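/- **Setting.** Let $1\le \ell\le n$, let $\sigma$ be an $n\times n$ integral matrix with columns $\sigma_1,\dots,\sigma_n$, and let $v\in\mathbb R^n$. Let $Z^\ell\subseteq\mathbb Z^n$ be the sublattice spanned by the first $\ell$ standard basis vectors, and let $\pi$ be the projection of an $n$-vector onto its first $\ell$ components. Let $\mathbf e(t)=e^{2\pi i t}$ and $\langle x,y\rangle=\sum x_iy_i$. The (properly embedded, rank $\ell$) Dedekind sum is $$S=S(Z^\ell,\sigma,\mathbf 1,v)=\sum_{x\in Z^\ell}{}^{'}\ \mathbf e(\langle x,v\rangle)\,\frac{\det\sigma}{\langle x,\sigma_1\rangle\cdots\langle x,\sigma_n\rangle},$$ where the prime means that the terms with vanishing denominator are omitted. Let $Q(y)=\prod_{i=1}^m Q_i(y)$, $m\ge1$, be a product of real linear forms $Q_i(y)=\sum_j Q_{ij}y_j$ on $\mathbb R^n$, none of which vanishes on $\mathbb Q^n\smallsetminus\{0\}$; write $Q$ also for the $m\times n$ matrix $(Q_{ij})$. The $Q$-limit of $S$ is $$S|_Q=\lim_{t\to\infty}\ \sum_{x\in Z^\ell,\ |Q(x)|<t}{}^{\!\!\!\!\!\!\!\!\!\!\!'}\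 \ \mathbf e(\langle x,v\rangle)\,\frac{\det\sigma}{\langle x,\sigma_1\rangle\cdots\langle x,\sigma_n\rangle};$$ it is *well defined* if each truncated sum converges absolutely and the limit exists. The sum $S$ is *normalized* if every $\pi(\sigma_j)\in\mathbb Z^\ell$ is primitive, and whenever $\pi(\sigma_i)$ and $\pi(\sigma_j)$ are proportional they are equal, and so are all $\pi(\sigma_k)$ with $k$ between $i$ and $j$. Partition $\{1,\dots,n\}$ into blocks $I_1,\dots,I_s$, labelled in order of occurrence, so that $i,j$ are in the same block if and only if $\pi(\sigma_i)=\pi(\sigma_j)$. Let $p_k=\#I_k$, and call $S$ *diagonal* if $s=\ell$. In that case let $\rho$ be the $\ell\times\ell$ matrix whose $k$-th column is $\pi(\sigma_j)$ for any $j\in I_k$. The sum $S$ is *unimodular* if the maximum of $|\det(\pi(\sigma_{i_1}),\dots,\pi(\sigma_{i_\ell}))|$ over $i_1<\dots<i_\ell$ equals $1$. Let $\mathscr B_e$ be the function of period $1$ that agrees with the Bernoulli polynomial $B_e$ on $(0,1)$, and for $e\geq2$ with $B_e(0)$ at the integers. For $p=(p_1,\dots,p_\ell)$, $u\in\mathbb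 R^\ell$ and a real $m\times\ell$ matrix $Q'$ put $J=\{j: p_j=1,\ u_j\in\mathbb Z\}$ and $$\mathbb B_p(u,Q')=\frac1m\sum_{i=1}^m\Bigl(\prod_{j\in J}\frac{\operatorname{sign}Q'_{ij}}2\Bigr)\prod_{j\notin J}\mathscr B_{p_j}(u_j)\quad\text{if }\#J\text{ is even},\qquad \mathbb B_p(u,Q')=0\quad\text{if }\#J\text{ is odd}.$$ **Proposition 3.6.** Let $S=S(Z^\ell,\sigma,\mathbf 1,v)$ be normalized and diagonal. Then $S|_Q$ is well defined. If $\det\sigma\ne0$, then $\det\rho\neq0$. Whenever $\det\rho\ne0$, the group $\mathbb Z^\ell/\rho\mathbb Z^\ell$ is finite and $$S(Z^\ell,\sigma,\mathbf 1,v)\big|_Q=\frac{\kappa\,\det\sigma}{|\det\rho|}\sum_{r\in\mathbb Z^\ell/\rho\mathbb Z^\ell}\mathbb B_p(u,Q'),\qquad u=\rho^{-1}(r+\pi(v)),\quad \kappa=\prod_{k=1}^\ell\Bigl(-\frac{(2\pi i)^{p_k}}{p_k!}\Bigr),$$ where $Q'=Q''\rho^{-t}$ and $Q''$ is the $m\times\ell$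 matrix of the restrictions of the forms $Q_i$ to the span of the first $\ell$ basis vectors. If $S$ is unimodular, then $\mathbb Z^\ell/\rho\mathbb Z^\ell$ has exactly one element and $$S(Z^\ell,\sigma,\mathbf 1,v)\big|_Q=\kappa\,\det\sigma\;\mathbb B_p\bigl(\rho^{-1}\pi(v),Q'\bigr).$$ -/

import Mathlib

namespace DedekindSum

open Filter Topology

/-- The additive character `𝐞(t) = exp (2πit)`. -/
noncomputable def character (t : ℝ) : ℂ :=
  Complex.exp (2 * (Real.pi : ℂ) * Complex.I * (t : ℂ))

/-- The denominator `⟨x, σ₁⟩ ^ e₁ ⋯ ⟨x, σₙ⟩ ^ eₙ`, where `σⱼ` is the `j`-th column of `σ`. -/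
def denominator {n : ℕ} (σ : Matrix (Fin n) (Fin n) ℤ) (e : Fin n → ℕ) (x : Fin n → ℤ) : ℤ :=
  ∏ j, (∑ i, x i * σ i j) ^ e j

/-- The general term `𝐞(⟨x, v⟩) · det σ / (⟨x, σ₁⟩ ^ e₁ ⋯ ⟨x, σₙ⟩ ^ eₙ)` of a Dedekind sum. -/
noncomputable def term {n : ℕ} (σ : Matrix (Fin n) (Fin n) ℤ) (e : Fin n → ℕ) (v : Fin n → ℝ)
    (x : Fin n → ℤ) : ℂ :=
  character (∑ i, (x i : ℝ) * v i) * (σ.det : ℂ) / (denominator σ e x : ℂ)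

/-- The value at `y` of the product of the `m` linear forms whose coefficients are the rows
of the matrix `Q`. -/
def productOfForms {m n : ℕ} (Q : Matrix (Fin m) (Fin n) ℝ) (y : Fin n → ℝ) : ℝ :=
  ∏ i, ∑ j, Q i j * y j

/-- The set of `x ∈ L` which contribute to the part `|Q(x)| < t` of the Dedekind sum:
the points where the denominator vanishes are omitted. -/
def truncation {m n : ℕ} (L : AddSubgroup (Fin n → ℤ)) (σ : Matrix (Fin n) (Fin n) ℤ)
    (e : Fin n → ℕ) (Q : Matrix (Fin m) (Fin n) ℝ) (t : ℝ) : Set (Fin n → ℤ) :=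
  {x | x ∈ L ∧ denominator σ e x ≠ 0 ∧ |productOfForms Q (fun i => (x i : ℝ))| < t}

/-- `S(L, σ, e, v)|_Q` is well defined and equal to `s`: every truncated sum over `|Q(x)| < t`
converges (absolutely), and these sums tend to `s` as `t → ∞`. -/
def HasQLimit {m n : ℕ} (L : AddSubgroup (Fin n → ℤ)) (σ : Matrix (Fin n) (Fin n) ℤ)
    (e : Fin n → ℕ) (v : Fin n → ℝ) (Q : Matrix (Fin m) (Fin n) ℝ) (s : ℂ) : Prop :=
  (∀ t : ℝ, Summable fun x : truncation L σ e Q t => term σ e v x) ∧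
    Tendsto (fun t : ℝ => ∑' x : truncation L σ e Q t, term σ e v x) atTop (𝓝 s)

/-- The sublattice of `ℤⁿ` spanned by the first `l` standard basis vectors. -/
def firstLattice (n l : ℕ) : AddSubgroup (Fin n → ℤ) where
  carrier := {x | ∀ i : Fin n, l ≤ (i : ℕ) → x i = 0}
  zero_mem' := fun _ _ => rfl
  add_mem' := fun {x y} hx hy i hi => by simp [hx i hi, hy i hi]
  neg_mem' := fun {x} hx i hi => by simp [hx i hi]

/-- The projection `π` onto the first `l` components. -/
def proj {α : Type*} {l n : ℕ} (h : l ≤ n) (x : Fin n → α) : Fin l → α :=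
  fun i => x (Fin.castLE h i)

/-- `π(σⱼ)`, which represents the linear form induced by the column `σⱼ` on the first `l`
coordinates. -/
def projCol {l n : ℕ} (h : l ≤ n) (σ : Matrix (Fin n) (Fin n) ℤ) (j : Fin n) : Fin l → ℤ :=
  proj h (fun i => σ i j)

/-- Normalized rank `l` sums: each `π(σⱼ)` is primitive, and columns which induce proportional
linear forms induce the same form and form a run of adjacent columns. -/
def IsNormalized {l n : ℕ} (h : l ≤ n) (σ : Matrix (Fin n) (Fin n) ℤ) : Prop :=
  (∀ j, Finset.univ.gcd (projCol h σ j) = 1) ∧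
    ∀ i j, (∃ c : ℝ, ∀ a, (projCol h σ i a : ℝ) = c * (projCol h σ j a : ℝ)) →
      projCol h σ i = projCol h σ j ∧
        ∀ k, i < k → k < j → projCol h σ k = projCol h σ i

/-- The first columns of the blocks of the partition of `{1, …, n}` in which `i` and `j`
lie in the same block if and only if `π(σᵢ) = π(σⱼ)`. There is one such column for
each block. -/
def leaders {l n : ℕ} (h : l ≤ n) (σ : Matrix (Fin n) (Fin n) ℤ) : Finset (Fin n) :=
  Finset.univ.filter fun j => ∀ i, i < j → projCol h σ i ≠ projCol h σ j

/-- A sum is diagonal if the number of blocks (the length of its type) is the rank `l`. -/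
def IsDiagonal {l n : ℕ} (h : l ≤ n) (σ : Matrix (Fin n) (Fin n) ℤ) : Prop :=
  (leaders h σ).card = l

/-- The first element of the block `I_k` of a diagonal sum; the blocks are labelled in the order
in which they occur among the columns. -/
def leader {l n : ℕ} (h : l ≤ n) (σ : Matrix (Fin n) (Fin n) ℤ) (hd : IsDiagonal h σ)
    (k : Fin l) : Fin n :=
  (leaders h σ).orderEmbOfFin hd k

/-- The type `(p₁, …, p_l)` of a diagonal sum: `p_k` is the number of elements of `I_k`. -/
def sumType {l n : ℕ} (h : l ≤ n) (σ : Matrix (Fin n) (Fin n) ℤ) (hd : IsDiagonal h σ)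
    (k : Fin l) : ℕ :=
  (Finset.univ.filter fun j => projCol h σ j = projCol h σ (leader h σ hd k)).card

/-- The matrix `ρ` whose `k`-th column is the common value of `π(σⱼ)`, `j ∈ I_k`. -/
def rho {l n : ℕ} (h : l ≤ n) (σ : Matrix (Fin n) (Fin n) ℤ) (hd : IsDiagonal h σ) :
    Matrix (Fin l) (Fin l) ℤ :=
  Matrix.of fun a k => projCol h σ (leader h σ hd k) a

open Classical in
/-- The index: the maximum of `|det (π(σ_{i₁}), …, π(σ_{i_l}))|` over `i₁ < ⋯ < i_l`. -/
noncomputable def index {l n : ℕ} (h : l ≤ n) (σ : Matrix (Fin n) (Fin n) ℤ) : ℕ :=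
  (Finset.univ.filter fun I : Fin l → Fin n => StrictMono I).sup fun I =>
    (Matrix.det (Matrix.of fun a k => projCol h σ (I k) a)).natAbs

/-- A sum is unimodular if its index is one. -/
def IsUnimodular {l n : ℕ} (h : l ≤ n) (σ : Matrix (Fin n) (Fin n) ℤ) : Prop :=
  index h σ = 1

/-- The function of period `1` which coincides with the Bernoulli polynomial `B_e` on `(0, 1)`.
(The value for `e = 1` at integers plays no role below.) -/
noncomputable def periodicBernoulli (e : ℕ) (x : ℝ) : ℝ :=
  bernoulliFun e (Int.fract x)

open Classical in
/-- The set `J` of those `j` for which `eⱼ = 1` and `uⱼ ∈ ℤ`. -/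
noncomputable def exceptional {l : ℕ} (e : Fin l → ℕ) (u : Fin l → ℝ) : Finset (Fin l) :=
  Finset.univ.filter fun j => e j = 1 ∧ ∃ k : ℤ, u j = k

open Classical in
/-- The function `𝔹_e(u, Q)`, for a matrix `Q` of `m` linear forms in `l` variables. -/
noncomputable def bernoulliQ {m l : ℕ} (e : Fin l → ℕ) (u : Fin l → ℝ)
    (Q : Matrix (Fin m) (Fin l) ℝ) : ℝ :=
  if Even (exceptional e u).card then
    (1 / (m : ℝ)) * ∑ i, (∏ j ∈ exceptional e u, Real.sign (Q i j) / 2) *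
      ∏ j ∈ (exceptional e u)ᶜ, periodicBernoulli (e j) (u j)
  else 0

theorem exceptional_add_int {l : ℕ} (e : Fin l → ℕ) (u : Fin l → ℝ) (z : Fin l → ℤ) :
    exceptional e (fun j => u j + (z j : ℝ)) = exceptional e u := by
  classical
  ext j
  simp only [exceptional, Finset.mem_filter, Finset.mem_univ, true_and]
  refine and_congr_right fun _ => ⟨?_, ?_⟩
  · rintro ⟨k, hk⟩
    exact ⟨k - z j, by push_cast; linarith⟩
  · rintro ⟨k, hk⟩
    exact ⟨k + z j, by push_cast; linarith⟩

theorem bernoulliQ_add_int {m l : ℕ} (e : Fin l → ℕ) (u : Fin l → ℝ) (z : Fin l → ℤ)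
    (Q : Matrix (Fin m) (Fin l) ℝ) :
    bernoulliQ e (fun j => u j + (z j : ℝ)) Q = bernoulliQ e u Q := by
  simp only [bernoulliQ, exceptional_add_int, periodicBernoulli, Int.fract_add_intCast]

/-- An integral matrix, regarded as a real matrix. -/
def realMatrix {l : ℕ} (ρ : Matrix (Fin l) (Fin l) ℤ) : Matrix (Fin l) (Fin l) ℝ :=
  ρ.map fun z => (z : ℝ)

/-- The vector `ρ⁻¹(r + w)`. -/
noncomputable def uVec {l : ℕ} (ρ : Matrix (Fin l) (Fin l) ℤ) (w : Fin l → ℝ)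
    (r : Fin l → ℤ) : Fin l → ℝ :=
  (realMatrix ρ)⁻¹.mulVec fun a => (r a : ℝ) + w a

/-- The matrix `Q'` of the linear forms `Q'' ∘ ρ⁻ᵗ`, where `Q''` consists of the restrictions
of the rows of `Q` to the span of the first `l` basis vectors. -/
noncomputable def transformedForms {l m n : ℕ} (h : l ≤ n) (ρ : Matrix (Fin l) (Fin l) ℤ)
    (Q : Matrix (Fin m) (Fin n) ℝ) : Matrix (Fin m) (Fin l) ℝ :=
  (Matrix.of fun i => proj h (Q i)) * ((realMatrix ρ).transpose)⁻¹

/-- The group `ℤˡ / ρℤˡ`. -/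
abbrev Cosets {l : ℕ} (ρ : Matrix (Fin l) (Fin l) ℤ) : Type :=
  (Fin l → ℤ) ⧸ LinearMap.range ρ.mulVecLin

theorem bernoulliQ_uVec_add {m l : ℕ} (ρ : Matrix (Fin l) (Fin l) ℤ) (p : Fin l → ℕ)
    (w : Fin l → ℝ) (Q : Matrix (Fin m) (Fin l) ℝ) (r z : Fin l → ℤ) :
    bernoulliQ p (uVec ρ w (r + ρ.mulVec z)) Q = bernoulliQ p (uVec ρ w r) Q := by
  by_cases hρ : IsUnit (realMatrix ρ).det
  · rw [← bernoulliQ_add_int p (uVec ρ w r) z Q]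
    congr 1
    have h1 : (fun a => (((r + ρ.mulVec z) a : ℤ) : ℝ) + w a) =
        (fun a => (r a : ℝ) + w a) + (realMatrix ρ).mulVec (fun j => (z j : ℝ)) := by
      funext a
      simp [realMatrix, Matrix.mulVec, dotProduct]
      ring
    unfold uVec
    rw [h1, Matrix.mulVec_add, Matrix.mulVec_mulVec, Matrix.nonsing_inv_mul _ hρ,
      Matrix.one_mulVec]
    rfl
  · simp [uVec, Matrix.nonsing_inv_apply_not_isUnit _ hρ]

/-- The function `r ↦ 𝔹_p(ρ⁻¹(r + w), Q)` on `ℤˡ / ρℤˡ`. -/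
noncomputable def cosetTerm {m l : ℕ} (ρ : Matrix (Fin l) (Fin l) ℤ) (p : Fin l → ℕ)
    (w : Fin l → ℝ) (Q : Matrix (Fin m) (Fin l) ℝ) (r : Cosets ρ) : ℝ :=
  Quotient.liftOn' r (fun r => bernoulliQ p (uVec ρ w r) Q) fun a b hab => by
    obtain ⟨z, hz⟩ := (Submodule.quotientRel_def _).1 hab
    rw [Matrix.mulVecLin_apply] at hz
    have : a = b + ρ.mulVec z := by rw [hz]; abel
    simp only [this, bernoulliQ_uVec_add]

/-- The constant `κ = ∏ₖ (-(2πi) ^ pₖ / pₖ!)`. -/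
noncomputable def kappa {l : ℕ} (p : Fin l → ℕ) : ℂ :=
  ∏ k, -((2 * (Real.pi : ℂ) * Complex.I) ^ p k) / ((p k).factorial : ℂ)

end DedekindSum

open DedekindSum

/-!
The sum is diagonal, so the substitution `y = ρᵗ x` turns the general term into a product
`∏ₖ 𝐞(yₖ uₖ) / yₖ ^ pₖ` of terms of Fourier series of periodic Bernoulli functions. The condition
`y ∈ ρᵗℤˡ` is removed by averaging over the characters of `ℤˡ / ρℤˡ`, which only shifts `u`. It
remains to show, for forms `Qᵢ` on `ℤˡ` which vanish at the origin only, that the sum over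
`|∏ᵢ Qᵢ(y)| < t` (`sharpSum`) tends to `κ 𝔹_p(u, Q)` (`tendsto_sharpSum`). If `det ρ = 0`, then
`det σ = 0` and there is nothing to prove.

*Absolute bounds.* The terms are bounded by `weight y = ∏ₖ 1 / |yₖ|`, which is not summable. But in
a strip `|Qᵢ(y)| ≤ T`, every line parallel to a coordinate axis contains `O(T)` lattice points, and
trading a part of the decay in the largest coordinate for additional decay in the others bounds the
total weight (`exists_sum_weight_le`). In the same way, the transition region
`T ^ m ≤ |∏ᵢ Qᵢ(y)| ≤ (1 + ε) T ^ m` contributes little, since a polynomial of degree `m` has its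
value in a short interval at few integers only.

*One form.* For a single form `q`, the sum with the weights `max (0, 1 - |q(y)| / T)` is an
average of products of Fourier series along the line `u + x q / T`, with respect to the Fejér
kernel in `x`. Since the Fourier series converge boundedly to functions with one-sided limits, it
converges to the mean of the limits at `u` from the two sides of the line (`sideMean`). The rate of
convergence and the bound for the transition region replace the weights by the sharp truncation
`|q(y)| < T` (`tendsto_stripSum`). The exceptional coordinates, at which the sawtooth function
jumps, contribute the factors `sign / 2`; these cancel in the mean if their number is odd.

*Several forms.* The truncation `|∏ᵢ Qᵢ(y)| < T ^ m` has the same limit as the mean of the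
truncations `|Qᵢ(y)| < T` (`tendsto_sharpSum_pow_sub`). With `wᵢ = log |Qᵢ(y)| - log T`, the
difference of the indicators is the derivative with respect to `log T` of
`(mean w)⁺ - mean (w⁺)` (`excess`), which as a function of `y / T` vanishes where all `|Qᵢ(y)|`
exceed `T`. Up to small errors it may be replaced by a Lipschitz function of compact support
in `y / T`, and the sum against such a function hardly depends on the scale `T`
(`exists_norm_sum_cube_scale_le`), as one sees in one variable by partial summation.
-/

namespace DedekindSum

open Filter Topology MeasureTheory

/-! ### Absolute bounds for lattice sums -/

/-- The weight `∏ 1 / |yₖ|`, which is zero as soon as a coordinate of `y` vanishes. It bounds the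
general term of every sum considered below. -/
noncomputable def weight {ι : Type*} [Fintype ι] (y : ι → ℤ) : ℝ := ∏ k, |(y k : ℝ)|⁻¹

section Weight

variable {ι : Type*} [Fintype ι]

theorem weight_nonneg (y : ι → ℤ) : 0 ≤ weight y :=
  Finset.prod_nonneg fun _ _ => inv_nonneg.2 (abs_nonneg _)

theorem weight_eq_zero {y : ι → ℤ} {k : ι} (h : y k = 0) : weight y = 0 :=
  Finset.prod_eq_zero (Finset.mem_univ k) (by simp [h])

theorem one_le_abs_cast {n : ℤ} (h : n ≠ 0) : (1 : ℝ) ≤ |(n : ℝ)| := by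
  exact_mod_cast Int.one_le_abs h

/-- If the `a`-th coordinate of `y` is the largest, a part of the decay in that coordinate can be
traded for additional decay in all the others. -/
theorem weight_le_of_max [DecidableEq ι] {θ Y : ℝ} (hθ : 0 < θ) (hθ1 : θ ≤ 1) (hY : 0 < Y)
    {y : ι → ℤ} (hy : ∀ k, y k ≠ 0) {a : ι} (hYa : Y ≤ |(y a : ℝ)|)
    (ha : ∀ k, |(y k : ℝ)| ≤ |(y a : ℝ)|) :
    weight y ≤ Y ^ (θ - 1) *
      ∏ k, if k = a then 1 else |(y k : ℝ)| ^ (-(1 + θ / Fintype.card ι)) := by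
  have hpos : ∀ k, 0 < |(y k : ℝ)| := fun k => lt_of_lt_of_le one_pos (one_le_abs_cast (hy k))
  have hcard : (0 : ℝ) < Fintype.card ι := by
    exact_mod_cast Fintype.card_pos_iff.2 ⟨a⟩
  set η := θ / Fintype.card ι with hη
  have hη0 : 0 < η := div_pos hθ hcard
  have h1 : |(y a : ℝ)|⁻¹ ≤ Y ^ (θ - 1) * ∏ k, |(y k : ℝ)| ^ (-η) := by
    have e1 : |(y a : ℝ)|⁻¹ = |(y a : ℝ)| ^ (θ - 1) * |(y a : ℝ)| ^ (-θ) := by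
      rw [← Real.rpow_add (hpos a), ← Real.rpow_neg_one]
      congr 1
      ring
    have e2 : |(y a : ℝ)| ^ (-θ) = ∏ _k : ι, |(y a : ℝ)| ^ (-η) := by
      rw [Finset.prod_const, ← Real.rpow_natCast, ← Real.rpow_mul (hpos a).le]
      congr 1
      rw [hη, Finset.card_univ]
      field_simp
    rw [e1, e2]
    refine mul_le_mul (Real.rpow_le_rpow_of_nonpos hY hYa (by linarith))
      (Finset.prod_le_prod (fun k _ => (Real.rpow_pos_of_pos (hpos a) _).le) fun k _ =>
        Real.rpow_le_rpow_of_nonpos (hpos k) (ha k) (by linarith))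
      (Finset.prod_nonneg fun k _ => (Real.rpow_pos_of_pos (hpos a) _).le)
      (Real.rpow_pos_of_pos hY _).le
  have h2 : ∏ k, |(y k : ℝ)| ^ (-η) ≤
      ∏ k, if k = a then 1 else |(y k : ℝ)| ^ (-η) := by
    refine Finset.prod_le_prod (fun k _ => (Real.rpow_pos_of_pos (hpos k) _).le) fun k _ => ?_
    split_ifs with hk
    · exact Real.rpow_le_one_of_one_le_of_nonpos (one_le_abs_cast (hy k)) (by linarith)
    · exact le_rfl
  have h3 : weight y = |(y a : ℝ)|⁻¹ * ∏ k, if k = a then 1 else |(y k : ℝ)|⁻¹ := by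
    rw [weight, ← Finset.mul_prod_erase _ _ (Finset.mem_univ a),
      ← Finset.mul_prod_erase (s := Finset.univ)
        (f := fun k => if k = a then (1 : ℝ) else |(y k : ℝ)|⁻¹) (Finset.mem_univ a)]
    simp only [if_true, one_mul]
    congr 1
    refine Finset.prod_congr rfl fun k hk => ?_
    rw [if_neg (Finset.ne_of_mem_erase hk)]
  have h4 : (∏ k, if k = a then 1 else |(y k : ℝ)| ^ (-(1 + η))) =
      (∏ k, if k = a then (1 : ℝ) else |(y k : ℝ)| ^ (-η)) *
        ∏ k, if k = a then 1 else |(y k : ℝ)|⁻¹ := by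
    rw [← Finset.prod_mul_distrib]
    refine Finset.prod_congr rfl fun k _ => ?_
    split_ifs with hk
    · simp
    · rw [← Real.rpow_neg_one, ← Real.rpow_add (hpos k)]
      congr 1
      ring
  rw [h3, h4, ← mul_assoc]
  refine mul_le_mul_of_nonneg_right (h1.trans
    (mul_le_mul_of_nonneg_left h2 (Real.rpow_pos_of_pos hY _).le))
    (Finset.prod_nonneg fun k _ => ?_)
  split_ifs
  · exact zero_le_one
  · positivity

/-- The basic estimate: if every line parallel to a coordinate axis contains at most `X` points
of `A`, and every point of `A` has a coordinate of size at least `Y`, then the total weight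
of `A` is `O(X Y ^ (θ - 1))`. -/
theorem exists_sum_weight_le [DecidableEq ι] {θ : ℝ} (hθ : 0 < θ) (hθ1 : θ ≤ 1) :
    ∃ C : ℝ, 0 ≤ C ∧ ∀ (A : Finset (ι → ℤ)) (X Y : ℝ), 0 < Y → 0 ≤ X →
      (∀ y ∈ A, ∃ a, Y ≤ |(y a : ℝ)|) →
      (∀ (a : ι) (z : ι → ℤ) (s : Finset ℤ), (∀ n ∈ s, Function.update z a n ∈ A) →
        (s.card : ℝ) ≤ X) →
      ∑ y ∈ A, weight y ≤ C * X * Y ^ (θ - 1) := by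
  set η := θ / Fintype.card ι with hη
  set S := ∑' n : ℤ, |(n : ℝ)| ^ (-(1 + η)) with hS
  have hS0 : 0 ≤ S := tsum_nonneg fun n => Real.rpow_nonneg (abs_nonneg _) _
  refine ⟨Fintype.card ι * (1 + S) ^ Fintype.card ι, by positivity, ?_⟩
  intro A X Y hY hX hmax hfib
  have hYp : 0 < Y ^ (θ - 1) := Real.rpow_pos_of_pos hY _
  -- the bound for points whose largest coordinate is the `a`-th; it does not depend on `z a`
  let f : ι → (ι → ℤ) → ℝ := fun a z =>
    ∏ k, if k = a then (1 : ℝ) else |(z k : ℝ)| ^ (-(1 + η))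
  have hf0 : ∀ a z, 0 ≤ f a z := fun a z => Finset.prod_nonneg fun k _ => by
    split_ifs
    · exact zero_le_one
    · exact Real.rpow_nonneg (abs_nonneg _) _
  have hpt : ∀ y ∈ A, weight y ≤ ∑ a, Y ^ (θ - 1) * f a y := by
    intro y hyA
    by_cases hy : ∀ k, y k ≠ 0
    · obtain ⟨b, hb⟩ := hmax y hyA
      obtain ⟨a, -, ha⟩ := Finset.exists_max_image Finset.univ (fun k => |(y k : ℝ)|)
        ⟨b, Finset.mem_univ b⟩
      refine (weight_le_of_max hθ hθ1 hY hy (hb.trans (ha b (Finset.mem_univ b)))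
        fun k => ha k (Finset.mem_univ k)).trans ?_
      exact Finset.single_le_sum (f := fun a => Y ^ (θ - 1) * f a y)
        (fun a _ => mul_nonneg hYp.le (hf0 a y)) (Finset.mem_univ a)
    · push Not at hy
      obtain ⟨k, hk⟩ := hy
      rw [weight_eq_zero hk]
      exact Finset.sum_nonneg fun a _ => mul_nonneg hYp.le (hf0 a y)
  have hsum : ∀ a, ∑ y ∈ A, f a y ≤ X * (1 + S) ^ Fintype.card ι := by
    intro a
    have hη0 : 0 < η := div_pos hθ (by exact_mod_cast Fintype.card_pos_iff.2 ⟨a⟩)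
    have hsummable : Summable fun n : ℤ => |(n : ℝ)| ^ (-(1 + η)) :=
      Real.summable_abs_int_rpow (by linarith)
    let π : (ι → ℤ) → (ι → ℤ) := fun y => Function.update y a 0
    have e1 : ∀ y, f a y = f a (π y) := fun y => Finset.prod_congr rfl fun k _ => by
      by_cases hk : k = a
      · simp [hk]
      · simp [hk, π]
    -- the fibres of `π` are lines parallel to the `a`-th axis
    rw [Finset.sum_congr rfl fun y _ => e1 y, Finset.sum_comp (f a) π]
    have e2 : ∀ z ∈ A.image π, (A.filter fun y => π y = z).card • f a z ≤ X * f a z := by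
      intro z _
      rw [nsmul_eq_mul]
      refine mul_le_mul_of_nonneg_right ?_ (hf0 a z)
      have hup : ∀ y ∈ A.filter (fun y => π y = z), Function.update z a (y a) = y := by
        intro y hy
        rw [← (Finset.mem_filter.1 hy).2]
        simp [π]
      rw [← Finset.card_image_of_injOn (f := fun y : ι → ℤ => y a)
        (s := A.filter fun y => π y = z)]
      · refine hfib a z _ fun n hn => ?_
        obtain ⟨y, hy, rfl⟩ := Finset.mem_image.1 hn
        rw [hup y hy]
        exact (Finset.mem_filter.1 hy).1
      · intro y hy y' hy' h
        have h' : y a = y' a := h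
        rw [← hup y hy, ← hup y' hy', h']
    refine (Finset.sum_le_sum e2).trans ?_
    rw [← Finset.mul_sum]
    refine mul_le_mul_of_nonneg_left ?_ hX
    let t : ι → Finset ℤ := fun k => if k = a then {0} else A.image fun y => y k
    have e3 : A.image π ⊆ Fintype.piFinset t := by
      intro z hz
      obtain ⟨y, hy, rfl⟩ := Finset.mem_image.1 hz
      refine Fintype.mem_piFinset.2 fun k => ?_
      by_cases hk : k = a
      · subst hk; simp [t, π]
      · simp only [t, hk, if_false, π, ne_eq, not_false_eq_true, Function.update_of_ne]
        exact Finset.mem_image_of_mem _ hy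
    refine (Finset.sum_le_sum_of_subset_of_nonneg e3 fun z _ _ => hf0 a z).trans ?_
    have e4 := (Finset.prod_univ_sum t
      (fun k (n : ℤ) => if k = a then (1 : ℝ) else |(n : ℝ)| ^ (-(1 + η)))).symm
    refine e4.le.trans ?_
    rw [← Finset.card_univ, ← Finset.prod_const]
    refine Finset.prod_le_prod (fun k _ => Finset.sum_nonneg fun n _ => ?_) fun k _ => ?_
    · split_ifs
      · exact zero_le_one
      · exact Real.rpow_nonneg (abs_nonneg _) _
    · by_cases hk : k = a
      · simp [t, hk, hS0]
      · simp only [hk, if_false]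
        have := hsummable.sum_le_tsum (t k) fun n _ => Real.rpow_nonneg (abs_nonneg _) _
        linarith
  calc ∑ y ∈ A, weight y ≤ ∑ y ∈ A, ∑ a, Y ^ (θ - 1) * f a y := Finset.sum_le_sum hpt
    _ = Y ^ (θ - 1) * ∑ a, ∑ y ∈ A, f a y := by
        rw [Finset.sum_comm, Finset.mul_sum]
        exact Finset.sum_congr rfl fun a _ => (Finset.mul_sum _ _ _).symm
    _ ≤ Y ^ (θ - 1) * ∑ _a : ι, X * (1 + S) ^ Fintype.card ι :=
        mul_le_mul_of_nonneg_left (Finset.sum_le_sum fun a _ => hsum a) hYp.le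
    _ = _ := by
        rw [Finset.sum_const, nsmul_eq_mul, Finset.card_univ]
        ring

end Weight

/-! ### Counting integers at which a product of linear forms is almost constant -/

theorem card_le_of_abs_linear_le {q b T : ℝ} (hq : q ≠ 0) (hT : 0 ≤ T) (s : Finset ℤ)
    (hs : ∀ n ∈ s, |q * n + b| ≤ T) : (s.card : ℝ) ≤ 2 * T / |q| + 1 := by
  have hq' : 0 < |q| := abs_pos.2 hq
  rcases s.eq_empty_or_nonempty with rfl | hne
  · simp only [Finset.card_empty, Nat.cast_zero]; positivity
  have h1 := hs _ (s.min'_mem hne)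
  have h2 := hs _ (s.max'_mem hne)
  have h3 : s ⊆ Finset.Icc (s.min' hne) (s.max' hne) := fun n hn =>
    Finset.mem_Icc.2 ⟨s.min'_le n hn, s.le_max' n hn⟩
  have h4 := Finset.card_le_card h3
  rw [Int.card_Icc] at h4
  have hle : s.min' hne ≤ s.max' hne := s.min'_le _ (s.max'_mem hne)
  have h5 : (s.card : ℝ) ≤ (s.max' hne : ℝ) - s.min' hne + 1 := by
    have : (s.card : ℤ) ≤ s.max' hne + 1 - s.min' hne := by omega
    have : ((s.card : ℤ) : ℝ) ≤ ((s.max' hne + 1 - s.min' hne : ℤ) : ℝ) := by exact_mod_cast this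
    push_cast at this
    linarith
  have h6 : |q| * ((s.max' hne : ℝ) - s.min' hne) ≤ 2 * T := by
    have hle' : (0 : ℝ) ≤ (s.max' hne : ℝ) - s.min' hne := by
      rw [sub_nonneg]; exact_mod_cast hle
    rw [← abs_of_nonneg hle', ← abs_mul]
    have : q * ((s.max' hne : ℝ) - s.min' hne) =
        (q * s.max' hne + b) - (q * s.min' hne + b) := by ring
    rw [this]
    exact (abs_sub _ _).trans (by linarith)
  have h7 : (s.max' hne : ℝ) - s.min' hne ≤ 2 * T / |q| := by
    rw [le_div_iff₀ hq']; linarith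
  linarith

theorem add_le_of_strictMono_fin {N : ℕ} {e : Fin N → ℤ} (he : StrictMono e) (i d : ℕ)
    (h : i + d < N) : e ⟨i, by omega⟩ + d ≤ e ⟨i + d, h⟩ := by
  induction d with
  | zero => simp
  | succ d ih =>
    have h1 := ih (by omega)
    have h2 : e ⟨i + d, by omega⟩ < e ⟨i + (d + 1), h⟩ :=
      he (Fin.mk_lt_mk.2 (by omega))
    push_cast
    omega

/-- If the values of a polynomial of degree `m` at the integers of `s` vary by at most `h`, then
the number of these integers is bounded in terms of `h`, by the formula for the leading coefficient
as a divided difference at `m + 1` well spaced points. -/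
theorem card_le_of_abs_eval_sub_le {m : ℕ} (hm : 1 ≤ m) (P : Polynomial ℝ) (hP : P.natDegree = m)
    {α h : ℝ} (hh : 0 ≤ h) (s : Finset ℤ) (hs : ∀ n ∈ s, |P.eval (n : ℝ) - α| ≤ h) :
    (s.card : ℝ) ≤ m * (1 + ((m + 1) * h / |P.leadingCoeff|) ^ (1 / (m : ℝ))) := by
  have hm' : (0 : ℝ) < m := by exact_mod_cast hm
  have hP0 : P ≠ 0 := by
    rintro rfl
    simp at hP
    omega
  have hlc : 0 < |P.leadingCoeff| := abs_pos.2 (Polynomial.leadingCoeff_ne_zero.2 hP0)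
  set X := (m + 1) * h / |P.leadingCoeff| with hX
  have hX0 : 0 ≤ X := by positivity
  set N := s.card with hN
  -- taking every `g`-th element of `s` gives `m + 1` points at mutual distances at least `g`
  set g := (N - 1) / m with hg
  have hNg : N ≤ m * (g + 1) := by
    have := Nat.lt_mul_div_succ (N - 1) (by omega : 0 < m)
    rw [← hg] at this
    omega
  have hgX : (g : ℝ) ≤ X ^ (1 / (m : ℝ)) := by
    rcases Nat.eq_zero_or_pos g with h0 | hg0
    · rw [h0, Nat.cast_zero]
      positivity
    have hgN : g * m ≤ N - 1 := Nat.div_mul_le_self _ _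
    have hN1 : 1 ≤ N := by
      by_contra hlt
      have : N = 0 := by omega
      rw [hg, this] at hg0
      simp at hg0
    have hidx : ∀ j ∈ Finset.range (m + 1), j * g < N := fun j hj => by
      have : j * g ≤ m * g := Nat.mul_le_mul_right _ (by have := Finset.mem_range.1 hj; omega)
      rw [mul_comm m g] at this
      omega
    let v : ℕ → ℝ := fun j => if hj : j * g < N then (s.orderEmbOfFin rfl ⟨j * g, hj⟩ : ℝ) else 0
    have hgap : ∀ j ∈ Finset.range (m + 1), ∀ k ∈ Finset.range (m + 1), j < k →
        (g : ℝ) ≤ v k - v j := by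
      intro j hj k hk hjk
      obtain ⟨d, rfl⟩ := Nat.exists_eq_add_of_lt hjk
      have hkN := hidx _ hk
      simp only [v, dif_pos (hidx j hj), dif_pos hkN]
      have h1 := add_le_of_strictMono_fin (s.orderEmbOfFin rfl).strictMono (j * g) ((d + 1) * g)
        (by rw [← add_mul]; exact hkN)
      have h2 : (⟨j * g + (d + 1) * g, by rw [← add_mul]; exact hkN⟩ : Fin N) =
          ⟨(j + d + 1) * g, hkN⟩ := Fin.ext (by simp only; ring)
      rw [h2] at h1
      have h3 : (g : ℤ) ≤ ((d + 1) * g : ℕ) := by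
        exact_mod_cast Nat.le_mul_of_pos_left g (Nat.succ_pos d)
      have h4 : (g : ℤ) ≤ s.orderEmbOfFin rfl ⟨(j + d + 1) * g, hkN⟩ -
          s.orderEmbOfFin rfl ⟨j * g, hidx j hj⟩ := by linarith
      exact_mod_cast h4
    have hg0' : (0 : ℝ) < g := by exact_mod_cast hg0
    have habs : ∀ j ∈ Finset.range (m + 1), ∀ k ∈ Finset.range (m + 1), k ≠ j →
        (g : ℝ) ≤ |v j - v k| := by
      intro j hj k hk hkj
      rcases lt_or_gt_of_ne hkj with h1 | h1
      · exact (hgap k hk j hj h1).trans (le_abs_self _)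
      · rw [abs_sub_comm]
        exact (hgap j hj k hk h1).trans (le_abs_self _)
    have hinj : Set.InjOn v (Finset.range (m + 1)) := by
      intro j hj k hk hjk
      by_contra hne
      have := habs j hj k hk (Ne.symm hne)
      rw [hjk, sub_self, abs_zero] at this
      linarith
    have hdeg : (P - Polynomial.C α).natDegree = m := by
      rw [Polynomial.natDegree_sub_C, hP]
    have hcoeff : (P - Polynomial.C α).coeff m = P.leadingCoeff := by
      rw [Polynomial.coeff_sub, Polynomial.coeff_C_of_ne_zero (by omega), sub_zero,
        Polynomial.leadingCoeff, hP]
    have hsum := Lagrange.coeff_eq_sum (P := P - Polynomial.C α) hinj (by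
      rw [Finset.card_range]
      refine lt_of_le_of_lt Polynomial.degree_le_natDegree ?_
      rw [hdeg]
      exact_mod_cast Nat.lt_succ_self m)
    rw [Finset.card_range, Nat.add_sub_cancel, hcoeff] at hsum
    have hbound : |P.leadingCoeff| ≤ ∑ _j ∈ Finset.range (m + 1), h / (g : ℝ) ^ m := by
      rw [hsum]
      refine (Finset.abs_sum_le_sum_abs _ _).trans (Finset.sum_le_sum fun j hj => ?_)
      rw [abs_div, Finset.abs_prod]
      have h1 : |(P - Polynomial.C α).eval (v j)| ≤ h := by
        rw [Polynomial.eval_sub, Polynomial.eval_C]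
        simp only [v, dif_pos (hidx j hj)]
        exact hs _ (s.orderEmbOfFin_mem rfl _)
      have h2 : (g : ℝ) ^ m ≤ ∏ k ∈ (Finset.range (m + 1)).erase j, |v j - v k| := by
        have hc : ((Finset.range (m + 1)).erase j).card = m := by
          rw [Finset.card_erase_of_mem hj, Finset.card_range, Nat.add_sub_cancel]
        calc (g : ℝ) ^ m = ∏ _k ∈ (Finset.range (m + 1)).erase j, (g : ℝ) := by
              rw [Finset.prod_const, hc]
          _ ≤ _ := Finset.prod_le_prod (fun _ _ => hg0'.le) fun k hk =>
              habs j hj k (Finset.mem_of_mem_erase hk) (Finset.ne_of_mem_erase hk)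
      exact div_le_div₀ hh h1 (by positivity) h2
    rw [Finset.sum_const, Finset.card_range, nsmul_eq_mul, mul_div_assoc',
      le_div_iff₀ (by positivity)] at hbound
    have hpow : (g : ℝ) ^ m ≤ X := by
      rw [hX, le_div_iff₀ hlc]
      push_cast at hbound
      linarith
    calc (g : ℝ) = ((g : ℝ) ^ (m : ℝ)) ^ (1 / (m : ℝ)) := by
          rw [← Real.rpow_mul hg0'.le, mul_one_div_cancel hm'.ne', Real.rpow_one]
      _ ≤ X ^ (1 / (m : ℝ)) := by
          rw [Real.rpow_natCast]
          exact Real.rpow_le_rpow (by positivity) hpow (by positivity)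
  calc (N : ℝ) ≤ m * (g + 1) := by exact_mod_cast hNg
    _ ≤ _ := by
        rw [add_comm]
        gcongr

/-- A product of `m` linear functions `qᵢ n + bᵢ` has absolute value in a short interval
`[t, t + h]` for few integers `n` only. -/
theorem card_le_of_abs_prod_mem {m : ℕ} (hm : 1 ≤ m) {q b : Fin m → ℝ} (hq : ∀ i, q i ≠ 0)
    {t h : ℝ} (hh : 0 ≤ h) (s : Finset ℤ)
    (hs : ∀ n ∈ s, t ≤ |∏ i, (q i * n + b i)| ∧ |∏ i, (q i * n + b i)| ≤ t + h) :
    (s.card : ℝ) ≤ 2 * (m * (1 + ((m + 1) * h / |∏ i, q i|) ^ (1 / (m : ℝ)))) := by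
  let P : Polynomial ℝ := ∏ i, (Polynomial.C (q i) * Polynomial.X + Polynomial.C (b i))
  have heval : ∀ x : ℝ, P.eval x = ∏ i, (q i * x + b i) := fun x => by
    simp [P, Polynomial.eval_prod]
  have hfac : ∀ i, (Polynomial.C (q i) * Polynomial.X + Polynomial.C (b i)).natDegree = 1 :=
    fun i => Polynomial.natDegree_linear (hq i)
  have hlead : P.leadingCoeff = ∏ i, q i := by
    simp only [P, Polynomial.leadingCoeff_prod]
    exact Finset.prod_congr rfl fun i _ => Polynomial.leadingCoeff_linear (hq i)
  have hdeg : P.natDegree = m := by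
    simp only [P]
    rw [Polynomial.natDegree_prod _ _ fun i _ h0 => by
      have := hfac i
      rw [h0] at this
      simp at this]
    simp [hfac]
  have key : ∀ (α : ℝ) (s' : Finset ℤ), (∀ n ∈ s', |P.eval (n : ℝ) - α| ≤ h) →
      (s'.card : ℝ) ≤ m * (1 + ((m + 1) * h / |∏ i, q i|) ^ (1 / (m : ℝ))) := by
    intro α s' h'
    rw [← hlead]
    exact card_le_of_abs_eval_sub_le hm P hdeg hh s' h'
  rw [← Finset.card_filter_add_card_filter_not (s := s) (fun n : ℤ => 0 ≤ P.eval (n : ℝ))]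
  push_cast
  rw [two_mul]
  refine add_le_add (key t _ fun n hn => ?_) (key (-t) _ fun n hn => ?_)
  · obtain ⟨hn, h0⟩ := Finset.mem_filter.1 hn
    have := hs n hn
    rw [← heval, abs_of_nonneg h0] at this
    rw [abs_le]
    constructor <;> linarith
  · obtain ⟨hn, h0⟩ := Finset.mem_filter.1 hn
    have := hs n hn
    rw [← heval, abs_of_neg (not_le.1 h0)] at this
    rw [abs_le]
    constructor <;> linarith

/-! ### Weights of strips and of transition regions -/

section Forms

variable {ι : Type*} [Fintype ι]

/-- The value at the lattice point `y` of the linear form with coefficients `q`. -/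
def latticeForm (q : ι → ℝ) (y : ι → ℤ) : ℝ := ∑ j, q j * y j

theorem latticeForm_update [DecidableEq ι] (q : ι → ℝ) (z : ι → ℤ) (a : ι) (n : ℤ) :
    latticeForm q (Function.update z a n) =
      q a * n + latticeForm q (Function.update z a 0) := by
  have h : ∀ n : ℤ, latticeForm q (Function.update z a n) =
      q a * n + ∑ j ∈ Finset.univ.erase a, q j * z j := by
    intro n
    rw [latticeForm, ← Finset.add_sum_erase _ _ (Finset.mem_univ a), Function.update_self]
    congr 1
    refine Finset.sum_congr rfl fun j hj => ?_
    rw [Function.update_of_ne (Finset.ne_of_mem_erase hj)]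
  rw [h n, h 0]
  simp

theorem abs_latticeForm_le (q : ι → ℝ) (y : ι → ℤ) {B : ℝ} (hy : ∀ k, |(y k : ℝ)| ≤ B) :
    |latticeForm q y| ≤ (∑ j, |q j|) * B := by
  rw [latticeForm, Finset.sum_mul]
  refine (Finset.abs_sum_le_sum_abs _ _).trans (Finset.sum_le_sum fun j _ => ?_)
  rw [abs_mul]
  exact mul_le_mul_of_nonneg_left (hy j) (abs_nonneg _)

theorem coeff_ne_zero_of_nonvanishing [DecidableEq ι] {q : ι → ℝ}
    (hq : ∀ y : ι → ℤ, y ≠ 0 → latticeForm q y ≠ 0) (j : ι) : q j ≠ 0 := by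
  have h := hq (Pi.single j 1) (by
    intro h
    have := congrFun h j
    simp at this)
  intro h0
  apply h
  rw [latticeForm, Finset.sum_eq_single j]
  · simp [h0]
  · intro k _ hk
    simp [hk]
  · simp

/-- The part of a strip `|qᵢ(y)| ≤ T` which lies at distance at least `Y` from the origin. -/
theorem exists_sum_weight_strip_le [DecidableEq ι] {m : ℕ} {Q : Fin m → ι → ℝ}
    (hQ : ∀ i j, Q i j ≠ 0) {θ : ℝ} (hθ : 0 < θ) (hθ1 : θ ≤ 1) :
    ∃ C : ℝ, 0 ≤ C ∧ ∀ (A : Finset (ι → ℤ)) (T Y : ℝ), 1 ≤ T → 0 < Y →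
      (∀ y ∈ A, ∃ i, |latticeForm (Q i) y| ≤ T) → (∀ y ∈ A, ∃ a, Y ≤ |(y a : ℝ)|) →
      ∑ y ∈ A, weight y ≤ C * T * Y ^ (θ - 1) := by
  obtain ⟨C, hC0, hC⟩ := exists_sum_weight_le (ι := ι) hθ hθ1
  set K : ℝ := ∑ a, ∑ i, (2 / |Q i a| + 1) with hK
  have hK0 : 0 ≤ K := Finset.sum_nonneg fun a _ => Finset.sum_nonneg fun i _ => by positivity
  refine ⟨C * K, by positivity, fun A T Y hT hY hA hAY => ?_⟩
  have hT0 : 0 ≤ T := by linarith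
  have := hC A (K * T) Y hY (by positivity) hAY fun a z s hs => ?_
  · calc _ ≤ _ := this
      _ = _ := by ring
  · have hcover : s ⊆ Finset.univ.biUnion fun i =>
        s.filter fun n => |latticeForm (Q i) (Function.update z a n)| ≤ T := by
      intro n hn
      obtain ⟨i, hi⟩ := hA _ (hs n hn)
      exact Finset.mem_biUnion.2 ⟨i, Finset.mem_univ i, Finset.mem_filter.2 ⟨hn, hi⟩⟩
    have h1 : (s.card : ℝ) ≤ ∑ i,
        ((s.filter fun n => |latticeForm (Q i) (Function.update z a n)| ≤ T).card : ℝ) := by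
      exact_mod_cast (Finset.card_le_card hcover).trans Finset.card_biUnion_le
    have h2 : ∀ i, ((s.filter fun n =>
        |latticeForm (Q i) (Function.update z a n)| ≤ T).card : ℝ) ≤ (2 / |Q i a| + 1) * T := by
      intro i
      have := card_le_of_abs_linear_le (hQ i a) hT0
        (b := latticeForm (Q i) (Function.update z a 0))
        (s.filter fun n => |latticeForm (Q i) (Function.update z a n)| ≤ T) fun n hn => by
          rw [← latticeForm_update]
          exact (Finset.mem_filter.1 hn).2
      refine this.trans ?_
      rw [add_mul, one_mul, div_mul_eq_mul_div]
      linarith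
    refine h1.trans ((Finset.sum_le_sum fun i _ => h2 i).trans ?_)
    rw [← Finset.sum_mul]
    refine mul_le_mul_of_nonneg_right ?_ hT0
    exact Finset.single_le_sum (f := fun a => ∑ i, (2 / |Q i a| + 1))
      (fun a _ => Finset.sum_nonneg fun i _ => by positivity) (Finset.mem_univ a)

/-- The region in which `|Q(y)|` lies between `T ^ m` and `(1 + ε) T ^ m`. -/
theorem exists_sum_weight_transition_le [DecidableEq ι] {m : ℕ} (hm : 1 ≤ m)
    {Q : Fin m → ι → ℝ} (hQ : ∀ i j, Q i j ≠ 0) {θ : ℝ} (hθ : 0 < θ) (hθ1 : θ ≤ 1) :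
    ∃ C : ℝ, 0 ≤ C ∧ ∀ (A : Finset (ι → ℤ)) (T ε : ℝ), 0 < T → 0 ≤ ε →
      (∀ y ∈ A, T ^ m ≤ |∏ i, latticeForm (Q i) y| ∧
        |∏ i, latticeForm (Q i) y| ≤ T ^ m * (1 + ε)) →
      ∑ y ∈ A, weight y ≤ C * (1 + ε ^ (1 / (m : ℝ)) * T) * T ^ (θ - 1) := by
  obtain ⟨C, hC0, hC⟩ := exists_sum_weight_le (ι := ι) hθ hθ1
  have hm' : (0 : ℝ) < m := by exact_mod_cast hm
  let c : ι → ℝ := fun a => ((m + 1) / |∏ i, Q i a|) ^ (1 / (m : ℝ))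
  have hc0 : ∀ a, 0 ≤ c a := fun a => by positivity
  set K : ℝ := ∑ a, 2 * (m * (1 + c a)) with hK
  have hK0 : 0 ≤ K := Finset.sum_nonneg fun a _ => by have := hc0 a; positivity
  set R : ℝ := 1 + ∑ i, ∑ j, |Q i j| with hR
  have hR0 : 0 < R := by
    have : 0 ≤ ∑ i, ∑ j, |Q i j| :=
      Finset.sum_nonneg fun i _ => Finset.sum_nonneg fun j _ => abs_nonneg _
    linarith
  refine ⟨C * K * R⁻¹ ^ (θ - 1), by positivity, fun A T ε hT hε hA => ?_⟩
  have hY : 0 < R⁻¹ * T := by positivity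
  -- all forms are smaller than `T` near the origin
  have hfar : ∀ y ∈ A, ∃ a, R⁻¹ * T ≤ |(y a : ℝ)| := by
    intro y hy
    by_contra hlt
    push Not at hlt
    have h1 : ∀ i, |latticeForm (Q i) y| < T := by
      intro i
      refine (abs_latticeForm_le (Q i) y fun k => (hlt k).le).trans_lt ?_
      have h2 : ∑ j, |Q i j| < R := by
        have := Finset.single_le_sum (f := fun i => ∑ j, |Q i j|)
          (fun i _ => Finset.sum_nonneg fun j _ => abs_nonneg _) (Finset.mem_univ i)
        rw [hR]
        linarith
      calc (∑ j, |Q i j|) * (R⁻¹ * T) < R * (R⁻¹ * T) := mul_lt_mul_of_pos_right h2 hY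
        _ = T := by field_simp
    have h3 : |∏ i, latticeForm (Q i) y| < T ^ m := by
      rw [Finset.abs_prod]
      have : Nonempty (Fin m) := ⟨⟨0, hm⟩⟩
      calc ∏ i, |latticeForm (Q i) y| < ∏ _i : Fin m, T := by
            rcases em (∃ i, latticeForm (Q i) y = 0) with ⟨i, hi⟩ | hne
            · rw [Finset.prod_eq_zero (Finset.mem_univ i) (by rw [hi, abs_zero])]
              exact Finset.prod_pos fun _ _ => hT
            · push Not at hne
              exact Finset.prod_lt_prod_of_nonempty (fun i _ => abs_pos.2 (hne i))
                (fun i _ => h1 i) Finset.univ_nonempty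
        _ = T ^ m := by simp
    exact absurd (hA y hy).1 (not_le.2 h3)
  have hE0 : 0 ≤ ε ^ (1 / (m : ℝ)) * T := by positivity
  have := hC A (K * (1 + ε ^ (1 / (m : ℝ)) * T)) (R⁻¹ * T) hY (by positivity) hfar
    fun a z s hs => ?_
  · rw [Real.mul_rpow (by positivity) hT.le] at this
    calc _ ≤ _ := this
      _ = _ := by ring
  · have h1 := card_le_of_abs_prod_mem hm (q := fun i => Q i a)
      (b := fun i => latticeForm (Q i) (Function.update z a 0)) (fun i => hQ i a)
      (t := T ^ m) (h := T ^ m * ε) (by positivity) s fun n hn => by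
        have := hA _ (hs n hn)
        simp only [latticeForm_update (Q _) z a n] at this
        rwa [mul_add, mul_one] at this
    have h2 : ((m + 1) * (T ^ m * ε) / |∏ i, Q i a|) ^ (1 / (m : ℝ)) =
        c a * (ε ^ (1 / (m : ℝ)) * T) := by
      have : (m + 1) * (T ^ m * ε) / |∏ i, Q i a| =
          ((m + 1) / |∏ i, Q i a|) * (ε * T ^ m) := by ring
      rw [this, Real.mul_rpow (by positivity) (by positivity),
        Real.mul_rpow hε (by positivity), ← Real.rpow_natCast T, ← Real.rpow_mul hT.le,
        mul_one_div_cancel hm'.ne', Real.rpow_one]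
    rw [h2] at h1
    refine h1.trans ?_
    have h3 : 2 * (m * (1 + c a)) ≤ K :=
      Finset.single_le_sum (f := fun a => 2 * ((m : ℝ) * (1 + c a)))
        (fun a _ => by have := hc0 a; positivity) (Finset.mem_univ a)
    refine le_trans ?_ (mul_le_mul_of_nonneg_right h3 (by positivity))
    have h4 : 1 + c a * (ε ^ (1 / (m : ℝ)) * T) ≤
        (1 + c a) * (1 + ε ^ (1 / (m : ℝ)) * T) := by
      have := hc0 a
      nlinarith
    calc 2 * (m * (1 + c a * (ε ^ (1 / (m : ℝ)) * T)))
        ≤ 2 * (m * ((1 + c a) * (1 + ε ^ (1 / (m : ℝ)) * T))) := by gcongr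
      _ = _ := by ring

/-- A function which is dominated by the weight and supported in a set of finite total weight
is absolutely summable. -/
theorem summable_and_norm_tsum_le {f : (ι → ℤ) → ℂ} {S : Set (ι → ℤ)} {c b : ℝ}
    (hc : 0 ≤ c) (hf : ∀ y ∈ S, ‖f y‖ ≤ c * weight y) (hS : ∀ y ∉ S, f y = 0)
    (hsum : ∀ A : Finset (ι → ℤ), (∀ y ∈ A, y ∈ S) → ∑ y ∈ A, weight y ≤ b) :
    Summable f ∧ ‖∑' y, f y‖ ≤ c * b := by
  classical
  have hfin : ∀ A : Finset (ι → ℤ), ∑ y ∈ A, ‖f y‖ ≤ c * b := by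
    intro A
    rw [← Finset.sum_filter_add_sum_filter_not A (· ∈ S)]
    have h1 : ∑ y ∈ A.filter (· ∉ S), ‖f y‖ = 0 :=
      Finset.sum_eq_zero fun y hy => by rw [hS y (Finset.mem_filter.1 hy).2, norm_zero]
    rw [h1, add_zero]
    refine (Finset.sum_le_sum fun y hy => hf y (Finset.mem_filter.1 hy).2).trans ?_
    rw [← Finset.mul_sum]
    exact mul_le_mul_of_nonneg_left
      (hsum _ fun y hy => (Finset.mem_filter.1 hy).2) hc
  have hsummable : Summable fun y => ‖f y‖ :=
    summable_of_sum_le (fun y => norm_nonneg _) hfin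
  exact ⟨hsummable.of_norm, (norm_tsum_le_tsum_norm hsummable).trans
    (Real.tsum_le_of_sum_le (fun y => norm_nonneg _) hfin)⟩

end Forms

/-! ### The character -/

theorem norm_character (t : ℝ) : ‖character t‖ = 1 := by
  rw [character, show 2 * (Real.pi : ℂ) * Complex.I * (t : ℂ) =
    ((2 * Real.pi * t : ℝ) : ℂ) * Complex.I by push_cast; ring, Complex.norm_exp_ofReal_mul_I]

theorem character_add (s t : ℝ) : character (s + t) = character s * character t := by
  rw [character, character, character, ← Complex.exp_add]
  congr 1
  push_cast
  ring

theorem character_intCast (n : ℤ) : character n = 1 := by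
  rw [character, ← Complex.exp_int_mul_two_pi_mul_I n]
  congr 1
  push_cast
  ring

theorem character_zero : character 0 = 1 := by simpa using character_intCast 0

theorem character_add_intCast (t : ℝ) (n : ℤ) : character (t + n) = character t := by
  rw [character_add, character_intCast, mul_one]

theorem character_natCast_mul (n : ℕ) (t : ℝ) : character (n * t) = character t ^ n := by
  rw [character, character, ← Complex.exp_nat_mul]
  congr 1
  push_cast
  ring

theorem character_sum {ι : Type*} (s : Finset ι) (f : ι → ℝ) :
    character (∑ i ∈ s, f i) = ∏ i ∈ s, character (f i) := by
  classical
  induction s using Finset.induction_on with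
  | empty => simp [character_zero]
  | insert a s ha ih => rw [Finset.sum_insert ha, Finset.prod_insert ha, character_add, ih]

theorem continuous_character : Continuous character := by
  unfold character
  fun_prop

theorem norm_character_sub_one (t : ℝ) : ‖character t - 1‖ = 2 * |Real.sin (Real.pi * t)| := by
  rw [character, show 2 * (Real.pi : ℂ) * Complex.I * (t : ℂ) =
    Complex.I * ((2 * Real.pi * t : ℝ) : ℂ) by push_cast; ring,
    Complex.norm_exp_I_mul_ofReal_sub_one, Real.norm_eq_abs, abs_mul, abs_two]
  congr 3
  ring

theorem norm_character_sub_one_le (t : ℝ) : ‖character t - 1‖ ≤ 2 * Real.pi * |t| := by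
  rw [norm_character_sub_one, mul_assoc]
  refine mul_le_mul_of_nonneg_left ?_ two_pos.le
  refine (Real.abs_sin_le_abs).trans ?_
  rw [abs_mul, abs_of_pos Real.pi_pos]

theorem le_norm_character_sub_one {t : ℝ} (ht : |t| ≤ 1 / 2) : 4 * |t| ≤ ‖character t - 1‖ := by
  rw [norm_character_sub_one]
  have h1 : |Real.sin (Real.pi * t)| = Real.sin (Real.pi * |t|) := by
    rcases abs_cases t with ⟨h, h0⟩ | ⟨h, h0⟩
    · rw [h, abs_of_nonneg]
      refine Real.sin_nonneg_of_nonneg_of_le_pi (by positivity) ?_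
      rw [h] at ht
      nlinarith [Real.pi_pos]
    · rw [h, mul_neg, Real.sin_neg, abs_of_nonpos]
      rw [← neg_nonneg, ← Real.sin_neg, ← mul_neg]
      refine Real.sin_nonneg_of_nonneg_of_le_pi (mul_nonneg Real.pi_pos.le (by linarith)) ?_
      rw [h] at ht
      nlinarith [Real.pi_pos]
  rw [h1]
  have h2 := Real.mul_le_sin (x := Real.pi * |t|) (by positivity) (by nlinarith [Real.pi_pos])
  have h3 : 2 / Real.pi * (Real.pi * |t|) = 2 * |t| := by
    field_simp
  linarith

theorem character_ne_one {t : ℝ} (ht : ∀ k : ℤ, t ≠ k) : character t ≠ 1 := by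
  intro h
  rw [character, Complex.exp_eq_one_iff] at h
  obtain ⟨k, hk⟩ := h
  refine ht k ?_
  have h2 : (2 * (Real.pi : ℂ) * Complex.I) ≠ 0 := Complex.two_pi_I_ne_zero
  have h3 : (2 * (Real.pi : ℂ) * Complex.I) * (t : ℂ) = (2 * (Real.pi : ℂ) * Complex.I) * k := by
    rw [hk]; ring
  exact_mod_cast mul_left_cancel₀ h2 h3

theorem norm_character_sub_one_le_sqrt (t : ℝ) :
    ‖character t - 1‖ ≤ 4 * |t| ^ (1 / 2 : ℝ) := by
  rw [← Real.sqrt_eq_rpow]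
  have h1 : ‖character t - 1‖ ≤ 2 := by
    refine (norm_sub_le _ _).trans ?_
    rw [norm_character, norm_one]
    norm_num
  have h2 := norm_character_sub_one_le t
  refine abs_le_of_sq_le_sq' ?_ (by positivity) |>.2
  rw [mul_pow, Real.sq_sqrt (abs_nonneg t)]
  nlinarith [Real.pi_le_four, norm_nonneg (character t - 1), abs_nonneg t]

/-! ### One-dimensional Fourier series -/

/-- The general term `𝐞(nu) / n ^ p` of the Fourier series of a periodic Bernoulli function; it is
zero for `n = 0` if `p ≠ 0`. -/
noncomputable def fourierTerm (p : ℕ) (u : ℝ) (n : ℤ) : ℂ := character (n * u) / (n : ℂ) ^ p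

/-- The symmetric partial sums of the Fourier series of a periodic Bernoulli function. -/
noncomputable def fourierPartial (p : ℕ) (u : ℝ) (N : ℕ) : ℂ :=
  ∑ n ∈ Finset.Icc (-(N : ℤ)) N, fourierTerm p u n

open Classical in
/-- The pointwise limit of the symmetric partial sums: a multiple of the periodic Bernoulli
function, except that it vanishes at the jumps of the sawtooth function. -/
noncomputable def fourierLimit (p : ℕ) (u : ℝ) : ℂ :=
  if p = 1 ∧ ∃ k : ℤ, u = k then 0 else
    -((2 * (Real.pi : ℂ) * Complex.I) ^ p) / (p.factorial : ℂ) * periodicBernoulli p u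

theorem norm_fourierTerm (p : ℕ) (u : ℝ) (n : ℤ) :
    ‖fourierTerm p u n‖ = (|(n : ℝ)| ^ p)⁻¹ := by
  rw [fourierTerm, norm_div, norm_character, norm_pow, Complex.norm_intCast, one_div]

theorem inv_abs_pow_le {p q : ℕ} (hq : 1 ≤ q) (hpq : q ≤ p) (n : ℤ) :
    (|(n : ℝ)| ^ p)⁻¹ ≤ (|(n : ℝ)| ^ q)⁻¹ := by
  rcases eq_or_ne n 0 with rfl | hn
  · simp [show p ≠ 0 by omega, show q ≠ 0 by omega]
  · have h1 := one_le_abs_cast hn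
    exact inv_anti₀ (by positivity) (pow_le_pow_right₀ h1 hpq)

theorem norm_fourierTerm_le {p : ℕ} (hp : 1 ≤ p) (u : ℝ) (n : ℤ) :
    ‖fourierTerm p u n‖ ≤ |(n : ℝ)|⁻¹ := by
  rw [norm_fourierTerm]
  simpa using inv_abs_pow_le le_rfl hp n

theorem fourierTerm_zero {p : ℕ} (hp : 1 ≤ p) (u : ℝ) : fourierTerm p u 0 = 0 := by
  simp [fourierTerm, show p ≠ 0 by omega]

theorem fourierTerm_add_intCast (p : ℕ) (u : ℝ) (k n : ℤ) :
    fourierTerm p (u + k) n = fourierTerm p u n := by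
  rw [fourierTerm, fourierTerm, mul_add,
    show (n : ℝ) * (k : ℝ) = ((n * k : ℤ) : ℝ) by push_cast; ring, character_add_intCast]

theorem fourierPartial_add_intCast (p : ℕ) (u : ℝ) (k : ℤ) (N : ℕ) :
    fourierPartial p (u + k) N = fourierPartial p u N :=
  Finset.sum_congr rfl fun n _ => fourierTerm_add_intCast p u k n

theorem sum_Icc_neg {M : Type*} [AddCommMonoid M] (f : ℤ → M) (N : ℕ) :
    ∑ n ∈ Finset.Icc (-(N : ℤ)) N, f n =
      f 0 + ∑ i ∈ Finset.range N, (f ((i : ℤ) + 1) + f (-((i : ℤ) + 1))) := by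
  induction N with
  | zero => simp
  | succ N ih =>
    have h : Finset.Icc (-((N + 1 : ℕ) : ℤ)) ((N + 1 : ℕ) : ℤ) =
        insert ((N : ℤ) + 1) (insert (-((N : ℤ) + 1)) (Finset.Icc (-(N : ℤ)) N)) := by
      ext n
      simp only [Finset.mem_Icc, Finset.mem_insert]
      push_cast
      omega
    rw [h, Finset.sum_insert, Finset.sum_insert, ih, Finset.sum_range_succ]
    · abel
    · simp only [Finset.mem_Icc]; omega
    · simp only [Finset.mem_Icc, Finset.mem_insert]; omega

/-! #### Exponent at least two -/

theorem summable_inv_abs_pow_two : Summable fun n : ℤ => (|(n : ℝ)| ^ 2)⁻¹ := by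
  have := Real.summable_one_div_int_pow.2 one_lt_two
  simpa [sq_abs] using this

theorem hasSum_fourierTerm {p : ℕ} (hp : 2 ≤ p) (u : ℝ) :
    HasSum (fourierTerm p u) (fourierLimit p u) := by
  have h := hasSum_one_div_pow_mul_fourier_mul_bernoulliFun hp (x := Int.fract u)
    ⟨Int.fract_nonneg u, (Int.fract_lt_one u).le⟩
  have h1 : fourierLimit p u = -(2 * (Real.pi : ℂ) * Complex.I) ^ p / (p.factorial : ℂ) *
      bernoulliFun p (Int.fract u) := by
    rw [fourierLimit, if_neg (fun h => by omega), periodicBernoulli]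
  rw [h1]
  convert h using 2 with n
  rw [← Int.fract_add_floor u, fourierTerm_add_intCast, Int.fract_add_floor, fourierTerm,
    character, fourier_coe_apply]
  rw [one_div, div_eq_inv_mul]
  congr 2
  push_cast
  ring

theorem tendsto_Icc_neg_atTop : Tendsto (fun N : ℕ => Finset.Icc (-(N : ℤ)) N) atTop atTop := by
  refine tendsto_atTop_finset_of_monotone (fun a b hab => ?_) fun n => ⟨n.natAbs, ?_⟩
  · exact Finset.Icc_subset_Icc (by simpa using hab) (by simpa using hab)
  · simp only [Finset.mem_Icc]
    omega

/-! #### The sawtooth function -/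

theorem norm_sum_smul_le_of_antitone {f : ℕ → ℝ} {z : ℕ → ℂ} {b : ℝ} (hf : Antitone f)
    (hf0 : ∀ n, 0 ≤ f n) (hz : ∀ n, ‖∑ i ∈ Finset.range n, z i‖ ≤ b) (n : ℕ) :
    ‖∑ i ∈ Finset.range n, f i • z i‖ ≤ f 0 * b := by
  have hb : 0 ≤ b := (norm_nonneg _).trans (hz 0)
  rw [Finset.sum_range_by_parts]
  refine (norm_sub_le _ _).trans ?_
  have h1 : ‖f (n - 1) • ∑ i ∈ Finset.range n, z i‖ ≤ f (n - 1) * b := by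
    rw [norm_smul, Real.norm_of_nonneg (hf0 _)]
    exact mul_le_mul_of_nonneg_left (hz n) (hf0 _)
  have h2 : ‖∑ i ∈ Finset.range (n - 1), (f (i + 1) - f i) • ∑ j ∈ Finset.range (i + 1), z j‖ ≤
      (f 0 - f (n - 1)) * b := by
    refine (norm_sum_le _ _).trans ?_
    rw [← Finset.sum_range_sub' f, Finset.sum_mul]
    refine Finset.sum_le_sum fun i _ => ?_
    have h3 := hf (Nat.le_succ i)
    rw [norm_smul, Real.norm_eq_abs, abs_of_nonpos (sub_nonpos.2 h3), neg_sub]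
    exact mul_le_mul_of_nonneg_left (hz _) (sub_nonneg.2 h3)
  linarith

theorem norm_geom_sum_le {z : ℂ} (hz : ‖z‖ = 1) (hz1 : z ≠ 1) (M n : ℕ) :
    ‖∑ i ∈ Finset.range n, z ^ (M + i + 1)‖ ≤ 2 / ‖z - 1‖ := by
  have h1 : ∑ i ∈ Finset.range n, z ^ (M + i + 1) = z ^ (M + 1) * ((z ^ n - 1) / (z - 1)) := by
    rw [← geom_sum_eq hz1, Finset.mul_sum]
    exact Finset.sum_congr rfl fun i _ => by rw [← pow_add]; congr 1; ring
  rw [h1, norm_mul, norm_pow, hz, one_pow, one_mul, norm_div]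
  refine div_le_div_of_nonneg_right ?_ (norm_nonneg _)
  refine (norm_sub_le _ _).trans ?_
  rw [norm_pow, hz, one_pow, norm_one]
  norm_num

theorem norm_sum_pow_div_le {z : ℂ} (hz : ‖z‖ = 1) (hz1 : z ≠ 1) (M n : ℕ) :
    ‖∑ i ∈ Finset.range n, (1 / ((M : ℝ) + i + 1)) • z ^ (M + i + 1)‖ ≤
      1 / ((M : ℝ) + 1) * (2 / ‖z - 1‖) := by
  have := norm_sum_smul_le_of_antitone (f := fun i : ℕ => 1 / ((M : ℝ) + i + 1))
    (z := fun i => z ^ (M + i + 1)) (b := 2 / ‖z - 1‖) ?_ ?_ ?_ n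
  · simpa using this
  · intro i j hij
    have : (i : ℝ) ≤ j := by exact_mod_cast hij
    exact one_div_le_one_div_of_le (by positivity) (by linarith)
  · intro i
    positivity
  · exact norm_geom_sum_le hz hz1 M

theorem fourierPartial_one (u : ℝ) (N : ℕ) :
    fourierPartial 1 u N = ∑ i ∈ Finset.range N,
      (1 / ((i : ℝ) + 1)) • (character u ^ (i + 1) - character (-u) ^ (i + 1)) := by
  rw [fourierPartial, sum_Icc_neg, fourierTerm_zero le_rfl, zero_add]
  refine Finset.sum_congr rfl fun i _ => ?_
  rw [fourierTerm, fourierTerm, ← character_natCast_mul, ← character_natCast_mul, pow_one, pow_one,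
    Complex.real_smul]
  push_cast
  rw [show -((i : ℝ) + 1) * u = ((i : ℝ) + 1) * -u by ring, div_neg]
  ring

theorem norm_fourierPartial_one_le (u : ℝ) (N : ℕ) :
    ‖fourierPartial 1 u N‖ ≤ 4 * Real.pi + 1 := by
  wlog hu : |u| ≤ 1 / 2 generalizing u
  · have := this (u - round u) (abs_sub_round u)
    rwa [← fourierPartial_add_intCast 1 (u - round u) (round u), sub_add_cancel] at this
  rcases eq_or_ne u 0 with rfl | hu0
  · rw [fourierPartial_one]
    simp only [neg_zero, sub_self, smul_zero, Finset.sum_const_zero, norm_zero]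
    positivity
  have hu0' : 0 < |u| := abs_pos.2 hu0
  -- terms with `(i + 1) |u| ≤ 1` are bounded by `4 π |u|`, the others are summed by parts
  have hhead : ∀ n : ℕ, (n : ℝ) * |u| ≤ 1 → ‖fourierPartial 1 u n‖ ≤ 4 * Real.pi := by
    intro n hn
    rw [fourierPartial_one]
    have hterm : ∀ i ∈ Finset.range n, ‖(1 / ((i : ℝ) + 1)) •
        (character u ^ (i + 1) - character (-u) ^ (i + 1))‖ ≤ 4 * Real.pi * |u| := by
      intro i _
      have hi : (0 : ℝ) < (i : ℝ) + 1 := by positivity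
      rw [norm_smul, Real.norm_of_nonneg (by positivity), one_div, inv_mul_le_iff₀ hi,
        ← character_natCast_mul, ← character_natCast_mul]
      have h1 := norm_character_sub_one_le (((i + 1 : ℕ) : ℝ) * u)
      have h2 := norm_character_sub_one_le (((i + 1 : ℕ) : ℝ) * -u)
      rw [abs_mul, Nat.abs_cast] at h1 h2
      rw [abs_neg] at h2
      rw [← sub_sub_sub_cancel_right _ _ (1 : ℂ)]
      refine (norm_sub_le _ _).trans ((add_le_add h1 h2).trans ?_)
      push_cast
      linarith
    refine (norm_sum_le_of_le _ hterm).trans ?_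
    rw [Finset.sum_const, Finset.card_range, nsmul_eq_mul]
    nlinarith [Real.pi_pos]
  set M := ⌊1 / |u|⌋₊ with hM
  have hMle : (M : ℝ) * |u| ≤ 1 := by
    have := Nat.floor_le (by positivity : 0 ≤ 1 / |u|)
    rwa [le_div_iff₀ hu0'] at this
  have hMlt : 1 / ((M : ℝ) + 1) ≤ |u| := by
    have := Nat.lt_floor_add_one (1 / |u|)
    rw [one_div_le (by positivity) hu0']
    exact this.le
  rcases le_total N M with hNM | hNM
  · have : (N : ℝ) * |u| ≤ 1 :=
      (mul_le_mul_of_nonneg_right (by exact_mod_cast hNM) hu0'.le).trans hMle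
    linarith [hhead N this]
  · obtain ⟨n, rfl⟩ := Nat.exists_eq_add_of_le hNM
    rw [fourierPartial_one, Finset.sum_range_add, ← fourierPartial_one]
    have htail : ∀ s : ℝ, |s| = |u| → ‖∑ i ∈ Finset.range n,
        (1 / ((M : ℝ) + i + 1)) • character s ^ (M + i + 1)‖ ≤ 1 / 2 := by
      intro s hs
      have h4 := le_norm_character_sub_one (hs.le.trans hu)
      have hs0 : 0 < |s| := hs ▸ hu0'
      have hpos : 0 < ‖character s - 1‖ := by linarith
      refine (norm_sum_pow_div_le (norm_character s)
        (fun h => by rw [h, sub_self, norm_zero] at hpos; exact lt_irrefl _ hpos) M n).trans ?_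
      calc 1 / ((M : ℝ) + 1) * (2 / ‖character s - 1‖) ≤ |s| * (2 / (4 * |s|)) := by
            rw [hs] at h4 ⊢
            gcongr
        _ = 1 / 2 := by field_simp; norm_num
    have hsplit : ∑ x ∈ Finset.range n, (1 / (((M + x : ℕ) : ℝ) + 1)) •
        (character u ^ (M + x + 1) - character (-u) ^ (M + x + 1)) =
        (∑ i ∈ Finset.range n, (1 / ((M : ℝ) + i + 1)) • character u ^ (M + i + 1)) -
        ∑ i ∈ Finset.range n, (1 / ((M : ℝ) + i + 1)) • character (-u) ^ (M + i + 1) := by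
      rw [← Finset.sum_sub_distrib]
      refine Finset.sum_congr rfl fun i _ => ?_
      rw [smul_sub]
      push_cast
      rfl
    rw [hsplit]
    refine (norm_add_le _ _).trans (add_le_add (hhead M hMle) ?_)
    refine (norm_sub_le _ _).trans ?_
    linarith [htail u rfl, htail (-u) (abs_neg u)]

theorem exists_norm_fourierPartial_le {p : ℕ} (hp : 1 ≤ p) :
    ∃ C : ℝ, 0 ≤ C ∧ ∀ u N, ‖fourierPartial p u N‖ ≤ C := by
  rcases hp.eq_or_lt with rfl | hp
  · exact ⟨4 * Real.pi + 1, by positivity, norm_fourierPartial_one_le⟩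
  · refine ⟨∑' n : ℤ, (|(n : ℝ)| ^ 2)⁻¹, tsum_nonneg fun n => by positivity, fun u N => ?_⟩
    refine (norm_sum_le_of_le _ fun n _ => ?_).trans
      (summable_inv_abs_pow_two.sum_le_tsum _ fun n _ => by positivity)
    rw [norm_fourierTerm]
    exact inv_abs_pow_le one_le_two hp n

/-- The series `∑ zⁿ / n` converges on the unit circle away from `1`, to the value predicted by
Abel's limit theorem. -/
theorem tendsto_sum_pow_div {z : ℂ} (hz : ‖z‖ = 1) (hz1 : z ≠ 1) :
    Tendsto (fun n : ℕ => ∑ i ∈ Finset.range n, (1 / ((i : ℝ) + 1)) • z ^ (i + 1)) atTop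
      (𝓝 (-Complex.log (1 - z))) := by
  have hcau : CauchySeq fun n : ℕ => ∑ i ∈ Finset.range n, (1 / ((i : ℝ) + 1)) • z ^ (i + 1) := by
    refine Antitone.cauchySeq_series_mul_of_tendsto_zero_of_bounded
      (f := fun i : ℕ => 1 / ((i : ℝ) + 1)) (b := 2 / ‖z - 1‖) ?_
      tendsto_one_div_add_atTop_nhds_zero_nat fun n => ?_
    · intro i j hij
      have : (i : ℝ) ≤ j := by exact_mod_cast hij
      exact one_div_le_one_div_of_le (by positivity) (by linarith)
    · simpa using norm_geom_sum_le hz hz1 0 n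
  obtain ⟨l, hl⟩ := cauchySeq_tendsto_of_complete hcau
  have hshift : Tendsto (fun n => ∑ i ∈ Finset.range n, z ^ i / (i : ℂ)) atTop (𝓝 l) := by
    rw [← tendsto_add_atTop_iff_nat 1]
    refine hl.congr fun n => ?_
    rw [Finset.sum_range_succ']
    simp only [Nat.cast_zero, div_zero, add_zero]
    refine Finset.sum_congr rfl fun i _ => ?_
    rw [Complex.real_smul]
    push_cast
    ring
  have habel := Complex.tendsto_tsum_powerSeries_nhdsWithin_lt hshift
  rw [tendsto_map'_iff] at habel
  have hlog : Tendsto (fun r : ℝ => -Complex.log (1 - z * r)) (𝓝[<] 1)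
      (𝓝 (-Complex.log (1 - z))) := by
    have hre : z.re < 1 := by
      refine lt_of_le_of_ne ((Complex.re_le_norm z).trans hz.le) fun h => hz1 ?_
      have him : z.im = 0 := by
        have := Complex.sq_norm z
        rw [hz, Complex.normSq_apply, h] at this
        nlinarith
      exact Complex.ext (by simpa using h) (by simpa using him)
    have hslit : 1 - z ∈ Complex.slitPlane := Or.inl (by simpa using hre)
    have hcont : ContinuousAt (fun r : ℝ => -Complex.log (1 - z * r)) 1 := by
      refine ContinuousAt.neg (ContinuousAt.clog (by fun_prop) ?_)
      simpa using hslit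
    have := hcont.tendsto.mono_left (nhdsWithin_le_nhds (s := Set.Iio 1))
    simpa using this
  have heq : ∀ᶠ r : ℝ in 𝓝[<] 1,
      ((fun w : ℂ => ∑' n : ℕ, z ^ n / (n : ℂ) * w ^ n) ∘ Complex.ofReal) r =
        -Complex.log (1 - z * r) := by
    have : Set.Ioo (-1 : ℝ) 1 ∈ 𝓝[<] (1 : ℝ) := Ioo_mem_nhdsLT (by norm_num)
    filter_upwards [this] with r hr
    have hlt : ‖z * r‖ < 1 := by
      rw [norm_mul, hz, one_mul, Complex.norm_real, Real.norm_eq_abs]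
      exact abs_lt.2 hr
    rw [← (Complex.hasSum_taylorSeries_neg_log hlt).tsum_eq]
    refine tsum_congr fun n => ?_
    rw [mul_pow]
    ring
  rw [← tendsto_nhds_unique (habel.congr' heq) hlog]
  exact hl

theorem arg_one_sub_character {x : ℝ} (h0 : 0 < x) (h1 : x < 1) :
    (1 - character x).arg = Real.pi * x - Real.pi / 2 := by
  have hsin : 0 < 2 * Real.sin (Real.pi * x) := by
    have := Real.sin_pos_of_pos_of_lt_pi (x := Real.pi * x) (by positivity)
      (by nlinarith [Real.pi_pos])
    linarith
  have h : 1 - character x = ((2 * Real.sin (Real.pi * x) : ℝ) : ℂ) *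
      (Real.cos (Real.pi * x - Real.pi / 2) +
        Real.sin (Real.pi * x - Real.pi / 2) * Complex.I) := by
    rw [Real.cos_sub_pi_div_two, Real.sin_sub_pi_div_two, character,
      show 2 * (Real.pi : ℂ) * Complex.I * (x : ℂ) = ((2 * (Real.pi * x) : ℝ) : ℂ) * Complex.I by
        push_cast; ring, Complex.exp_mul_I, ← Complex.ofReal_cos, ← Complex.ofReal_sin,
      Real.cos_two_mul, Real.sin_two_mul]
    have := Real.sin_sq_add_cos_sq (Real.pi * x)
    have h2 : ((Real.sin (Real.pi * x) : ℝ) : ℂ) ^ 2 +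
        ((Real.cos (Real.pi * x) : ℝ) : ℂ) ^ 2 = 1 := by
      exact_mod_cast this
    push_cast at h2 ⊢
    linear_combination (-2) * h2
  rw [h]
  push_cast
  have := Complex.arg_mul_cos_add_sin_mul_I hsin (θ := Real.pi * x - Real.pi / 2)
    ⟨by nlinarith [Real.pi_pos], by nlinarith [Real.pi_pos]⟩
  push_cast at this
  exact this

theorem tendsto_fourierPartial {p : ℕ} (hp : 1 ≤ p) (u : ℝ) :
    Tendsto (fourierPartial p u) atTop (𝓝 (fourierLimit p u)) := by
  rcases hp.eq_or_lt with rfl | hp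
  swap
  · exact (hasSum_fourierTerm hp u).comp tendsto_Icc_neg_atTop
  by_cases hu : ∃ k : ℤ, u = k
  · obtain ⟨k, rfl⟩ := hu
    rw [fourierLimit, if_pos ⟨rfl, k, rfl⟩]
    refine tendsto_const_nhds.congr fun N => ?_
    rw [← zero_add (k : ℝ), fourierPartial_add_intCast, fourierPartial_one]
    simp
  · rw [fourierLimit, if_neg (fun h => hu h.2)]
    push Not at hu
    have hfr0 : 0 < Int.fract u :=
      lt_of_le_of_ne (Int.fract_nonneg u) fun h => hu ⌊u⌋ (by
        have := Int.fract_add_floor u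
        rw [← h, zero_add] at this
        exact this.symm)
    have hfr1 := Int.fract_lt_one u
    have hchar : character (-u) = starRingEnd ℂ (character u) := by
      rw [character, character, ← Complex.exp_conj]
      congr 1
      simp only [map_mul, Complex.conj_ofReal, Complex.conj_I, Complex.ofReal_neg, map_ofNat]
      ring
    have h1 := tendsto_sum_pow_div (norm_character u) (character_ne_one hu)
    have h2 := tendsto_sum_pow_div (norm_character (-u))
      (character_ne_one fun k hk => hu (-k) (by push_cast; linarith))
    have h3 : Tendsto (fourierPartial 1 u) atTop
        (𝓝 (-Complex.log (1 - character u) - -Complex.log (1 - character (-u)))) :=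
      (h1.sub h2).congr fun N => by
        rw [fourierPartial_one, ← Finset.sum_sub_distrib]
        exact Finset.sum_congr rfl fun i _ => (smul_sub _ _ _).symm
    have hval : -Complex.log (1 - character u) - -Complex.log (1 - character (-u)) =
        -((2 * (Real.pi : ℂ) * Complex.I) ^ 1) / (Nat.factorial 1 : ℂ) *
          periodicBernoulli 1 u := by
      have hcu : character u = character (Int.fract u) := by
        conv_lhs => rw [← Int.fract_add_floor u, character_add_intCast]
      have harg := arg_one_sub_character hfr0 hfr1
      rw [← hcu] at harg
      have hne : (1 - character u).arg ≠ Real.pi := by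
        rw [harg]
        nlinarith [Real.pi_pos]
      have hconj : Complex.log (1 - character (-u)) =
          starRingEnd ℂ (Complex.log (1 - character u)) := by
        rw [← Complex.log_conj _ hne, hchar, map_sub, map_one]
      rw [hconj, neg_sub_neg, ← neg_sub, Complex.sub_conj, Complex.log_im, harg, periodicBernoulli,
        bernoulliFun_one]
      push_cast
      simp
      ring
    rwa [hval] at h3

/-! ### One-sided limits of periodic Bernoulli functions -/

theorem norm_fourierLimit_le {p : ℕ} (hp : 1 ≤ p) :
    ∃ C : ℝ, 0 ≤ C ∧ ∀ u, ‖fourierLimit p u‖ ≤ C := by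
  obtain ⟨C, hC0, hC⟩ := exists_norm_fourierPartial_le hp
  exact ⟨C, hC0, fun u => le_of_tendsto (tendsto_fourierPartial hp u).norm
    (Eventually.of_forall fun N => hC u N)⟩

open Classical in
/-- The limit of `fourierLimit p` at `u` from the side given by the sign `s = ±1`. -/
noncomputable def fourierSide (p : ℕ) (u s : ℝ) : ℂ :=
  if p = 1 ∧ ∃ k : ℤ, u = k then
    -((2 * (Real.pi : ℂ) * Complex.I) ^ p) / (p.factorial : ℂ) * ((-(s / 2) : ℝ) : ℂ)
  else fourierLimit p u

/-- A bounded function which is Lipschitz at the origin is Hölder of exponent `1 / 2` there,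
uniformly on the whole line. -/
theorem norm_le_sqrt_of_linear {f : ℝ → ℂ} {r D : ℝ} (hr : 0 < r) (hr1 : r ≤ 1) (hD : 0 ≤ D)
    (h1 : ∀ x, x ≠ 0 → |x| < r → ‖f x‖ ≤ 2 * Real.pi * |x|) (h2 : ∀ x, x ≠ 0 → ‖f x‖ ≤ D)
    {x : ℝ} (hx : x ≠ 0) :
    ‖f x‖ ≤ (2 * Real.pi + D * r ^ (-(1 / 2) : ℝ)) * |x| ^ (1 / 2 : ℝ) := by
  have hx0 : 0 < |x| := abs_pos.2 hx
  have hs : 0 < |x| ^ (1 / 2 : ℝ) := Real.rpow_pos_of_pos hx0 _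
  have hr' : 0 < r ^ (-(1 / 2) : ℝ) := Real.rpow_pos_of_pos hr _
  rw [add_mul]
  rcases lt_or_ge |x| r with hlt | hge
  · have h3 : |x| ≤ |x| ^ (1 / 2 : ℝ) := by
      conv_lhs => rw [← Real.rpow_one |x|]
      exact Real.rpow_le_rpow_of_exponent_ge hx0 (by linarith) (by norm_num)
    have h4 : 2 * Real.pi * |x| ≤ 2 * Real.pi * |x| ^ (1 / 2 : ℝ) :=
      mul_le_mul_of_nonneg_left h3 (by positivity)
    have h5 : 0 ≤ D * r ^ (-(1 / 2) : ℝ) * |x| ^ (1 / 2 : ℝ) := by positivity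
    linarith [h1 x hx hlt]
  · have h3 : 1 ≤ r ^ (-(1 / 2) : ℝ) * |x| ^ (1 / 2 : ℝ) := by
      rw [Real.rpow_neg hr.le, inv_mul_eq_div, ← Real.div_rpow hx0.le hr.le]
      exact Real.one_le_rpow ((one_le_div hr).2 hge) (by norm_num)
    have h4 : D ≤ D * r ^ (-(1 / 2) : ℝ) * |x| ^ (1 / 2 : ℝ) := by
      rw [mul_assoc]
      exact le_mul_of_one_le_right hD h3
    have h5 : 0 ≤ 2 * Real.pi * |x| ^ (1 / 2 : ℝ) := by positivity
    linarith [h2 x hx]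

theorem fourierLimit_one_of_notMem {u : ℝ} (hu : ∀ k : ℤ, u ≠ k) :
    fourierLimit 1 u = -(2 * (Real.pi : ℂ) * Complex.I) * ((Int.fract u - 1 / 2 : ℝ) : ℂ) := by
  rw [fourierLimit, if_neg (fun h => by obtain ⟨k, hk⟩ := h.2; exact hu k hk), periodicBernoulli,
    bernoulliFun_one]
  simp

theorem norm_two_pi_I_mul (x : ℝ) :
    ‖-(2 * (Real.pi : ℂ) * Complex.I) * (x : ℂ)‖ = 2 * Real.pi * |x| := by
  simp [abs_of_pos Real.pi_pos]

theorem ne_intCast_of_fract_pos {u : ℝ} (h : 0 < Int.fract u) (k : ℤ) : u ≠ k := by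
  rintro rfl
  simp at h

theorem summable_inv_abs_rpow : Summable fun n : ℤ => 4 * |(n : ℝ)| ^ (-(3 / 2) : ℝ) :=
  (Real.summable_abs_int_rpow (by norm_num)).mul_left 4

/-- Near every point, the limit function is Hölder continuous of exponent `1 / 2` on either side. -/
theorem exists_norm_fourierLimit_sub_le {p : ℕ} (hp : 1 ≤ p) (u : ℝ) :
    ∃ C : ℝ, 0 ≤ C ∧ ∀ x : ℝ, x ≠ 0 →
      ‖fourierLimit p (u + x) - fourierSide p u (Real.sign x)‖ ≤ C * |x| ^ (1 / 2 : ℝ) := by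
  rcases hp.eq_or_lt with rfl | hp
  swap
  · refine ⟨∑' n : ℤ, 4 * |(n : ℝ)| ^ (-(3 / 2) : ℝ), tsum_nonneg fun n => by positivity,
      fun x _ => ?_⟩
    rw [fourierSide, if_neg (fun h => by omega)]
    have hs := (hasSum_fourierTerm hp (u + x)).sub (hasSum_fourierTerm hp u)
    rw [← hs.tsum_eq, ← tsum_mul_right]
    refine tsum_of_norm_bounded (summable_inv_abs_rpow.mul_right _).hasSum fun n => ?_
    have h1 : fourierTerm p (u + x) n - fourierTerm p u n =
        fourierTerm p u n * (character (n * x) - 1) := by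
      rw [fourierTerm, fourierTerm, mul_add, character_add]
      ring
    rw [h1, norm_mul, norm_fourierTerm]
    rcases eq_or_ne n 0 with rfl | hn
    · simp [show p ≠ 0 by omega]
    have hn1 := one_le_abs_cast hn
    have hn0 : 0 < |(n : ℝ)| := by linarith
    calc (|(n : ℝ)| ^ p)⁻¹ * ‖character (n * x) - 1‖
        ≤ (|(n : ℝ)| ^ 2)⁻¹ * (4 * |n * x| ^ (1 / 2 : ℝ)) :=
          mul_le_mul (inv_abs_pow_le one_le_two hp n) (norm_character_sub_one_le_sqrt _)
            (norm_nonneg _) (by positivity)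
      _ = 4 * |(n : ℝ)| ^ (-(3 / 2) : ℝ) * |x| ^ (1 / 2 : ℝ) := by
          rw [abs_mul, Real.mul_rpow hn0.le (abs_nonneg x), ← Real.rpow_natCast, ← Real.rpow_neg
            hn0.le, show (-(3 / 2) : ℝ) = -((2 : ℕ) : ℝ) + 1 / 2 by norm_num, Real.rpow_add hn0]
          ring
  obtain ⟨D, hD0, hD⟩ := norm_fourierLimit_le (p := 1) le_rfl
  by_cases hu : ∃ k : ℤ, u = k
  · obtain ⟨k, rfl⟩ := hu
    -- at a jump of the sawtooth function, which is linear of slope one on either side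
    have hside : ∀ s : ℝ, fourierSide 1 k s =
        -(2 * (Real.pi : ℂ) * Complex.I) * ((-(s / 2) : ℝ) : ℂ) := by
      intro s
      rw [fourierSide, if_pos ⟨rfl, k, rfl⟩]
      simp
    refine ⟨_, ?_, fun x hx => norm_le_sqrt_of_linear
      (f := fun x => fourierLimit 1 (k + x) - fourierSide 1 k (Real.sign x))
      (r := 1) (D := D + 2 * Real.pi) one_pos le_rfl (by positivity) ?_ ?_ hx⟩
    · positivity
    · intro x hx hx1
      have hfr : Int.fract x - 1 / 2 - -(Real.sign x / 2) = x ∧ 0 < Int.fract x := by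
        rcases lt_or_gt_of_ne hx with h | h
        · rw [Real.sign_of_neg h]
          have : Int.fract x = x + 1 := by
            rw [Int.fract_eq_iff]
            refine ⟨by linarith [(abs_lt.1 hx1).1], by linarith, -1, by push_cast; ring⟩
          rw [this]
          constructor
          · ring
          · linarith [(abs_lt.1 hx1).1]
        · rw [Real.sign_of_pos h]
          have : Int.fract x = x := Int.fract_eq_self.2 ⟨h.le, (abs_lt.1 hx1).2⟩
          rw [this]
          constructor
          · ring
          · exact h
      have hfr' : Int.fract ((k : ℝ) + x) = Int.fract x := Int.fract_intCast_add k x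
      rw [fourierLimit_one_of_notMem (ne_intCast_of_fract_pos (by rw [hfr']; exact hfr.2)), hside,
        ← mul_sub, ← Complex.ofReal_sub, norm_two_pi_I_mul, hfr', hfr.1]
    · intro x hx
      refine (norm_sub_le _ _).trans (add_le_add (hD _) ?_)
      rw [hside, norm_two_pi_I_mul, abs_neg]
      have : |Real.sign x / 2| ≤ 1 := by
        rcases Real.sign_apply_eq x with h | h | h <;> rw [h] <;> norm_num
      nlinarith [Real.pi_pos]
  · push Not at hu
    have hside : ∀ s, fourierSide 1 u s = fourierLimit 1 u := fun s => by
      rw [fourierSide, if_neg]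
      rintro ⟨-, k, hk⟩
      exact hu k hk
    have hf0 : 0 < Int.fract u :=
      lt_of_le_of_ne (Int.fract_nonneg u) fun h => hu ⌊u⌋ (by
        have := Int.fract_add_floor u
        rw [← h, zero_add] at this
        exact this.symm)
    have hf1 := Int.fract_lt_one u
    have hr : 0 < min (Int.fract u) (1 - Int.fract u) := lt_min hf0 (by linarith)
    refine ⟨_, ?_, fun x hx => norm_le_sqrt_of_linear
      (f := fun x => fourierLimit 1 (u + x) - fourierSide 1 u (Real.sign x))
      (r := min (Int.fract u) (1 - Int.fract u)) (D := D + D) hr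
      ((min_le_left _ _).trans hf1.le) (by positivity) ?_ ?_ hx⟩
    · positivity
    · intro x _ hxr
      obtain ⟨h1, h2⟩ := lt_min_iff.1 hxr
      have hfr : Int.fract (u + x) = Int.fract u + x := by
        rw [Int.fract_eq_iff]
        refine ⟨by linarith [neg_abs_le x], by linarith [le_abs_self x], ⌊u⌋, ?_⟩
        have := Int.fract_add_floor u
        linarith
      have hpos : 0 < Int.fract (u + x) := by
        rw [hfr]
        linarith [neg_abs_le x]
      rw [hside, fourierLimit_one_of_notMem (ne_intCast_of_fract_pos hpos),
        fourierLimit_one_of_notMem hu, ← mul_sub, ← Complex.ofReal_sub, norm_two_pi_I_mul, hfr]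
      refine le_of_eq ?_
      congr 2
      ring
    · intro x _
      rw [hside]
      exact (norm_sub_le _ _).trans (add_le_add (hD _) (hD _))

theorem norm_prod_sub_prod_le {ι : Type*} (s : Finset ι) {a b : ι → ℂ} {D : ℝ} (hD : 1 ≤ D)
    (ha : ∀ i, ‖a i‖ ≤ D) (hb : ∀ i, ‖b i‖ ≤ D) :
    ‖∏ i ∈ s, a i - ∏ i ∈ s, b i‖ ≤ D ^ s.card * ∑ i ∈ s, ‖a i - b i‖ := by
  classical
  induction s using Finset.induction_on with
  | empty => simp
  | insert i s hi ih =>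
    rw [Finset.prod_insert hi, Finset.prod_insert hi, Finset.sum_insert hi,
      Finset.card_insert_of_notMem hi]
    have h1 : a i * ∏ j ∈ s, a j - b i * ∏ j ∈ s, b j =
        a i * (∏ j ∈ s, a j - ∏ j ∈ s, b j) + (a i - b i) * ∏ j ∈ s, b j := by ring
    have h2 : ‖∏ j ∈ s, b j‖ ≤ D ^ s.card := by
      rw [norm_prod, ← Finset.prod_const]
      exact Finset.prod_le_prod (fun j _ => norm_nonneg _) fun j _ => hb j
    have h3 : (1 : ℝ) ≤ D ^ s.card := one_le_pow₀ hD
    rw [h1]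
    refine (norm_add_le _ _).trans ?_
    rw [norm_mul, norm_mul]
    have h4 : ‖a i‖ * ‖∏ j ∈ s, a j - ∏ j ∈ s, b j‖ ≤
        D * (D ^ s.card * ∑ j ∈ s, ‖a j - b j‖) :=
      mul_le_mul (ha i) ih (norm_nonneg _) (by linarith)
    have h5 : ‖a i - b i‖ * ‖∏ j ∈ s, b j‖ ≤ ‖a i - b i‖ * (D * D ^ s.card) := by
      refine mul_le_mul_of_nonneg_left (h2.trans ?_) (norm_nonneg _)
      exact le_mul_of_one_le_left (by linarith) hD
    rw [pow_succ]
    linarith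

/-! ### The Fejér kernel -/

open FourierTransform

/-- The tent function `max (0, 1 - |s|)`. -/
noncomputable def tent (s : ℝ) : ℝ := max 0 (1 - |s|)

theorem continuous_tent : Continuous tent := by
  unfold tent
  fun_prop

theorem tent_nonneg (s : ℝ) : 0 ≤ tent s := le_max_left _ _

theorem tent_le_one (s : ℝ) : tent s ≤ 1 := max_le zero_le_one (by linarith [abs_nonneg s])

theorem tent_of_one_le {s : ℝ} (hs : 1 ≤ |s|) : tent s = 0 := max_eq_left (by linarith)

theorem tent_of_le_one {s : ℝ} (hs : |s| ≤ 1) : tent s = 1 - |s| := max_eq_right (by linarith)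

theorem integral_one_sub_mul_exp {c : ℂ} (hc : c ≠ 0) :
    ∫ v in (0 : ℝ)..1, Complex.exp (c * v) * ((1 - v : ℝ) : ℂ) =
      Complex.exp c / c ^ 2 - (1 / c + 1 / c ^ 2) := by
  have hderiv : ∀ x ∈ Set.uIcc (0 : ℝ) 1, HasDerivAt
      (fun v : ℝ => ((1 - (v : ℂ)) / c + 1 / c ^ 2) * Complex.exp (c * v))
      (Complex.exp (c * x) * ((1 - x : ℝ) : ℂ)) x := by
    intro x _
    have h1 : HasDerivAt (fun v : ℝ => (v : ℂ)) 1 x := Complex.ofRealCLM.hasDerivAt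
    have h2 := ((h1.const_sub 1).div_const c).add_const (1 / c ^ 2)
    have h3 := (h1.const_mul c).cexp
    refine (h2.mul h3).congr_deriv ?_
    push_cast
    field_simp
    ring
  rw [intervalIntegral.integral_eq_sub_of_hasDerivAt hderiv
    (Continuous.intervalIntegrable (by fun_prop) _ _)]
  simp
  ring

theorem integral_one_add_mul_exp {c : ℂ} (hc : c ≠ 0) :
    ∫ v in (-1 : ℝ)..0, Complex.exp (c * v) * ((1 + v : ℝ) : ℂ) =
      Complex.exp (-c) / c ^ 2 + (1 / c - 1 / c ^ 2) := by
  have hderiv : ∀ x ∈ Set.uIcc (-1 : ℝ) 0, HasDerivAt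
      (fun v : ℝ => ((1 + (v : ℂ)) / c - 1 / c ^ 2) * Complex.exp (c * v))
      (Complex.exp (c * x) * ((1 + x : ℝ) : ℂ)) x := by
    intro x _
    have h1 : HasDerivAt (fun v : ℝ => (v : ℂ)) 1 x := Complex.ofRealCLM.hasDerivAt
    have h2 := ((h1.const_add 1).div_const c).sub_const (1 / c ^ 2)
    have h3 := (h1.const_mul c).cexp
    refine (h2.mul h3).congr_deriv ?_
    push_cast
    field_simp
    ring
  rw [intervalIntegral.integral_eq_sub_of_hasDerivAt hderiv
    (Continuous.intervalIntegrable (by fun_prop) _ _)]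
  simp
  ring

theorem fourier_tent {w : ℝ} (hw : w ≠ 0) :
    𝓕 (fun s => (tent s : ℂ)) w = ((Real.sinc (Real.pi * w) ^ 2 : ℝ) : ℂ) := by
  have hpw : Real.pi * w ≠ 0 := mul_ne_zero Real.pi_ne_zero hw
  set c : ℂ := ((-2 * Real.pi * w : ℝ) : ℂ) * Complex.I with hc
  have hc0 : c ≠ 0 := by
    refine mul_ne_zero ?_ Complex.I_ne_zero
    exact_mod_cast (by simpa [mul_assoc] using hpw : -2 * Real.pi * w ≠ 0)
  have h1 : 𝓕 (fun s => (tent s : ℂ)) w = ∫ v : ℝ, Complex.exp (c * v) * (tent v : ℂ) := by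
    rw [Real.fourier_real_eq_integral_exp_smul]
    refine integral_congr_ae (Eventually.of_forall fun v => ?_)
    simp only [smul_eq_mul]
    congr 2
    rw [hc]
    push_cast
    ring
  have hsupp : Function.support (fun v : ℝ => Complex.exp (c * v) * (tent v : ℂ)) ⊆
      Set.Ioc (-1) 1 := by
    intro v hv
    by_contra hnot
    refine hv ?_
    have : 1 ≤ |v| := by
      by_contra hlt
      have := abs_lt.1 (not_le.1 hlt)
      exact hnot ⟨this.1, this.2.le⟩
    simp [tent_of_one_le this]
  have hcont : Continuous fun v : ℝ => Complex.exp (c * v) * (tent v : ℂ) := by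
    have := continuous_tent
    fun_prop
  rw [h1, ← intervalIntegral.integral_eq_integral_of_support_subset hsupp,
    ← intervalIntegral.integral_add_adjacent_intervals
      (hcont.intervalIntegrable (-1) 0) (hcont.intervalIntegrable 0 1)]
  have h2 : ∫ v in (-1 : ℝ)..0, Complex.exp (c * v) * (tent v : ℂ) =
      ∫ v in (-1 : ℝ)..0, Complex.exp (c * v) * ((1 + v : ℝ) : ℂ) := by
    refine intervalIntegral.integral_congr fun v hv => ?_
    rw [Set.uIcc_of_le (by norm_num)] at hv
    rw [tent_of_le_one (abs_le.2 ⟨hv.1, by linarith [hv.2]⟩), abs_of_nonpos hv.2, sub_neg_eq_add]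
  have h3 : ∫ v in (0 : ℝ)..1, Complex.exp (c * v) * (tent v : ℂ) =
      ∫ v in (0 : ℝ)..1, Complex.exp (c * v) * ((1 - v : ℝ) : ℂ) := by
    refine intervalIntegral.integral_congr fun v hv => ?_
    rw [Set.uIcc_of_le (by norm_num)] at hv
    rw [tent_of_le_one (abs_le.2 ⟨by linarith [hv.1], hv.2⟩), abs_of_nonneg hv.1]
  rw [h2, h3, integral_one_sub_mul_exp hc0, integral_one_add_mul_exp hc0,
    Real.sinc_of_ne_zero hpw]
  have h4 : Complex.exp c + Complex.exp (-c) = 2 - 4 * ((Real.sin (Real.pi * w) : ℝ) : ℂ) ^ 2 := by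
    have e1 : c = -(((2 * (Real.pi * w) : ℝ) : ℂ) * Complex.I) := by rw [hc]; push_cast; ring
    have e2 : Real.cos (2 * (Real.pi * w)) = 1 - 2 * Real.sin (Real.pi * w) ^ 2 := by
      rw [Real.cos_two_mul, Real.cos_sq']
      ring
    have e3 : Complex.exp c + Complex.exp (-c) = 2 * ((Real.cos (2 * (Real.pi * w)) : ℝ) : ℂ) := by
      rw [Complex.ofReal_cos, Complex.cos, e1]
      ring_nf
    rw [e3, e2]
    push_cast
    ring
  have h5 : c ^ 2 = -(4 * ((Real.pi * w : ℝ) : ℂ) ^ 2) := by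
    rw [hc, mul_pow, Complex.I_sq]
    push_cast
    ring
  have h6 : ((Real.pi * w : ℝ) : ℂ) ≠ 0 := by exact_mod_cast hpw
  calc _ = (Complex.exp c + Complex.exp (-c) - 2) / c ^ 2 := by ring
    _ = _ := by
      rw [h4, h5]
      push_cast at h6 ⊢
      field_simp
      ring

/-- The Fejér kernel decays like `x ^ (-2)`, so that it may be integrated against
`|x| ^ (1 / 2)`. -/
theorem integrable_rpow_mul_sinc_sq :
    Integrable fun x : ℝ => Real.sinc (Real.pi * x) ^ 2 * (1 + |x| ^ (1 / 2 : ℝ)) := by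
  have hdom : Integrable fun x : ℝ => 16 * (1 + ‖x‖) ^ (-(3 / 2) : ℝ) :=
    (integrable_one_add_norm (by simp; norm_num)).const_mul 16
  refine hdom.mono' ?_ (Eventually.of_forall fun x => ?_)
  · refine Continuous.aestronglyMeasurable ?_
    have := Real.continuous_sinc
    have h2 : Continuous fun x : ℝ => |x| ^ (1 / 2 : ℝ) :=
      (continuous_abs).rpow_const fun x => Or.inr (by norm_num)
    fun_prop
  · rw [Real.norm_of_nonneg (by positivity), Real.norm_eq_abs]
    have hx1 : (1 : ℝ) ≤ 1 + |x| := by linarith [abs_nonneg x]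
    have hpos : 0 < 1 + |x| := by linarith
    have h1 : Real.sinc (Real.pi * x) ^ 2 ≤ 4 * (1 + |x|) ^ (-2 : ℝ) := by
      rw [Real.rpow_neg hpos.le, ← div_eq_mul_inv, le_div_iff₀ (by positivity),
        show ((2 : ℝ)) = ((2 : ℕ) : ℝ) by norm_num, Real.rpow_natCast, ← mul_pow,
        show ((4 : ℝ)) = 2 ^ 2 by norm_num]
      refine sq_le_sq' ?_ ?_ <;>
      · have key : |Real.sinc (Real.pi * x)| * (1 + |x|) ≤ 2 := by
          have hs1 := Real.abs_sinc_le_one (Real.pi * x)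
          have hs2 : |Real.sinc (Real.pi * x)| * |x| ≤ 1 := by
            rcases eq_or_ne x 0 with rfl | hx
            · simp
            · have hpx : Real.pi * x ≠ 0 := mul_ne_zero Real.pi_ne_zero hx
              rw [Real.sinc_of_ne_zero hpx, abs_div, abs_mul, abs_of_pos Real.pi_pos,
                div_mul_eq_mul_div, div_le_one (by positivity)]
              have := Real.abs_sin_le_one (Real.pi * x)
              nlinarith [Real.pi_gt_three, abs_pos.2 hx]
          linarith
        have := abs_le.1 (show |Real.sinc (Real.pi * x) * (1 + |x|)| ≤ 2 by
          rw [abs_mul, abs_of_pos hpos]; exact key)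
        linarith [this.1, this.2]
    have h2 : 1 + |x| ^ (1 / 2 : ℝ) ≤ 2 * (1 + |x|) ^ (1 / 2 : ℝ) := by
      have := Real.one_le_rpow hx1 (by norm_num : (0 : ℝ) ≤ 1 / 2)
      have := Real.rpow_le_rpow (abs_nonneg x) (by linarith : |x| ≤ 1 + |x|)
        (by norm_num : (0 : ℝ) ≤ 1 / 2)
      linarith
    calc _ ≤ 4 * (1 + |x|) ^ (-2 : ℝ) * (2 * (1 + |x|) ^ (1 / 2 : ℝ)) :=
          mul_le_mul h1 h2 (by positivity) (by positivity)
      _ = 8 * (1 + |x|) ^ (-(3 / 2) : ℝ) := by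
          rw [show (-(3 / 2) : ℝ) = -2 + 1 / 2 by norm_num, Real.rpow_add hpos]
          ring
      _ ≤ _ := by
          have : 0 < (1 + |x|) ^ (-(3 / 2) : ℝ) := Real.rpow_pos_of_pos hpos _
          linarith

theorem integrable_sinc_sq : Integrable fun x : ℝ => Real.sinc (Real.pi * x) ^ 2 := by
  refine integrable_rpow_mul_sinc_sq.mono' ?_ (Eventually.of_forall fun x => ?_)
  · refine Continuous.aestronglyMeasurable ?_
    have := Real.continuous_sinc
    fun_prop
  · rw [Real.norm_of_nonneg (by positivity)]
    exact le_mul_of_one_le_right (by positivity) (by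
      have : 0 ≤ |x| ^ (1 / 2 : ℝ) := by positivity
      linarith)

/-- The tent function is the Fourier transform of the Fejér kernel. -/
theorem tent_eq_integral (s : ℝ) :
    (tent s : ℂ) = ∫ x : ℝ, ((Real.sinc (Real.pi * x) ^ 2 : ℝ) : ℂ) * character (s * x) := by
  have hcont : Continuous fun s => (tent s : ℂ) := Complex.continuous_ofReal.comp continuous_tent
  have hint : Integrable fun s => (tent s : ℂ) := by
    refine hcont.integrable_of_hasCompactSupport
      (HasCompactSupport.of_support_subset_isCompact (isCompact_Icc (a := (-1 : ℝ)) (b := 1)) ?_)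
    intro v hv
    by_contra hnot
    refine hv ?_
    have : 1 ≤ |v| := by
      by_contra hlt
      have := abs_lt.1 (not_le.1 hlt)
      exact hnot ⟨this.1.le, this.2.le⟩
    simp [tent_of_one_le this]
  have hae : 𝓕 (fun s => (tent s : ℂ)) =ᵐ[volume]
      fun x => ((Real.sinc (Real.pi * x) ^ 2 : ℝ) : ℂ) := by
    have : ∀ᵐ x : ℝ, x ≠ 0 := by simp [ae_iff]
    filter_upwards [this] with x hx using fourier_tent hx
  have hint' : Integrable (𝓕 fun s => (tent s : ℂ)) :=
    (integrable_sinc_sq.ofReal).congr hae.symm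
  have hinv := congrFun (hcont.fourierInv_fourier_eq hint hint') s
  rw [Real.fourierInv_eq'] at hinv
  rw [← hinv]
  refine integral_congr_ae ?_
  filter_upwards [hae] with x hx
  rw [hx, smul_eq_mul, mul_comm, character]
  congr 2
  simp
  ring

/-! ### Sums truncated by a single linear form -/

section SingleForm

variable {ι : Type*} [Fintype ι]

/-- The general term `∏ₖ 𝐞(yₖ uₖ) / yₖ ^ pₖ` of a diagonal sum in diagonal coordinates. -/
noncomputable def diagTerm (p : ι → ℕ) (u : ι → ℝ) (y : ι → ℤ) : ℂ :=
  ∏ k, fourierTerm (p k) (u k) (y k)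

theorem norm_diagTerm_le {p : ι → ℕ} (hp : ∀ k, 1 ≤ p k) (u : ι → ℝ) (y : ι → ℤ) :
    ‖diagTerm p u y‖ ≤ weight y := by
  rw [diagTerm, norm_prod, weight]
  exact Finset.prod_le_prod (fun _ _ => norm_nonneg _) fun k _ => norm_fourierTerm_le (hp k) _ _

theorem diagTerm_eq_zero {p : ι → ℕ} (hp : ∀ k, 1 ≤ p k) (u : ι → ℝ) {y : ι → ℤ} {k : ι}
    (h : y k = 0) : diagTerm p u y = 0 :=
  Finset.prod_eq_zero (Finset.mem_univ k) (by rw [h, fourierTerm_zero (hp k)])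

theorem fourierTerm_add (p : ℕ) (u v : ℝ) (n : ℤ) :
    fourierTerm p (u + v) n = fourierTerm p u n * character (n * v) := by
  rw [fourierTerm, fourierTerm, mul_add, character_add]
  ring

theorem diagTerm_mul_character (p : ι → ℕ) (u q : ι → ℝ) (y : ι → ℤ) (x : ℝ) :
    diagTerm p u y * character (latticeForm q y * x) =
      diagTerm p (fun k => u k + q k * x) y := by
  have h : latticeForm q y * x = ∑ k, (y k : ℝ) * (q k * x) := by
    rw [latticeForm, Finset.sum_mul]
    exact Finset.sum_congr rfl fun k _ => by ring
  rw [h, character_sum, diagTerm, diagTerm, ← Finset.prod_mul_distrib]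
  exact Finset.prod_congr rfl fun k _ => (fourierTerm_add _ _ _ _).symm

theorem continuous_fourierPartial (p N : ℕ) : Continuous fun u => fourierPartial p u N := by
  unfold fourierPartial fourierTerm
  have := continuous_character
  fun_prop

theorem measurable_fourierLimit {p : ℕ} (hp : 1 ≤ p) : Measurable (fourierLimit p) :=
  measurable_of_tendsto_metrizable (fun N => (continuous_fourierPartial p N).measurable)
    (tendsto_pi_nhds.2 fun u => tendsto_fourierPartial hp u)

theorem exists_norm_prod_le {p : ι → ℕ} (hp : ∀ k, 1 ≤ p k) :
    ∃ D : ℝ, 1 ≤ D ∧ (∀ k u N, ‖fourierPartial (p k) u N‖ ≤ D) ∧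
      ∀ k u, ‖fourierLimit (p k) u‖ ≤ D := by
  choose C hC0 hC using fun k => exists_norm_fourierPartial_le (hp k)
  have hk : ∀ k, C k ≤ 1 + ∑ k, C k := fun k => by
    have := Finset.single_le_sum (f := C) (fun k _ => hC0 k) (Finset.mem_univ k)
    linarith
  refine ⟨1 + ∑ k, C k, ?_, fun k u N => (hC k u N).trans (hk k), fun k u => ?_⟩
  · have := Finset.sum_nonneg fun k (_ : k ∈ Finset.univ) => hC0 k
    linarith
  · exact le_of_tendsto (tendsto_fourierPartial (hp k) u).norm
      (Eventually.of_forall fun N => (hC k u N).trans (hk k))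

theorem norm_prod_le_pow {a : ι → ℂ} {D : ℝ} (h : ∀ k, ‖a k‖ ≤ D) :
    ‖∏ k, a k‖ ≤ D ^ Fintype.card ι := by
  rw [norm_prod, ← Finset.card_univ, ← Finset.prod_const]
  exact Finset.prod_le_prod (fun _ _ => norm_nonneg _) fun k _ => h k

variable [DecidableEq ι]

/-- The cube of lattice points all of whose coordinates are at most `N` in absolute value. -/
noncomputable def cube (ι : Type*) [Fintype ι] [DecidableEq ι] (N : ℕ) : Finset (ι → ℤ) :=
  Fintype.piFinset fun _ => Finset.Icc (-(N : ℤ)) N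

theorem mem_cube {N : ℕ} {y : ι → ℤ} : y ∈ cube ι N ↔ ∀ k, |y k| ≤ N := by
  simp only [cube, Fintype.mem_piFinset, Finset.mem_Icc, abs_le]

theorem tendsto_cube : Tendsto (cube ι) atTop atTop := by
  refine tendsto_atTop_finset_of_monotone (fun a b hab y hy => ?_) fun y => ?_
  · rw [mem_cube] at hy ⊢
    exact fun k => (hy k).trans (by exact_mod_cast hab)
  · refine ⟨∑ k, (y k).natAbs, mem_cube.2 fun k => ?_⟩
    rw [Int.abs_eq_natAbs]
    exact_mod_cast Finset.single_le_sum (f := fun k => (y k).natAbs) (fun _ _ => Nat.zero_le _)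
      (Finset.mem_univ k)

theorem sum_cube_diagTerm (p : ι → ℕ) (u : ι → ℝ) (N : ℕ) :
    ∑ y ∈ cube ι N, diagTerm p u y = ∏ k, fourierPartial (p k) (u k) N := by
  simp only [fourierPartial]
  rw [Finset.prod_univ_sum]
  rfl

theorem sum_cube_mul_tent (p : ι → ℕ) (u q : ι → ℝ) (T : ℝ) (N : ℕ) :
    ∑ y ∈ cube ι N, diagTerm p u y * (tent (latticeForm q y / T) : ℂ) =
      ∫ x : ℝ, ((Real.sinc (Real.pi * x) ^ 2 : ℝ) : ℂ) *
        ∏ k, fourierPartial (p k) (u k + q k * (x / T)) N := by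
  have h1 : ∀ x : ℝ, ((Real.sinc (Real.pi * x) ^ 2 : ℝ) : ℂ) *
      ∏ k, fourierPartial (p k) (u k + q k * (x / T)) N =
      ∑ y ∈ cube ι N, diagTerm p u y *
        (((Real.sinc (Real.pi * x) ^ 2 : ℝ) : ℂ) * character (latticeForm q y / T * x)) := by
    intro x
    rw [← sum_cube_diagTerm, Finset.mul_sum]
    refine Finset.sum_congr rfl fun y _ => ?_
    rw [← diagTerm_mul_character, div_mul_eq_mul_div, mul_div_assoc]
    ring
  simp_rw [h1]
  rw [integral_finsetSum]
  · refine Finset.sum_congr rfl fun y _ => ?_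
    rw [integral_const_mul, ← tent_eq_integral]
  · intro y _
    refine Integrable.const_mul ?_ _
    refine integrable_sinc_sq.mono' ?_ (Eventually.of_forall fun x => ?_)
    · have := continuous_character
      have := Real.continuous_sinc
      exact Continuous.aestronglyMeasurable (by fun_prop)
    · rw [norm_mul, norm_character, mul_one, Complex.norm_real,
        Real.norm_of_nonneg (by positivity)]

/-- Every sum whose terms are supported in a finite union of strips converges absolutely. -/
theorem summable_of_strip [Nonempty ι] {p : ι → ℕ} (hp : ∀ k, 1 ≤ p k) (u : ι → ℝ) {m : ℕ}
    {Q : Fin m → ι → ℝ} (hQ : ∀ i j, Q i j ≠ 0) {T c : ℝ} (hT : 1 ≤ T) (hc : 0 ≤ c)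
    {f : (ι → ℤ) → ℂ} (hf : ∀ y, ‖f y‖ ≤ c * ‖diagTerm p u y‖)
    (hsupp : ∀ y, f y ≠ 0 → ∃ i, |latticeForm (Q i) y| ≤ T) : Summable f := by
  obtain ⟨C, hC0, hC⟩ := exists_sum_weight_strip_le hQ one_pos le_rfl
  refine (summable_and_norm_tsum_le (S := {y | f y ≠ 0}) (c := c)
    (b := C * T * 1 ^ ((1 : ℝ) - 1)) hc ?_ (fun y hy => not_not.1 hy) ?_).1
  · exact fun y _ => (hf y).trans (mul_le_mul_of_nonneg_left (norm_diagTerm_le hp u y) hc)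
  · intro A hA
    refine hC A T 1 hT one_pos (fun y hy => hsupp y (hA y hy)) fun y hy => ?_
    obtain ⟨k⟩ := ‹Nonempty ι›
    refine ⟨k, one_le_abs_cast fun hk => hA y hy ?_⟩
    have := hf y
    rw [diagTerm_eq_zero hp u hk, norm_zero, mul_zero] at this
    exact norm_le_zero_iff.1 this

theorem summable_mul_tent [Nonempty ι] {p : ι → ℕ} (hp : ∀ k, 1 ≤ p k) (u : ι → ℝ) {q : ι → ℝ}
    (hq : ∀ j, q j ≠ 0) {T : ℝ} (hT : 1 ≤ T) :
    Summable fun y => diagTerm p u y * (tent (latticeForm q y / T) : ℂ) := by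
  have hT0 : 0 < T := by linarith
  refine summable_of_strip hp u (Q := fun _ : Fin 1 => q) (fun _ j => hq j) hT zero_le_one
    (fun y => ?_) fun y hy => ⟨0, ?_⟩
  · rw [norm_mul, one_mul, Complex.norm_real, Real.norm_of_nonneg (tent_nonneg _)]
    exact mul_le_of_le_one_right (norm_nonneg _) (tent_le_one _)
  · by_contra hlt
    refine hy ?_
    rw [tent_of_one_le, Complex.ofReal_zero, mul_zero]
    rw [abs_div, abs_of_pos hT0, le_div_iff₀ hT0]
    linarith

theorem integrable_sinc_sq_mul {g : ℝ → ℂ} (hg : Measurable g) {D : ℝ} (hD : ∀ x, ‖g x‖ ≤ D) :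
    Integrable fun x : ℝ => ((Real.sinc (Real.pi * x) ^ 2 : ℝ) : ℂ) * g x := by
  refine (integrable_sinc_sq.mul_const D).mono' ?_ (Eventually.of_forall fun x => ?_)
  · refine AEStronglyMeasurable.mul ?_ hg.aestronglyMeasurable
    have := Real.continuous_sinc
    exact Continuous.aestronglyMeasurable (by fun_prop)
  · rw [norm_mul, Complex.norm_real, Real.norm_of_nonneg (by positivity)]
    exact mul_le_mul_of_nonneg_left (hD x) (by positivity)

/-- The Fejér mean of the lattice sum as an average of the limit functions along the line spanned
by `q`. -/
theorem tsum_mul_tent [Nonempty ι] {p : ι → ℕ} (hp : ∀ k, 1 ≤ p k) (u : ι → ℝ) {q : ι → ℝ}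
    (hq : ∀ j, q j ≠ 0) {T : ℝ} (hT : 1 ≤ T) :
    ∑' y, diagTerm p u y * (tent (latticeForm q y / T) : ℂ) =
      ∫ x : ℝ, ((Real.sinc (Real.pi * x) ^ 2 : ℝ) : ℂ) *
        ∏ k, fourierLimit (p k) (u k + q k * (x / T)) := by
  have h1 := (summable_mul_tent hp u hq hT).hasSum.comp tendsto_cube
  refine tendsto_nhds_unique h1 ?_
  have h2 : ((fun s : Finset (ι → ℤ) => ∑ y ∈ s, diagTerm p u y *
      (tent (latticeForm q y / T) : ℂ)) ∘ cube ι) = fun N => ∫ x : ℝ,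
      ((Real.sinc (Real.pi * x) ^ 2 : ℝ) : ℂ) *
        ∏ k, fourierPartial (p k) (u k + q k * (x / T)) N :=
    funext fun N => sum_cube_mul_tent p u q T N
  rw [h2]
  obtain ⟨D, hD1, hD, -⟩ := exists_norm_prod_le hp
  refine tendsto_integral_of_dominated_convergence
    (fun x => Real.sinc (Real.pi * x) ^ 2 * D ^ Fintype.card ι) (fun N => ?_)
    (integrable_sinc_sq.mul_const _) (fun N => Eventually.of_forall fun x => ?_)
    (Eventually.of_forall fun x => ?_)
  · have := Real.continuous_sinc
    have h3 : ∀ k, Continuous fun x : ℝ => fourierPartial (p k) (u k + q k * (x / T)) N :=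
      fun k => (continuous_fourierPartial (p k) N).comp (by fun_prop)
    exact Continuous.aestronglyMeasurable (by fun_prop)
  · rw [norm_mul, Complex.norm_real, Real.norm_of_nonneg (by positivity)]
    exact mul_le_mul_of_nonneg_left (norm_prod_le_pow fun k => hD k _ N) (by positivity)
  · exact (tendsto_finsetProd _ fun k _ => tendsto_fourierPartial (hp k) _).const_mul _

theorem integral_sinc_sq : ∫ x : ℝ, ((Real.sinc (Real.pi * x) ^ 2 : ℝ) : ℂ) = 1 := by
  have := tent_eq_integral 0
  simp only [zero_mul, character_zero, mul_one] at this
  rw [← this]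
  simp [tent]

theorem integral_sinc_sq_mul_sign :
    ∫ x : ℝ, ((Real.sinc (Real.pi * x) ^ 2 : ℝ) : ℂ) * (Real.sign x : ℂ) = 0 := by
  have h := integral_neg_eq_self
    (fun x : ℝ => ((Real.sinc (Real.pi * x) ^ 2 : ℝ) : ℂ) * (Real.sign x : ℂ)) volume
  simp only [mul_neg, Real.sinc_neg, Real.sign_neg, Complex.ofReal_neg, integral_neg] at h
  exact self_eq_neg.1 h.symm

theorem measurable_sign : Measurable Real.sign := by
  have : Real.sign = fun r : ℝ => if r < 0 then (-1 : ℝ) else if 0 < r then 1 else 0 := rfl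
  rw [this]
  exact Measurable.ite measurableSet_Iio measurable_const
    (Measurable.ite measurableSet_Ioi measurable_const measurable_const)

theorem norm_fourierSide_le {p : ℕ} {u D : ℝ} (h : ∀ v, ‖fourierLimit p v‖ ≤ D) (s : ℝ)
    (hs : |s| ≤ 1) : ‖fourierSide p u s‖ ≤ D + Real.pi := by
  rw [fourierSide]
  split_ifs with hc
  · obtain ⟨rfl, -⟩ := hc
    have hD : 0 ≤ D := (norm_nonneg _).trans (h 0)
    rw [pow_one, Nat.factorial_one, Nat.cast_one, div_one, norm_two_pi_I_mul, abs_neg, abs_div,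
      abs_two]
    nlinarith [Real.pi_pos]
  · linarith [h u, Real.pi_pos]

theorem abs_sign_le_one (x : ℝ) : |Real.sign x| ≤ 1 := by
  rcases Real.sign_apply_eq x with h | h | h <;> rw [h] <;> norm_num

/-- The mean of the two one-sided limits at `u` along the line spanned by `q`. -/
noncomputable def sideMean (p : ι → ℕ) (u q : ι → ℝ) : ℂ :=
  (∏ k, fourierSide (p k) (u k) (Real.sign (q k)) +
    ∏ k, fourierSide (p k) (u k) (-Real.sign (q k))) / 2

/-- Fejér means of the sum converge, with the rate given by the one-sided Hölder continuity of the
limit functions. -/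
theorem exists_norm_tsum_mul_tent_sub_le [Nonempty ι] {p : ι → ℕ} (hp : ∀ k, 1 ≤ p k)
    (u : ι → ℝ) {q : ι → ℝ} (hq : ∀ j, q j ≠ 0) :
    ∃ C : ℝ, 0 ≤ C ∧ ∀ T : ℝ, 1 ≤ T →
      ‖∑' y, diagTerm p u y * (tent (latticeForm q y / T) : ℂ) - sideMean p u q‖ ≤
        C * T ^ (-(1 / 2) : ℝ) := by
  obtain ⟨D, hD1, -, hD⟩ := exists_norm_prod_le hp
  choose H hH0 hH using fun k => exists_norm_fourierLimit_sub_le (hp k) (u k)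
  set D' := D + Real.pi with hD'
  have hDD' : D ≤ D' := by linarith [Real.pi_pos]
  set K := D' ^ Fintype.card ι * ∑ k, H k * |q k| ^ (1 / 2 : ℝ) with hK
  have hsum0 : 0 ≤ ∑ k, H k * |q k| ^ (1 / 2 : ℝ) :=
    Finset.sum_nonneg fun k _ => mul_nonneg (hH0 k) (by positivity)
  have hK0 : 0 ≤ K := by positivity
  set I := ∫ x : ℝ, Real.sinc (Real.pi * x) ^ 2 * (1 + |x| ^ (1 / 2 : ℝ)) with hI
  have hI0 : 0 ≤ I := integral_nonneg fun x => by positivity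
  refine ⟨K * I, by positivity, fun T hT => ?_⟩
  have hT0 : 0 < T := by linarith
  set α := sideMean p u q with hα
  set β : ℂ := (∏ k, fourierSide (p k) (u k) (Real.sign (q k)) -
    ∏ k, fourierSide (p k) (u k) (-Real.sign (q k))) / 2 with hβ
  -- the product of the one-sided limits is `α + β` for `x > 0` and `α - β` for `x < 0`
  have hmain : ∫ x : ℝ, ((Real.sinc (Real.pi * x) ^ 2 : ℝ) : ℂ) *
      (α + β * (Real.sign x : ℂ)) = α := by
    have e1 : ∀ x : ℝ, ((Real.sinc (Real.pi * x) ^ 2 : ℝ) : ℂ) * (α + β * (Real.sign x : ℂ)) =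
        ((Real.sinc (Real.pi * x) ^ 2 : ℝ) : ℂ) * α +
        β * (((Real.sinc (Real.pi * x) ^ 2 : ℝ) : ℂ) * (Real.sign x : ℂ)) := fun x => by ring
    simp_rw [e1]
    rw [integral_add, integral_mul_const, integral_const_mul, integral_sinc_sq,
      integral_sinc_sq_mul_sign]
    · ring
    · exact integrable_sinc_sq_mul measurable_const (D := ‖α‖) fun x => le_rfl
    · refine (integrable_sinc_sq_mul (D := 1) ?_ fun x => ?_).const_mul β
      · exact Complex.measurable_ofReal.comp measurable_sign
      · rw [Complex.norm_real]
        exact abs_sign_le_one x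
  have hint1 : Integrable fun x : ℝ => ((Real.sinc (Real.pi * x) ^ 2 : ℝ) : ℂ) *
      ∏ k, fourierLimit (p k) (u k + q k * (x / T)) :=
    integrable_sinc_sq_mul
      (Finset.measurable_prod _ fun k _ => (measurable_fourierLimit (hp k)).comp (by fun_prop))
      (fun x => norm_prod_le_pow fun k => hD k _)
  have hint2 : Integrable fun x : ℝ => ((Real.sinc (Real.pi * x) ^ 2 : ℝ) : ℂ) *
      (α + β * (Real.sign x : ℂ)) := by
    refine integrable_sinc_sq_mul (D := ‖α‖ + ‖β‖ * 1) ?_ fun x => ?_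
    · exact measurable_const.add
        (measurable_const.mul (Complex.measurable_ofReal.comp measurable_sign))
    · refine (norm_add_le _ _).trans (add_le_add le_rfl ?_)
      rw [norm_mul, Complex.norm_real]
      exact mul_le_mul_of_nonneg_left (abs_sign_le_one x) (norm_nonneg _)
  have hpt : ∀ x : ℝ, x ≠ 0 → ‖((Real.sinc (Real.pi * x) ^ 2 : ℝ) : ℂ) *
      ∏ k, fourierLimit (p k) (u k + q k * (x / T)) -
      ((Real.sinc (Real.pi * x) ^ 2 : ℝ) : ℂ) * (α + β * (Real.sign x : ℂ))‖ ≤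
      K * T ^ (-(1 / 2) : ℝ) * (Real.sinc (Real.pi * x) ^ 2 * (1 + |x| ^ (1 / 2 : ℝ))) := by
    intro x hx
    have e1 : α + β * (Real.sign x : ℂ) =
        ∏ k, fourierSide (p k) (u k) (Real.sign (q k * (x / T))) := by
      have e2 : ∀ k, Real.sign (q k * (x / T)) = Real.sign (q k) * Real.sign x := by
        intro k
        rcases lt_or_gt_of_ne (hq k) with h1 | h1 <;> rcases lt_or_gt_of_ne hx with h2 | h2
        · rw [Real.sign_of_neg h1, Real.sign_of_neg h2, Real.sign_of_pos
            (mul_pos_of_neg_of_neg h1 (div_neg_of_neg_of_pos h2 hT0))]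
          norm_num
        · rw [Real.sign_of_neg h1, Real.sign_of_pos h2, Real.sign_of_neg
            (mul_neg_of_neg_of_pos h1 (div_pos h2 hT0))]
          norm_num
        · rw [Real.sign_of_pos h1, Real.sign_of_neg h2, Real.sign_of_neg
            (mul_neg_of_pos_of_neg h1 (div_neg_of_neg_of_pos h2 hT0))]
          norm_num
        · rw [Real.sign_of_pos h1, Real.sign_of_pos h2, Real.sign_of_pos
            (mul_pos h1 (div_pos h2 hT0))]
          norm_num
      simp_rw [e2]
      rw [hα, sideMean, hβ]
      rcases lt_or_gt_of_ne hx with h2 | h2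
      · rw [Real.sign_of_neg h2]
        simp only [mul_neg_one]
        push_cast
        ring
      · rw [Real.sign_of_pos h2]
        simp only [mul_one]
        push_cast
        ring
    rw [e1, ← mul_sub, norm_mul, Complex.norm_real, Real.norm_of_nonneg (by positivity)]
    have e3 := norm_prod_sub_prod_le Finset.univ (D := D') (by linarith)
      (a := fun k => fourierLimit (p k) (u k + q k * (x / T)))
      (b := fun k => fourierSide (p k) (u k) (Real.sign (q k * (x / T))))
      (fun k => (hD k _).trans hDD') fun k => norm_fourierSide_le (hD k) _ (abs_sign_le_one _)
    have e4 : ∑ k, ‖fourierLimit (p k) (u k + q k * (x / T)) -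
        fourierSide (p k) (u k) (Real.sign (q k * (x / T)))‖ ≤
        (∑ k, H k * |q k| ^ (1 / 2 : ℝ)) * (|x| ^ (1 / 2 : ℝ) * T ^ (-(1 / 2) : ℝ)) := by
      rw [Finset.sum_mul]
      refine Finset.sum_le_sum fun k _ => ?_
      refine (hH k _ (mul_ne_zero (hq k) (div_ne_zero hx hT0.ne'))).trans (le_of_eq ?_)
      rw [abs_mul, abs_div, abs_of_pos hT0, Real.mul_rpow (abs_nonneg _) (by positivity),
        Real.div_rpow (abs_nonneg _) hT0.le, Real.rpow_neg hT0.le]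
      ring
    have e5 : |x| ^ (1 / 2 : ℝ) ≤ 1 + |x| ^ (1 / 2 : ℝ) := by linarith
    have hT' : 0 ≤ T ^ (-(1 / 2) : ℝ) := by positivity
    calc _ ≤ Real.sinc (Real.pi * x) ^ 2 * (D' ^ Fintype.card ι *
          ((∑ k, H k * |q k| ^ (1 / 2 : ℝ)) *
            ((1 + |x| ^ (1 / 2 : ℝ)) * T ^ (-(1 / 2) : ℝ)))) := by
          refine mul_le_mul_of_nonneg_left (e3.trans ?_) (by positivity)
          rw [Finset.card_univ]
          refine mul_le_mul_of_nonneg_left (e4.trans ?_) (by positivity)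
          exact mul_le_mul_of_nonneg_left (mul_le_mul_of_nonneg_right e5 hT') hsum0
      _ = _ := by rw [hK]; ring
  rw [tsum_mul_tent hp u hq hT]
  conv_lhs => rw [← hmain]
  rw [← integral_sub hint1 hint2]
  calc _ ≤ ∫ x : ℝ, K * T ^ (-(1 / 2) : ℝ) *
        (Real.sinc (Real.pi * x) ^ 2 * (1 + |x| ^ (1 / 2 : ℝ))) := by
        refine norm_integral_le_of_norm_le (integrable_rpow_mul_sinc_sq.const_mul _) ?_
        have : ∀ᵐ x : ℝ, x ≠ 0 := by simp [ae_iff]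
        filter_upwards [this] with x hx using hpt x hx
    _ = _ := by
        rw [integral_const_mul]
        ring

end SingleForm

/-! ### Sharp truncation by a single form -/

section SharpSingleForm

variable {ι : Type*} [Fintype ι]

open Classical in
/-- The sum over the lattice points with `|Q(y)| < t`, for a product `Q` of linear forms. -/
noncomputable def sharpSum (p : ι → ℕ) (u : ι → ℝ) {m : ℕ} (Q : Fin m → ι → ℝ) (t : ℝ) : ℂ :=
  ∑' y, if |∏ i, latticeForm (Q i) y| < t then diagTerm p u y else 0

open Classical in
/-- The sum over the lattice points in the strip `|q(y)| < T`. -/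
noncomputable def stripSum (p : ι → ℕ) (u : ι → ℝ) (q : ι → ℝ) (T : ℝ) : ℂ :=
  ∑' y, if |latticeForm q y| < T then diagTerm p u y else 0

theorem exists_le_of_prod_lt {m : ℕ} {a : Fin m → ℝ} {T : ℝ} (hT : 0 ≤ T)
    (h : |∏ i, a i| < T ^ m) : ∃ i, |a i| ≤ T := by
  by_contra hne
  push Not at hne
  refine absurd h (not_lt.2 ?_)
  rw [Finset.abs_prod]
  calc T ^ m = ∏ _i : Fin m, T := by simp
    _ ≤ _ := Finset.prod_le_prod (fun _ _ => hT) fun i _ => (hne i).le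

variable [DecidableEq ι] [Nonempty ι]

open Classical in
theorem summable_sharp {p : ι → ℕ} (hp : ∀ k, 1 ≤ p k) (u : ι → ℝ) {m : ℕ} (hm : 1 ≤ m)
    {Q : Fin m → ι → ℝ} (hQ : ∀ i j, Q i j ≠ 0) (t : ℝ) :
    Summable fun y => if |∏ i, latticeForm (Q i) y| < t then diagTerm p u y else 0 := by
  refine summable_of_strip hp u hQ (le_max_left 1 t) zero_le_one (fun y => ?_) fun y hy => ?_
  · rw [one_mul]
    split_ifs
    · exact le_rfl
    · rw [norm_zero]
      exact norm_nonneg _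
  · have hlt : |∏ i, latticeForm (Q i) y| < t := by
      by_contra hge
      exact hy (if_neg hge)
    refine exists_le_of_prod_lt (by positivity) (hlt.trans_le ((le_max_right 1 t).trans ?_))
    exact le_self_pow₀ (le_max_left 1 t) (by omega)

open Classical in
theorem summable_strip {p : ι → ℕ} (hp : ∀ k, 1 ≤ p k) (u : ι → ℝ) {q : ι → ℝ}
    (hq : ∀ j, q j ≠ 0) (T : ℝ) :
    Summable fun y => if |latticeForm q y| < T then diagTerm p u y else 0 := by
  simpa using summable_sharp hp u le_rfl (Q := fun _ : Fin 1 => q) (fun _ j => hq j) T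

theorem mul_tent_div {s T : ℝ} (hT : 0 < T) : T * tent (s / T) = max 0 (T - |s|) := by
  rw [tent, mul_max_of_nonneg _ _ hT.le, mul_zero, mul_sub, mul_one, abs_div, abs_of_pos hT,
    mul_div_cancel₀ _ hT.ne']

/-- The sum over a strip converges to the mean of the one-sided limits: the sharp cutoff is compared
with a difference quotient of Fejér means over an interval of length `T ^ (3 / 4)`. -/
theorem tendsto_stripSum {p : ι → ℕ} (hp : ∀ k, 1 ≤ p k) (u : ι → ℝ) {q : ι → ℝ}
    (hq : ∀ j, q j ≠ 0) : Tendsto (stripSum p u q) atTop (𝓝 (sideMean p u q)) := by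
  classical
  obtain ⟨C, hC0, hC⟩ := exists_norm_tsum_mul_tent_sub_le hp u hq
  obtain ⟨C', hC'0, hC'⟩ := exists_sum_weight_transition_le (Q := fun _ : Fin 1 => q) le_rfl
    (fun _ j => hq j) (θ := 1 / 8) (by norm_num) (by norm_num)
  set M : ℝ → ℂ := fun T => ∑' y, diagTerm p u y * (tent (latticeForm q y / T) : ℂ) with hM
  set L := sideMean p u q with hL
  have key : ∀ T : ℝ, 1 ≤ T →
      ‖stripSum p u q T - L‖ ≤ (3 * C + 2 * C') * T ^ (-(1 / 8) : ℝ) := by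
    intro T hT
    have hT0 : 0 < T := by linarith
    set δ := T ^ (3 / 4 : ℝ) with hδ
    have hδ0 : 0 < δ := Real.rpow_pos_of_pos hT0 _
    have hδT : δ ≤ T := by
      conv_rhs => rw [← Real.rpow_one T]
      exact Real.rpow_le_rpow_of_exponent_le hT (by norm_num)
    set T' := T + δ with hT'
    have hT'0 : 0 < T' := by linarith
    -- the difference quotient of `T * tent (s / T) = (T - |s|)⁺` is the indicator of `|s| < T` away
    -- from the transition region
    let r : (ι → ℤ) → ℂ := fun y =>
      diagTerm p u y * ((T' * tent (latticeForm q y / T') - T * tent (latticeForm q y / T) -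
        (if |latticeForm q y| < T then δ else 0) : ℝ) : ℂ)
    have hr0 : ∀ y, ¬ (T ≤ |latticeForm q y| ∧ |latticeForm q y| ≤ T') → r y = 0 := by
      intro y hy
      simp only [r, mul_tent_div hT0, mul_tent_div hT'0]
      rcases lt_or_ge |latticeForm q y| T with h1 | h1
      · rw [if_pos h1, max_eq_right (by linarith), max_eq_right (by linarith)]
        have : T' - |latticeForm q y| - (T - |latticeForm q y|) - δ = 0 := by rw [hT']; ring
        rw [this, Complex.ofReal_zero, mul_zero]
      · have h2 : T' < |latticeForm q y| := by
          by_contra h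
          exact hy ⟨h1, not_lt.1 h⟩
        rw [if_neg (not_lt.2 h1), max_eq_left (by linarith), max_eq_left (by linarith)]
        simp
    have hr : ∀ y, ‖r y‖ ≤ δ * weight y := by
      intro y
      by_cases hy : T ≤ |latticeForm q y| ∧ |latticeForm q y| ≤ T'
      · simp only [r, mul_tent_div hT0, mul_tent_div hT'0]
        rw [if_neg (not_lt.2 hy.1), max_eq_right (by linarith [hy.2]),
          max_eq_left (by linarith [hy.1]), norm_mul, Complex.norm_real, mul_comm]
        refine mul_le_mul ?_ (norm_diagTerm_le hp u y) (norm_nonneg _) hδ0.le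
        rw [Real.norm_eq_abs, abs_le]
        constructor <;> linarith [hy.1, hy.2]
      · rw [hr0 y hy, norm_zero]
        exact mul_nonneg hδ0.le (weight_nonneg y)
    have hε : T ^ (-(1 / 4) : ℝ) * T = δ := by
      rw [hδ, ← Real.rpow_add_one hT0.ne']
      norm_num
    have hrsum : ‖∑' y, r y‖ ≤ δ * (C' * (1 + δ) * T ^ (-(7 / 8) : ℝ)) := by
      refine (summable_and_norm_tsum_le
        (S := {y | T ≤ |latticeForm q y| ∧ |latticeForm q y| ≤ T'}) hδ0.le
        (fun y _ => hr y) (fun y hy => hr0 y hy) fun A hA => ?_).2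
      have := hC' A T (T ^ (-(1 / 4) : ℝ)) hT0 (by positivity) fun y hy => by
        simp only [Finset.univ_unique, Finset.prod_singleton, pow_one]
        refine ⟨(hA y hy).1, (hA y hy).2.trans (le_of_eq ?_)⟩
        rw [mul_add, mul_one, mul_comm T (T ^ _), hε]
      refine this.trans (le_of_eq ?_)
      rw [Nat.cast_one, div_one, Real.rpow_one, hε]
      norm_num
    have hident : (δ : ℂ) * stripSum p u q T = T' * M T' - T * M T - ∑' y, r y := by
      have s1 := (summable_mul_tent hp u hq (T := T') (by linarith)).mul_left (T' : ℂ)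
      have s2 := (summable_mul_tent hp u hq hT).mul_left (T : ℂ)
      have s3 := (summable_strip hp u hq T).mul_left (δ : ℂ)
      have hrs : r = fun y =>
          (T' * (diagTerm p u y * (tent (latticeForm q y / T') : ℂ)) -
            T * (diagTerm p u y * (tent (latticeForm q y / T) : ℂ))) -
          δ * (if |latticeForm q y| < T then diagTerm p u y else 0) := by
        funext y
        simp only [r]
        split_ifs <;> push_cast <;> ring
      rw [hrs, ((s1.sub s2).tsum_sub s3), s1.tsum_sub s2, tsum_mul_left, tsum_mul_left,
        tsum_mul_left, stripSum, hM]
      ring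
    have hδC : (δ : ℂ) ≠ 0 := by exact_mod_cast hδ0.ne'
    have hdiff : (δ : ℂ) * (stripSum p u q T - L) =
        T' * (M T' - L) - T * (M T - L) - ∑' y, r y := by
      rw [mul_sub, hident, hT']
      push_cast
      ring
    have hhalf : ∀ x : ℝ, 1 ≤ x → ‖(x : ℂ) * (M x - L)‖ ≤ C * x ^ (1 / 2 : ℝ) := by
      intro x hx
      have hx0 : 0 < x := by linarith
      rw [norm_mul, Complex.norm_real, Real.norm_of_nonneg hx0.le]
      calc x * ‖M x - L‖ ≤ x * (C * x ^ (-(1 / 2) : ℝ)) :=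
            mul_le_mul_of_nonneg_left (hC x hx) hx0.le
        _ = C * (x ^ (-(1 / 2) : ℝ) * x) := by ring
        _ = C * x ^ (1 / 2 : ℝ) := by
            rw [← Real.rpow_add_one hx0.ne']
            norm_num
    have hT'half : T' ^ (1 / 2 : ℝ) ≤ 2 * T ^ (1 / 2 : ℝ) := by
      calc T' ^ (1 / 2 : ℝ) ≤ (4 * T) ^ (1 / 2 : ℝ) :=
            Real.rpow_le_rpow hT'0.le (by linarith) (by norm_num)
        _ = 2 * T ^ (1 / 2 : ℝ) := by
            rw [Real.mul_rpow (by norm_num) hT0.le, ← Real.sqrt_eq_rpow,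
              show (4 : ℝ) = 2 ^ 2 by norm_num, Real.sqrt_sq (by norm_num)]
    have hnorm : δ * ‖stripSum p u q T - L‖ ≤
        3 * C * T ^ (1 / 2 : ℝ) + δ * (C' * (1 + δ) * T ^ (-(7 / 8) : ℝ)) := by
      have : δ * ‖stripSum p u q T - L‖ = ‖(δ : ℂ) * (stripSum p u q T - L)‖ := by
        rw [norm_mul, Complex.norm_real, Real.norm_of_nonneg hδ0.le]
      rw [this, hdiff]
      refine (norm_sub_le _ _).trans (add_le_add ((norm_sub_le _ _).trans ?_) hrsum)
      have h1 := hhalf T' (by linarith)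
      have h2 := hhalf T hT
      have h3 := mul_le_mul_of_nonneg_left hT'half hC0
      linarith
    have hδ1 : 1 ≤ δ := Real.one_le_rpow hT (by norm_num)
    have e1 : T ^ (1 / 2 : ℝ) = δ * T ^ (-(1 / 4) : ℝ) := by
      rw [hδ, ← Real.rpow_add hT0]
      norm_num
    have e2 : δ * T ^ (-(7 / 8) : ℝ) = T ^ (-(1 / 8) : ℝ) := by
      rw [hδ, ← Real.rpow_add hT0]
      norm_num
    have e3 : T ^ (-(1 / 4) : ℝ) ≤ T ^ (-(1 / 8) : ℝ) :=
      Real.rpow_le_rpow_of_exponent_le hT (by norm_num)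
    have e4 : (1 + δ) * T ^ (-(7 / 8) : ℝ) ≤ 2 * T ^ (-(1 / 8) : ℝ) := by
      rw [← e2, ← mul_assoc]
      exact mul_le_mul_of_nonneg_right (by linarith) (by positivity)
    refine le_of_mul_le_mul_left (hnorm.trans ?_) hδ0
    rw [e1, add_mul (3 * C) (2 * C'), mul_add δ (3 * C * _)]
    refine add_le_add ?_ ?_
    · calc 3 * C * (δ * T ^ (-(1 / 4) : ℝ)) = δ * (3 * C * T ^ (-(1 / 4) : ℝ)) := by ring
        _ ≤ _ := by gcongr
    · refine mul_le_mul_of_nonneg_left ?_ hδ0.le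
      calc C' * (1 + δ) * T ^ (-(7 / 8) : ℝ) = C' * ((1 + δ) * T ^ (-(7 / 8) : ℝ)) := by ring
        _ ≤ C' * (2 * T ^ (-(1 / 8) : ℝ)) := mul_le_mul_of_nonneg_left e4 hC'0
        _ = _ := by ring
  rw [tendsto_iff_norm_sub_tendsto_zero]
  refine squeeze_zero' (Eventually.of_forall fun T => norm_nonneg _)
    (eventually_atTop.2 ⟨1, key⟩) ?_
  have := (tendsto_rpow_neg_atTop (y := 1 / 8) (by norm_num)).const_mul (3 * C + 2 * C')
  simpa using this

end SharpSingleForm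

/-! ### Scale invariance of sums against Lipschitz functions -/

/-- The harmonic sum `1 + 1/2 + ⋯ + 1/N`. -/
noncomputable def harmonicSum (N : ℕ) : ℝ := ∑ i ∈ Finset.range N, 1 / ((i : ℝ) + 1)

theorem one_le_harmonicSum {N : ℕ} (hN : 1 ≤ N) : 1 ≤ harmonicSum N := by
  have := Finset.single_le_sum (f := fun i : ℕ => 1 / ((i : ℝ) + 1))
    (fun i _ => by positivity) (Finset.mem_range.2 hN)
  simpa [harmonicSum] using this

theorem harmonicSum_nonneg (N : ℕ) : 0 ≤ harmonicSum N :=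
  Finset.sum_nonneg fun i _ => by positivity

theorem harmonicSum_le (N : ℕ) : harmonicSum N ≤ 1 + Real.log N := by
  have h := harmonic_le_one_add_log N
  have : harmonicSum N = (harmonic N : ℝ) := by
    simp [harmonicSum, harmonic]
  rwa [this]

/-- Summation by parts against a nontrivial character. -/
theorem norm_sum_div_smul_pow_le {z : ℂ} (hz : ‖z‖ = 1) (hz1 : z ≠ 1) {N : ℕ} (hN : 1 ≤ N)
    {f : ℕ → ℝ} {c : ℝ} (hf : ∀ n, |f n| ≤ c * n) (hf' : ∀ n, |f (n + 1) - f n| ≤ 2 * c)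
    (hfN : f N = 0) :
    ‖∑ i ∈ Finset.range N, (f (i + 1) / ((i : ℝ) + 1)) • z ^ (i + 1)‖ ≤
      3 * c * (2 / ‖z - 1‖) * harmonicSum N := by
  have hc : 0 ≤ c := by simpa using (abs_nonneg _).trans (hf 1)
  have hb : ∀ n, ‖∑ i ∈ Finset.range n, z ^ (i + 1)‖ ≤ 2 / ‖z - 1‖ := fun n => by
    simpa using norm_geom_sum_le hz hz1 0 n
  have hb0 : 0 ≤ 2 / ‖z - 1‖ := by positivity
  obtain ⟨N, rfl⟩ : ∃ k, N = k + 1 := ⟨N - 1, by omega⟩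
  rw [Finset.sum_range_by_parts _ (fun i => z ^ (i + 1))]
  simp only [Nat.add_sub_cancel, hfN, zero_div, zero_smul, zero_sub, norm_neg]
  refine (norm_sum_le _ _).trans ?_
  rw [harmonicSum, Finset.mul_sum, Finset.sum_range_succ]
  refine le_add_of_le_of_nonneg (Finset.sum_le_sum fun i _ => ?_) (by positivity)
  rw [norm_smul, mul_assoc, mul_comm (2 / ‖z - 1‖), ← mul_assoc]
  refine mul_le_mul ?_ (hb _) (norm_nonneg _) (by positivity)
  have hi1 : (0 : ℝ) < (i : ℝ) + 1 := by positivity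
  have hi2 : (0 : ℝ) < (i : ℝ) + 2 := by positivity
  have h1 : f (i + 1 + 1) / (((i + 1 : ℕ) : ℝ) + 1) - f (i + 1) / ((i : ℝ) + 1) =
      ((f (i + 1 + 1) - f (i + 1)) - f (i + 1) / ((i : ℝ) + 1)) / ((i : ℝ) + 2) := by
    push_cast
    field_simp
    ring
  have h2 : |f (i + 1) / ((i : ℝ) + 1)| ≤ c := by
    rw [abs_div, abs_of_pos hi1, div_le_iff₀ hi1]
    simpa using hf (i + 1)
  rw [Real.norm_eq_abs, h1, abs_div, abs_of_pos hi2, mul_one_div]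
  refine div_le_div₀ (by positivity) ((abs_sub _ _).trans ?_) hi1 (by linarith)
  linarith [hf' (i + 1)]

/-- Comparison of the sum `∑ ψ(n / S) / n` with an integral which does not depend on `S`, except for
its end points. -/
theorem abs_sum_div_sub_integral_le {ψ : ℝ → ℝ} {c S : ℝ} (hS : 0 < S) (hψ0 : ψ 0 = 0)
    (hψ : ∀ x y, |ψ x - ψ y| ≤ c * |x - y|) {N : ℕ} (hN : 1 ≤ N) (hψN : ψ (N / S) = 0) :
    |∑ i ∈ Finset.range N, ψ (((i : ℝ) + 1) / S) / ((i : ℝ) + 1) -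
      ∫ x in (1 / S)..(N / S), ψ x / x| ≤ 2 * (c / S) * harmonicSum N := by
  have hc : 0 ≤ c := by simpa using (abs_nonneg _).trans (hψ 1 0)
  have hcont : Continuous ψ :=
    (LipschitzWith.of_dist_le_mul (K := ⟨c, hc⟩) fun x y => hψ x y).continuous
  have hsub : ∫ x in (1 / S)..(N / S), ψ x / x = ∫ x in (1 : ℝ)..N, ψ (x / S) / x := by
    have h1 : ∀ x : ℝ, ψ (x / S) / x = S⁻¹ * (ψ (x / S) / (x / S)) := fun x => by
      field_simp
    simp_rw [h1]
    rw [intervalIntegral.integral_const_mul,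
      intervalIntegral.integral_comp_div (fun y => ψ y / y) hS.ne', smul_eq_mul, ← mul_assoc,
      inv_mul_cancel₀ hS.ne', one_mul]
  have hint : ∀ a b : ℝ, 0 < a → 0 < b →
      IntervalIntegrable (fun x => ψ (x / S) / x) volume a b := by
    intro a b ha hb
    refine ContinuousOn.intervalIntegrable ?_
    refine ContinuousOn.div (by fun_prop) continuousOn_id fun x hx => ?_
    exact (lt_of_lt_of_le (lt_min ha hb) hx.1).ne'
  obtain ⟨N, rfl⟩ : ∃ k, N = k + 1 := ⟨N - 1, by omega⟩
  have hsplit : ∫ x in (1 : ℝ)..((N + 1 : ℕ) : ℝ), ψ (x / S) / x =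
      ∑ i ∈ Finset.range N, ∫ x in ((i : ℝ) + 1)..((i : ℝ) + 1 + 1), ψ (x / S) / x := by
    have := intervalIntegral.sum_integral_adjacent_intervals (n := N)
      (f := fun x => ψ (x / S) / x) (μ := volume) (a := fun i : ℕ => (i : ℝ) + 1)
      fun i _ => hint _ _ (by positivity) (by positivity)
    simp only [Nat.cast_zero, zero_add] at this
    push_cast at this ⊢
    exact this.symm
  have hlast : ψ (((N : ℝ) + 1) / S) = 0 := by simpa using hψN
  rw [hsub, hsplit, Finset.sum_range_succ, hlast, zero_div, add_zero, ← Finset.sum_sub_distrib]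
  refine (Finset.abs_sum_le_sum_abs _ _).trans ?_
  rw [harmonicSum, Finset.mul_sum, Finset.sum_range_succ]
  refine le_add_of_le_of_nonneg (Finset.sum_le_sum fun i _ => ?_) (by positivity)
  have hi : (0 : ℝ) < (i : ℝ) + 1 := by positivity
  set n : ℝ := (i : ℝ) + 1 with hn
  have h2 : ψ (n / S) / n = ∫ _x in n..(n + 1), ψ (n / S) / n := by
    rw [intervalIntegral.integral_const]
    simp
  rw [h2, ← intervalIntegral.integral_sub (by simp) (hint _ _ hi (by linarith))]
  have h3 := intervalIntegral.norm_integral_le_of_norm_le_const (a := n) (b := n + 1)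
    (f := fun x => ψ (n / S) / n - ψ (x / S) / x) (C := 2 * (c / S) * (1 / n)) fun x hx => by
      rw [Set.uIoc_of_le (by linarith)] at hx
      have hx0 : 0 < x := hi.trans hx.1
      have e1 : ψ (n / S) / n - ψ (x / S) / x =
          (ψ (n / S) - ψ (x / S)) / x + ψ (n / S) * ((x - n) / (n * x)) := by
        field_simp
        ring
      have e2 : |ψ (n / S) - ψ (x / S)| ≤ c / S := by
        refine (hψ _ _).trans ?_
        rw [← sub_div, abs_div, abs_of_pos hS, abs_sub_comm, abs_of_pos (by linarith [hx.1]),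
          mul_div_assoc', div_le_div_iff_of_pos_right hS]
        exact mul_le_of_le_one_right hc (by linarith [hx.2])
      have e3 : |ψ (n / S)| ≤ c / S * n := by
        have := hψ (n / S) 0
        rw [hψ0, sub_zero, sub_zero, abs_of_pos (by positivity : 0 < n / S)] at this
        rwa [div_mul_eq_mul_div, ← mul_div_assoc']
      have hcS : 0 ≤ c / S := by positivity
      rw [Real.norm_eq_abs, e1]
      refine (abs_add_le _ _).trans ?_
      have e4 : |(ψ (n / S) - ψ (x / S)) / x| ≤ c / S * (1 / n) := by
        rw [abs_div, abs_of_pos hx0, mul_one_div]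
        exact div_le_div₀ hcS e2 hi hx.1.le
      have e5 : |ψ (n / S) * ((x - n) / (n * x))| ≤ c / S * (1 / n) := by
        have : 0 ≤ (x - n) / (n * x) := div_nonneg (by linarith [hx.1]) (by positivity)
        rw [abs_mul, abs_of_nonneg this]
        calc |ψ (n / S)| * ((x - n) / (n * x)) ≤ (c / S * n) * (1 / (n * n)) := by
              refine mul_le_mul e3 ?_ this (by positivity)
              refine div_le_div₀ zero_le_one (by linarith [hx.2]) (by positivity) ?_
              exact mul_le_mul_of_nonneg_left hx.1.le hi.le
          _ = _ := by field_simp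
      linarith
  rw [add_sub_cancel_left, abs_one, mul_one] at h3
  exact h3

/-- The sum of a one-dimensional Fourier series against `φ(n / T)` hardly depends on the scale `T`
if `φ` is Lipschitz and compactly supported. -/
theorem exists_norm_sum_scale_le {p : ℕ} (hp : 1 ≤ p) (u : ℝ) :
    ∃ C : ℝ, 0 ≤ C ∧ ∀ (N : ℕ) (T T' L : ℝ) (φ : ℝ → ℝ), 1 ≤ N → 0 < T → T ≤ T' →
      (∀ x y, |φ x - φ y| ≤ L * |x - y|) → (∀ x, (N : ℝ) ≤ T' * |x| → φ x = 0) →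
      ‖∑ n ∈ Finset.Icc (-(N : ℤ)) N, fourierTerm p u n * ((φ (n / T') - φ (n / T) : ℝ) : ℂ)‖ ≤
        C * (L / T) * harmonicSum N := by
  have hmain : ∃ C : ℝ, 0 ≤ C ∧ ∀ (N : ℕ) (T T' L : ℝ) (φ : ℝ → ℝ), 1 ≤ N → 0 < T → T ≤ T' →
      0 ≤ L → (∀ x y, |φ x - φ y| ≤ L * |x - y|) → (∀ x, (N : ℝ) ≤ T' * |x| → φ x = 0) →
      (∀ n : ℤ, |φ (n / T') - φ (n / T)| ≤ L / T * |(n : ℝ)|) →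
      ‖∑ n ∈ Finset.Icc (-(N : ℤ)) N, fourierTerm p u n * ((φ (n / T') - φ (n / T) : ℝ) : ℂ)‖ ≤
        C * (L / T) * harmonicSum N := by
    rcases hp.eq_or_lt with rfl | hp
    · by_cases hu : ∃ k : ℤ, u = k
      · -- the exceptional case: an odd sum, compared with an integral
        obtain ⟨k, rfl⟩ := hu
        refine ⟨10, by norm_num, fun N T T' L φ hN hT hTT' hL hφ hφN _ => ?_⟩
        have hT' : 0 < T' := hT.trans_le hTT'
        let ψ : ℝ → ℝ := fun x => φ x - φ (-x)
        have hψ : ∀ x y, |ψ x - ψ y| ≤ 2 * L * |x - y| := by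
          intro x y
          have h1 := hφ x y
          have h2 := hφ (-y) (-x)
          have h3 : -y - -x = x - y := by ring
          rw [h3] at h2
          have h4 : ψ x - ψ y = (φ x - φ y) + (φ (-y) - φ (-x)) := by simp only [ψ]; ring
          rw [h4]
          exact (abs_add_le _ _).trans (by linarith)
        have hψ0 : ψ 0 = 0 := by simp [ψ]
        have hψN : ∀ x, (N : ℝ) ≤ T' * |x| → ψ x = 0 := fun x hx => by
          simp only [ψ]
          rw [hφN x hx, hφN (-x) (by rwa [abs_neg]), sub_zero]
        have hN0 : (0 : ℝ) < N := by exact_mod_cast hN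
        have hN1 : (1 : ℝ) ≤ N := by exact_mod_cast hN
        have hreal : ∑ n ∈ Finset.Icc (-(N : ℤ)) N,
            fourierTerm 1 k n * ((φ (n / T') - φ (n / T) : ℝ) : ℂ) =
            ((∑ i ∈ Finset.range N, ψ (((i : ℝ) + 1) / T') / ((i : ℝ) + 1) -
              ∑ i ∈ Finset.range N, ψ (((i : ℝ) + 1) / T) / ((i : ℝ) + 1) : ℝ) : ℂ) := by
          have hterm : ∀ n : ℤ, fourierTerm 1 (k : ℝ) n = 1 / (n : ℂ) := fun n => by
            rw [fourierTerm, show (n : ℝ) * (k : ℝ) = ((n * k : ℤ) : ℝ) by push_cast; ring,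
              character_intCast, pow_one]
          rw [sum_Icc_neg, fourierTerm_zero le_rfl, zero_mul, zero_add,
            ← Finset.sum_sub_distrib, Complex.ofReal_sum]
          refine Finset.sum_congr rfl fun i _ => ?_
          rw [hterm, hterm]
          simp only [ψ]
          push_cast
          rw [neg_div, neg_div]
          have : (i : ℂ) + 1 ≠ 0 := by exact_mod_cast Nat.succ_ne_zero i
          have h' : -((i : ℂ) + 1) ≠ 0 := neg_ne_zero.2 this
          rw [div_neg]
          field_simp
          ring
        have hA := abs_sum_div_sub_integral_le hT hψ0 hψ hN (hψN _ (by
          rw [abs_of_pos (by positivity), mul_div_assoc', le_div_iff₀ hT, mul_comm]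
          exact mul_le_mul_of_nonneg_right hTT' hN0.le))
        have hA' := abs_sum_div_sub_integral_le hT' hψ0 hψ hN (hψN _ (by
          rw [abs_of_pos (by positivity), mul_div_cancel₀ _ hT'.ne']))
        have hcont : Continuous ψ :=
          (LipschitzWith.of_dist_le_mul (K := ⟨2 * L, by positivity⟩) fun x y => hψ x y).continuous
        have hint : ∀ a b : ℝ, 0 < a → 0 < b →
            IntervalIntegrable (fun x => ψ x / x) volume a b := by
          intro a b ha hb
          refine ContinuousOn.intervalIntegrable ?_
          refine ContinuousOn.div (by fun_prop) continuousOn_id fun x hx => ?_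
          exact (lt_of_lt_of_le (lt_min ha hb) hx.1).ne'
        -- the integrands vanish beyond `N / T'`, so only the lower end points differ
        have hends : (∫ x in (1 / T')..(N / T'), ψ x / x) - ∫ x in (1 / T)..(N / T), ψ x / x =
            ∫ x in (1 / T')..(1 / T), ψ x / x := by
          have hz : ∫ x in (N / T')..(N / T), ψ x / x = 0 := by
            rw [intervalIntegral.integral_congr (g := fun _ => (0 : ℝ)),
              intervalIntegral.integral_zero]
            intro x hx
            rw [Set.uIcc_of_le (div_le_div_of_nonneg_left hN0.le hT hTT')] at hx
            have hx0 : 0 < x := lt_of_lt_of_le (by positivity) hx.1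
            have : ψ x = 0 := hψN x (by
              rw [abs_of_pos hx0, mul_comm]
              exact (div_le_iff₀ hT').1 hx.1)
            simp [this]
          have e1 := intervalIntegral.integral_add_adjacent_intervals
            (hint (1 / T') (1 / T) (by positivity) (by positivity))
            (hint (1 / T) (N / T) (by positivity) (by positivity))
          have e2 := intervalIntegral.integral_add_adjacent_intervals
            (hint (1 / T') (N / T') (by positivity) (by positivity))
            (hint (N / T') (N / T) (by positivity) (by positivity))
          linarith
        have hsmall : |∫ x in (1 / T')..(1 / T), ψ x / x| ≤ 2 * (L / T) := by
          have := intervalIntegral.norm_integral_le_of_norm_le_const (a := 1 / T') (b := 1 / T)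
            (f := fun x => ψ x / x) (C := 2 * L) fun x hx => by
              rw [Set.uIoc_of_le (div_le_div_of_nonneg_left zero_le_one hT hTT')] at hx
              have hx0 : 0 < x := lt_trans (by positivity) hx.1
              rw [Real.norm_eq_abs, abs_div, abs_of_pos hx0, div_le_iff₀ hx0]
              have := hψ x 0
              rwa [hψ0, sub_zero, sub_zero, abs_of_pos hx0] at this
          refine this.trans ?_
          have h1 : 0 ≤ 1 / T - 1 / T' :=
            sub_nonneg.2 (div_le_div_of_nonneg_left zero_le_one hT hTT')
          have h2 : 0 ≤ 1 / T' := by positivity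
          rw [abs_of_nonneg h1, mul_assoc]
          refine mul_le_mul_of_nonneg_left ?_ two_pos.le
          calc L * (1 / T - 1 / T') ≤ L * (1 / T) :=
                mul_le_mul_of_nonneg_left (by linarith) hL
            _ = _ := mul_one_div _ _
        rw [hreal, Complex.norm_real, Real.norm_eq_abs]
        have hh := one_le_harmonicSum hN
        have hLT : 0 ≤ L / T := by positivity
        have hLT' : 2 * L / T' ≤ 2 * (L / T) := by
          rw [mul_div_assoc]
          exact mul_le_mul_of_nonneg_left (div_le_div_of_nonneg_left hL hT hTT') two_pos.le
        have hA'' : 2 * (2 * L / T') * harmonicSum N ≤ 4 * (L / T) * harmonicSum N :=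
          mul_le_mul_of_nonneg_right (by linarith) (by linarith)
        have hA2 : 2 * (2 * L / T) * harmonicSum N = 4 * (L / T) * harmonicSum N := by ring
        have hLh : L / T ≤ L / T * harmonicSum N := le_mul_of_one_le_right hLT hh
        rw [abs_le] at hA hA' hsmall ⊢
        constructor <;> linarith [hA.1, hA.2, hA'.1, hA'.2, hsmall.1, hsmall.2]
      · -- a nontrivial character, for which summation by parts applies
        push Not at hu
        have hz1 : character u ≠ 1 := character_ne_one hu
        have hz2 : character (-u) ≠ 1 := character_ne_one fun k hk =>
          hu (-k) (by push_cast; linarith)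
        refine ⟨3 * (2 / ‖character u - 1‖) + 3 * (2 / ‖character (-u) - 1‖), by positivity,
          fun N T T' L φ hN hT hTT' hL hφ hφN hsize => ?_⟩
        have hT' : 0 < T' := hT.trans_le hTT'
        have hN0 : (0 : ℝ) ≤ N := by positivity
        let f : ℝ → ℝ := fun x => φ (x / T') - φ (x / T)
        have hfN : ∀ x : ℝ, |x| = N → f x = 0 := fun x hx => by
          simp only [f]
          rw [hφN (x / T'), hφN (x / T), sub_zero]
          · rw [abs_div, abs_of_pos hT, hx, mul_div_assoc', le_div_iff₀ hT, mul_comm]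
            exact mul_le_mul_of_nonneg_right hTT' hN0
          · rw [abs_div, abs_of_pos hT', hx, mul_div_cancel₀ _ hT'.ne']
        have hfstep : ∀ x y : ℝ, |x - y| = 1 → |f x - f y| ≤ 2 * (L / T) := fun x y hxy => by
          have h1 := hφ (x / T') (y / T')
          have h2 := hφ (y / T) (x / T)
          rw [← sub_div, abs_div, hxy, abs_of_pos hT'] at h1
          rw [← sub_div, abs_div, abs_sub_comm y x, hxy, abs_of_pos hT] at h2
          have h3 : L * (1 / T') ≤ L * (1 / T) :=
            mul_le_mul_of_nonneg_left (div_le_div_of_nonneg_left zero_le_one hT hTT') hL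
          have h4 : f x - f y = (φ (x / T') - φ (y / T')) + (φ (y / T) - φ (x / T)) := by
            simp only [f]; ring
          rw [h4]
          refine (abs_add_le _ _).trans ?_
          rw [mul_one_div] at h2 h3 h1
          rw [mul_one_div] at h3
          linarith
        have hhalf : ∀ (s : ℝ) (σ : ℝ), |σ| = 1 → character s ≠ 1 →
            ‖∑ i ∈ Finset.range N, (f (σ * ((i : ℝ) + 1)) / ((i : ℝ) + 1)) •
              character s ^ (i + 1)‖ ≤
            3 * (L / T) * (2 / ‖character s - 1‖) * harmonicSum N := by
          intro s σ hσ hs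
          have hσ' : σ = 1 ∨ σ = -1 := by
            rcases abs_choice σ with h | h <;> rw [h] at hσ
            · exact Or.inl hσ
            · exact Or.inr (by linarith)
          have := norm_sum_div_smul_pow_le (norm_character s) hs hN
            (f := fun n : ℕ => f (σ * n)) (c := L / T) ?_ ?_ ?_
          · simpa using this
          · intro n
            rcases hσ' with rfl | rfl
            · have := hsize n
              simpa [f] using this
            · have := hsize (-n)
              simpa [f] using this
          · intro n
            refine hfstep _ _ ?_
            push_cast
            rw [← mul_sub, abs_mul, hσ]
            simp
          · refine hfN _ ?_
            rw [abs_mul, hσ, one_mul, Nat.abs_cast]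
        have hsplit : ∑ n ∈ Finset.Icc (-(N : ℤ)) N,
            fourierTerm 1 u n * ((φ (n / T') - φ (n / T) : ℝ) : ℂ) =
            ∑ i ∈ Finset.range N, (f (1 * ((i : ℝ) + 1)) / ((i : ℝ) + 1)) •
              character u ^ (i + 1) -
            ∑ i ∈ Finset.range N, (f (-1 * ((i : ℝ) + 1)) / ((i : ℝ) + 1)) •
              character (-u) ^ (i + 1) := by
          rw [sum_Icc_neg, fourierTerm_zero le_rfl, zero_mul, zero_add, ← Finset.sum_sub_distrib]
          refine Finset.sum_congr rfl fun i _ => ?_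
          rw [fourierTerm, fourierTerm, ← character_natCast_mul, ← character_natCast_mul, pow_one,
            pow_one, Complex.real_smul, Complex.real_smul]
          simp only [f]
          push_cast
          rw [show -((i : ℝ) + 1) * u = ((i : ℝ) + 1) * -u by ring, div_neg, one_mul, neg_one_mul]
          ring
        rw [hsplit]
        refine (norm_sub_le _ _).trans
          ((add_le_add (hhalf u 1 (by simp) hz1) (hhalf (-u) (-1) (by simp) hz2)).trans
            (le_of_eq (by ring)))
    · refine ⟨2, by norm_num, fun N T T' L φ _ hT _ hL _ _ hsize => ?_⟩
      have hLT : 0 ≤ L / T := by positivity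
      have hterm : ∀ n : ℤ, n ≠ 0 → ‖fourierTerm p u n * ((φ (n / T') - φ (n / T) : ℝ) : ℂ)‖ ≤
          L / T * (1 / |(n : ℝ)|) := by
        intro n hn
        have hn0 : 0 < |(n : ℝ)| := lt_of_lt_of_le one_pos (one_le_abs_cast hn)
        rw [norm_mul, norm_fourierTerm, Complex.norm_real]
        calc _ ≤ (|(n : ℝ)| ^ 2)⁻¹ * (L / T * |(n : ℝ)|) :=
              mul_le_mul (inv_abs_pow_le one_le_two hp n) (hsize n) (abs_nonneg _)
                (by positivity)
          _ = _ := by field_simp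
      rw [sum_Icc_neg, fourierTerm_zero (by omega), zero_mul, zero_add, harmonicSum,
        Finset.mul_sum]
      refine norm_sum_le_of_le _ fun i _ => ?_
      refine (norm_add_le _ _).trans ((add_le_add (hterm _ (by omega)) (hterm _ (by omega))).trans
        (le_of_eq ?_))
      have hi : (0 : ℝ) < (i : ℝ) + 1 := by positivity
      push_cast
      rw [abs_neg, abs_of_pos hi]
      ring
  obtain ⟨C, hC0, hC⟩ := hmain
  refine ⟨C, hC0, fun N T T' L φ hN hT hTT' hφ hφN => ?_⟩
  have hL : 0 ≤ L := by simpa using (abs_nonneg _).trans (hφ 1 0)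
  refine hC N T T' L φ hN hT hTT' hL hφ hφN fun n => (hφ _ _).trans ?_
  have hT' : 0 < T' := hT.trans_le hTT'
  rw [div_mul_eq_mul_div, ← mul_div_assoc']
  refine mul_le_mul_of_nonneg_left ?_ hL
  have e1 : (n : ℝ) / T' - n / T = n * -(1 / T - 1 / T') := by ring
  have h1 : 0 ≤ 1 / T - 1 / T' := sub_nonneg.2 (div_le_div_of_nonneg_left zero_le_one hT hTT')
  have h2 : 0 ≤ 1 / T' := by positivity
  rw [e1, abs_mul, abs_neg, abs_of_nonneg h1, div_eq_mul_one_div |(n : ℝ)|]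
  exact mul_le_mul_of_nonneg_left (by linarith) (abs_nonneg _)

section Multi

variable {ι : Type*} [Fintype ι] [DecidableEq ι]

theorem sum_piFinset_update {M : Type*} [AddCommMonoid M] (s : Finset ℤ) (a : ι)
    (g : (ι → ℤ) → M) :
    ∑ y ∈ Fintype.piFinset (fun _ : ι => s), g y =
      ∑ z ∈ Fintype.piFinset (Function.update (fun _ : ι => s) a {0}),
        ∑ n ∈ s, g (Function.update z a n) := by
  rw [← Finset.sum_product']
  refine Finset.sum_nbij' (fun y => (Function.update y a 0, y a))
    (fun x => Function.update x.1 a x.2) ?_ ?_ ?_ ?_ ?_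
  · intro y hy
    rw [Fintype.mem_piFinset] at hy
    refine Finset.mem_product.2 ⟨Fintype.mem_piFinset.2 fun k => ?_, hy a⟩
    by_cases hk : k = a
    · subst hk; simp
    · simp [hk, hy k]
  · intro x hx
    obtain ⟨h1, h2⟩ := Finset.mem_product.1 hx
    rw [Fintype.mem_piFinset] at h1 ⊢
    intro k
    by_cases hk : k = a
    · subst hk; simpa using h2
    · simpa [hk] using h1 k
  · intro y _
    simp
  · intro x hx
    have h1 := Fintype.mem_piFinset.1 (Finset.mem_product.1 hx).1 a
    simp only [Function.update_self, Finset.mem_singleton] at h1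
    ext1
    · simp [← h1]
    · simp
  · intro y _
    simp

theorem diagTerm_update (p : ι → ℕ) (u : ι → ℝ) (z : ι → ℤ) (a : ι) (n : ℤ) :
    diagTerm p u (Function.update z a n) =
      fourierTerm (p a) (u a) n * ∏ k ∈ Finset.univ.erase a, fourierTerm (p k) (u k) (z k) := by
  rw [diagTerm, ← Finset.mul_prod_erase _ _ (Finset.mem_univ a), Function.update_self]
  congr 1
  refine Finset.prod_congr rfl fun k hk => ?_
  rw [Function.update_of_ne (Finset.ne_of_mem_erase hk)]

theorem sum_inv_abs_Icc (N : ℕ) :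
    ∑ n ∈ Finset.Icc (-(N : ℤ)) N, |(n : ℝ)|⁻¹ = 2 * harmonicSum N := by
  rw [sum_Icc_neg, harmonicSum, Finset.mul_sum]
  simp only [Int.cast_zero, abs_zero, inv_zero, zero_add]
  refine Finset.sum_congr rfl fun i _ => ?_
  have hi : (0 : ℝ) < (i : ℝ) + 1 := by positivity
  push_cast
  rw [abs_neg, abs_of_pos hi]
  ring

/-- The sum against `Φ(y / T)` of a Lipschitz function `Φ` of compact support hardly depends on the
scale `T`; the scale is changed in one coordinate at a time. -/
theorem exists_norm_sum_cube_scale_le {p : ι → ℕ} (hp : ∀ k, 1 ≤ p k) (u : ι → ℝ) :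
    ∃ C : ℝ, 0 ≤ C ∧ ∀ (N : ℕ) (T T' L : ℝ) (Φ : (ι → ℝ) → ℝ), 1 ≤ N → 0 < T → T ≤ T' → 0 ≤ L →
      (∀ s t, |Φ s - Φ t| ≤ L * ‖s - t‖) → (∀ s, (∃ k, (N : ℝ) ≤ T' * |s k|) → Φ s = 0) →
      ‖∑ y ∈ cube ι N, diagTerm p u y *
        ((Φ (fun k => y k / T') - Φ (fun k => y k / T) : ℝ) : ℂ)‖ ≤
        C * (L / T) * (2 * harmonicSum N) ^ Fintype.card ι := by
  choose C hC0 hC using fun k => exists_norm_sum_scale_le (hp k) (u k)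
  refine ⟨∑ k, C k, Finset.sum_nonneg fun k _ => hC0 k, ?_⟩
  intro N T T' L Φ hN hT hTT' hL hΦ hsupp
  have hh1 := one_le_harmonicSum hN
  have hLT : 0 ≤ L / T := by positivity
  -- the coordinates in `K` are divided by `T'`, the others by `T`
  let sc : Finset ι → (ι → ℤ) → (ι → ℝ) := fun K y k => y k / (if k ∈ K then T' else T)
  have hstep : ∀ (K : Finset ι) (a : ι), a ∉ K →
      ‖∑ y ∈ cube ι N, diagTerm p u y *
        ((Φ (sc (insert a K) y) - Φ (sc K y) : ℝ) : ℂ)‖ ≤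
        C a * (L / T) * (2 * harmonicSum N) ^ Fintype.card ι := by
    intro K a haK
    rw [cube, sum_piFinset_update _ a]
    have hinner : ∀ z : ι → ℤ, ‖∑ n ∈ Finset.Icc (-(N : ℤ)) N,
        diagTerm p u (Function.update z a n) *
          ((Φ (sc (insert a K) (Function.update z a n)) -
            Φ (sc K (Function.update z a n)) : ℝ) : ℂ)‖ ≤
        (C a * (L / T) * harmonicSum N) *
          ∏ k, if k = a then 1 else |(z k : ℝ)|⁻¹ := by
      intro z
      have e1 : ∀ n : ℤ, sc (insert a K) (Function.update z a n) =
          Function.update (sc K z) a (n / T') := fun n => by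
        funext k
        by_cases hk : k = a
        · subst hk; simp [sc]
        · simp [sc, hk]
      have e2 : ∀ n : ℤ, sc K (Function.update z a n) =
          Function.update (sc K z) a (n / T) := fun n => by
        funext k
        by_cases hk : k = a
        · subst hk; simp [sc, haK]
        · simp [sc, hk]
      simp_rw [e1, e2, diagTerm_update]
      have e3 := hC a N T T' L (fun x => Φ (Function.update (sc K z) a x)) hN hT hTT'
        (fun x y => by
          refine (hΦ _ _).trans (mul_le_mul_of_nonneg_left ?_ hL)
          rw [pi_norm_le_iff_of_nonneg (abs_nonneg _)]
          intro k
          by_cases hk : k = a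
          · subst hk; simp
          · simp [hk])
        (fun x hx => hsupp _ ⟨a, by simpa using hx⟩)
      have e4 : ‖∏ k ∈ Finset.univ.erase a, fourierTerm (p k) (u k) (z k)‖ ≤
          ∏ k, if k = a then 1 else |(z k : ℝ)|⁻¹ := by
        rw [norm_prod, ← Finset.mul_prod_erase Finset.univ
          (fun k => if k = a then (1 : ℝ) else |(z k : ℝ)|⁻¹) (Finset.mem_univ a), if_pos rfl,
          one_mul]
        refine Finset.prod_le_prod (fun _ _ => norm_nonneg _) fun k hk => ?_
        rw [if_neg (Finset.ne_of_mem_erase hk)]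
        exact norm_fourierTerm_le (hp k) _ _
      calc _ = ‖(∑ n ∈ Finset.Icc (-(N : ℤ)) N, fourierTerm (p a) (u a) n *
            ((Φ (Function.update (sc K z) a (n / T')) -
              Φ (Function.update (sc K z) a (n / T)) : ℝ) : ℂ)) *
            ∏ k ∈ Finset.univ.erase a, fourierTerm (p k) (u k) (z k)‖ := by
            rw [Finset.sum_mul]
            congr 1
            exact Finset.sum_congr rfl fun n _ => by ring
        _ ≤ _ := by
            rw [norm_mul]
            exact mul_le_mul e3 e4 (norm_nonneg _)
              (mul_nonneg (mul_nonneg (hC0 a) hLT) (by linarith))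
    refine (norm_sum_le_of_le _ fun z _ => hinner z).trans ?_
    rw [← Finset.mul_sum]
    have hprod : ∑ z ∈ Fintype.piFinset
        (Function.update (fun _ : ι => Finset.Icc (-(N : ℤ)) N) a {0}),
        ∏ k, (if k = a then (1 : ℝ) else |(z k : ℝ)|⁻¹) =
        ∏ k, if k = a then 1 else 2 * harmonicSum N := by
      rw [← Finset.prod_univ_sum (Function.update (fun _ : ι => Finset.Icc (-(N : ℤ)) N) a {0})
        (fun k (n : ℤ) => if k = a then (1 : ℝ) else |(n : ℝ)|⁻¹)]
      refine Finset.prod_congr rfl fun k _ => ?_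
      by_cases hk : k = a
      · subst hk; simp
      · simp [hk, sum_inv_abs_Icc]
    rw [hprod, mul_assoc]
    refine mul_le_mul_of_nonneg_left ?_ (mul_nonneg (hC0 a) hLT)
    calc harmonicSum N * ∏ k, (if k = a then 1 else 2 * harmonicSum N)
        ≤ (2 * harmonicSum N) * ∏ k, (if k = a then 1 else 2 * harmonicSum N) := by
          refine mul_le_mul_of_nonneg_right (by linarith) (Finset.prod_nonneg fun k _ => ?_)
          split_ifs <;> linarith
      _ = ∏ _k : ι, 2 * harmonicSum N := by
          rw [← Finset.mul_prod_erase Finset.univ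
            (fun k => if k = a then (1 : ℝ) else 2 * harmonicSum N) (Finset.mem_univ a),
            ← Finset.mul_prod_erase Finset.univ
              (fun _ => 2 * harmonicSum N) (Finset.mem_univ a), if_pos rfl, one_mul]
          congr 1
          exact Finset.prod_congr rfl fun k hk => if_neg (Finset.ne_of_mem_erase hk)
      _ = _ := by rw [Finset.prod_const, Finset.card_univ]
  have hK : ∀ K : Finset ι, ‖∑ y ∈ cube ι N, diagTerm p u y *
        ((Φ (sc K y) - Φ (sc ∅ y) : ℝ) : ℂ)‖ ≤
        (∑ k ∈ K, C k) * (L / T) * (2 * harmonicSum N) ^ Fintype.card ι := by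
    intro K
    induction K using Finset.induction_on with
    | empty => simp
    | insert a K haK ih =>
      rw [Finset.sum_insert haK, add_mul, add_mul]
      refine le_trans ?_ (add_le_add (hstep K a haK) ih)
      refine le_trans (le_of_eq ?_) (norm_add_le _ _)
      rw [← Finset.sum_add_distrib]
      congr 1
      refine Finset.sum_congr rfl fun y _ => ?_
      push_cast
      ring
  have := hK Finset.univ
  simpa [sc] using this

end Multi

/-! ### The excess function -/

section Excess

variable {m : ℕ}

/-- The excess `(mean w)⁺ - mean (w⁺)`. Under a common shift of all `wᵢ` its derivative is the
difference of the indicator of `mean w < 0` and the mean of the indicators of `wᵢ < 0`. -/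
noncomputable def excess (w : Fin m → ℝ) : ℝ :=
  max 0 ((∑ i, w i) / m) - (∑ i, max 0 (w i)) / m

theorem mean_le_of_le (hm : 1 ≤ m) {a : Fin m → ℝ} {M : ℝ} (h : ∀ i, a i ≤ M) :
    (∑ i, a i) / m ≤ M := by
  have hm' : (0 : ℝ) < m := by exact_mod_cast hm
  rw [div_le_iff₀ hm']
  calc ∑ i, a i ≤ ∑ _i : Fin m, M := Finset.sum_le_sum fun i _ => h i
    _ = M * m := by simp [mul_comm]

theorem excess_of_nonneg {w : Fin m → ℝ} (h : ∀ i, 0 ≤ w i) : excess w = 0 := by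
  rw [excess, max_eq_right (div_nonneg (Finset.sum_nonneg fun i _ => h i) (by positivity)),
    Finset.sum_congr rfl fun i _ => max_eq_right (h i), sub_self]

theorem abs_excess_le (hm : 1 ≤ m) {w : Fin m → ℝ} {M : ℝ} (hM : 0 ≤ M) (h : ∀ i, w i ≤ M) :
    |excess w| ≤ M := by
  have h1 : (∑ i, max 0 (w i)) / m ≤ M := mean_le_of_le hm fun i => max_le hM (h i)
  have h2 : (∑ i, w i) / m ≤ (∑ i, max 0 (w i)) / m :=
    div_le_div_of_nonneg_right (Finset.sum_le_sum fun i _ => le_max_right _ _) (by positivity)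
  have h3 : 0 ≤ (∑ i, max 0 (w i)) / m :=
    div_nonneg (Finset.sum_nonneg fun i _ => le_max_left _ _) (by positivity)
  have h4 : 0 ≤ max 0 ((∑ i, w i) / m) := le_max_left _ _
  have h5 : max 0 ((∑ i, w i) / m) ≤ (∑ i, max 0 (w i)) / m := max_le h3 h2
  rw [excess, abs_le]
  constructor <;> linarith

theorem abs_excess_sub_le (hm : 1 ≤ m) {w w' : Fin m → ℝ} {d : ℝ} (h : ∀ i, |w' i - w i| ≤ d) :
    |excess w' - excess w| ≤ 2 * d := by
  have h1 : |(∑ i, w' i) / m - (∑ i, w i) / m| ≤ d := by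
    rw [← sub_div, ← Finset.sum_sub_distrib, abs_div, Nat.abs_cast]
    refine (div_le_div_of_nonneg_right (Finset.abs_sum_le_sum_abs _ _) (by positivity)).trans
      (mean_le_of_le hm h)
  have h2 : |(∑ i, max 0 (w' i)) / m - (∑ i, max 0 (w i)) / m| ≤ d := by
    rw [← sub_div, ← Finset.sum_sub_distrib, abs_div, Nat.abs_cast]
    refine (div_le_div_of_nonneg_right (Finset.abs_sum_le_sum_abs _ _) (by positivity)).trans
      (mean_le_of_le hm fun i => ?_)
    rw [max_comm 0, max_comm 0]
    exact (abs_max_sub_max_le_abs _ _ _).trans (h i)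
  have h3 : |max 0 ((∑ i, w' i) / m) - max 0 ((∑ i, w i) / m)| ≤ d := by
    rw [max_comm 0, max_comm 0]
    exact (abs_max_sub_max_le_abs _ _ _).trans h1
  have h4 : excess w' - excess w = (max 0 ((∑ i, w' i) / m) - max 0 ((∑ i, w i) / m)) -
      ((∑ i, max 0 (w' i)) / m - (∑ i, max 0 (w i)) / m) := by
    simp only [excess]
    ring
  rw [h4]
  exact (abs_sub _ _).trans (by linarith)

theorem sum_nonpos_of_le {w : Fin m → ℝ} {M : ℝ} (hM : 0 ≤ M) (h : ∀ i, w i ≤ M) {i₀ : Fin m}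
    (hi₀ : w i₀ ≤ -(m * M)) : ∑ i, w i ≤ 0 := by
  rw [← Finset.add_sum_erase _ _ (Finset.mem_univ i₀)]
  have h1 : ∑ i ∈ Finset.univ.erase i₀, w i ≤ ∑ _i : Fin m, M :=
    (Finset.sum_le_sum fun i _ => h i).trans
      (Finset.sum_le_sum_of_subset_of_nonneg (Finset.erase_subset _ _) fun _ _ _ => hM)
  simp only [Finset.sum_const, Finset.card_univ, Fintype.card_fin, nsmul_eq_mul] at h1
  linarith

/-- Very negative entries may be replaced by moderately negative ones. -/
theorem excess_max {w : Fin m → ℝ} {M : ℝ} (hM : 0 ≤ M) (h : ∀ i, w i ≤ M) :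
    excess (fun i => max (w i) (-(m * M))) = excess w := by
  have hmM : -(m * M) ≤ 0 := by
    have : 0 ≤ (m : ℝ) * M := by positivity
    linarith
  have h1 : ∀ i, max 0 (max (w i) (-(m * M))) = max 0 (w i) := fun i => by
    rw [← max_assoc, max_eq_left (hmM.trans (le_max_left _ _))]
  by_cases hex : ∃ i, w i < -(m * M)
  · obtain ⟨i₀, hi₀⟩ := hex
    have h2 : ∑ i, w i ≤ 0 := sum_nonpos_of_le hM h hi₀.le
    have h3 : ∑ i, max (w i) (-(m * M)) ≤ 0 :=
      sum_nonpos_of_le hM (fun i => max_le (h i) (hmM.trans hM)) (i₀ := i₀)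
        (max_le hi₀.le le_rfl)
    rw [excess, excess, max_eq_left (div_nonpos_of_nonpos_of_nonneg h2 (by positivity)),
      max_eq_left (div_nonpos_of_nonpos_of_nonneg h3 (by positivity))]
    simp only [h1]
  · push Not at hex
    congr 1
    funext i
    exact max_eq_left (hex i)

open Classical in
theorem abs_max_shift_le {w ε : ℝ} (hε : 0 ≤ ε) :
    |max 0 (w - ε) - max 0 w + ε - ε * (if w < 0 then 1 else 0)| ≤
      ε * (if 0 ≤ w ∧ w ≤ ε then 1 else 0) := by
  rcases lt_or_ge w 0 with h | h
  · rw [if_pos h, if_neg (fun h' => absurd h'.1 (not_le.2 h)), max_eq_left (by linarith),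
      max_eq_left h.le]
    simp
  · rw [if_neg (not_lt.2 h), max_eq_right h]
    rcases le_or_gt w ε with h' | h'
    · rw [if_pos ⟨h, h'⟩, max_eq_left (by linarith), abs_le]
      constructor <;> linarith
    · rw [if_neg (fun h'' => absurd h''.2 (not_le.2 h')), max_eq_right (by linarith)]
      rw [show w - ε - w + ε - ε * 0 = 0 by ring]
      simp

open Classical in
/-- Under a small shift, the excess changes by the difference of the indicators of `mean w < 0` and
of the `wᵢ < 0`, up to contributions from transition regions. -/
theorem abs_excess_shift_le (hm : 1 ≤ m) (w : Fin m → ℝ) {ε : ℝ} (hε : 0 ≤ ε) :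
    |excess (fun i => w i - ε) - excess w -
      ε * ((if (∑ i, w i) / m < 0 then 1 else 0) - (∑ i, if w i < 0 then 1 else 0) / m)| ≤
      ε * ((if 0 ≤ (∑ i, w i) / m ∧ (∑ i, w i) / m ≤ ε then 1 else 0) +
        ∑ i, if 0 ≤ w i ∧ w i ≤ ε then 1 else 0) := by
  have hm' : (0 : ℝ) < m := by exact_mod_cast hm
  have hm1 : (1 : ℝ) ≤ m := by exact_mod_cast hm
  have hmean : (∑ i, (w i - ε)) / m = (∑ i, w i) / m - ε := by
    rw [Finset.sum_sub_distrib]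
    simp only [Finset.sum_const, Finset.card_univ, Fintype.card_fin, nsmul_eq_mul]
    field_simp
  have h1 := abs_max_shift_le (w := (∑ i, w i) / m) hε
  have h2 : |∑ i, (max 0 (w i - ε) - max 0 (w i) + ε - ε * (if w i < 0 then 1 else 0))| ≤
      ε * ∑ i, if 0 ≤ w i ∧ w i ≤ ε then 1 else 0 := by
    rw [Finset.mul_sum]
    exact (Finset.abs_sum_le_sum_abs _ _).trans
      (Finset.sum_le_sum fun i _ => abs_max_shift_le hε)
  have h3 : |(∑ i, (max 0 (w i - ε) - max 0 (w i) + ε -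
      ε * (if w i < 0 then 1 else 0))) / m| ≤
      ε * ∑ i, if 0 ≤ w i ∧ w i ≤ ε then 1 else 0 := by
    rw [abs_div, Nat.abs_cast]
    exact (div_le_self (abs_nonneg _) hm1).trans h2
  have h4 : excess (fun i => w i - ε) - excess w -
      ε * ((if (∑ i, w i) / m < 0 then 1 else 0) - (∑ i, if w i < 0 then 1 else 0) / m) =
      (max 0 ((∑ i, w i) / m - ε) - max 0 ((∑ i, w i) / m) + ε -
        ε * (if (∑ i, w i) / m < 0 then 1 else 0)) -
      (∑ i, (max 0 (w i - ε) - max 0 (w i) + ε - ε * (if w i < 0 then 1 else 0))) / m := by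
    simp only [excess, hmean]
    rw [Finset.sum_sub_distrib, Finset.sum_add_distrib, Finset.sum_sub_distrib, ← Finset.mul_sum]
    simp only [Finset.sum_const, Finset.card_univ, Fintype.card_fin, nsmul_eq_mul]
    field_simp
    ring
  rw [h4, mul_add]
  exact (abs_sub _ _).trans (add_le_add h1 h3)

end Excess

/-! ### A Lipschitz function of compact support -/

/-- The piecewise linear cutoff which is `1` on `(-∞, 1]` and `0` on `[2, ∞)`. -/
noncomputable def cutoff (x : ℝ) : ℝ := max 0 (min 1 (2 - x))

theorem cutoff_nonneg (x : ℝ) : 0 ≤ cutoff x := le_max_left _ _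

theorem cutoff_le_one (x : ℝ) : cutoff x ≤ 1 := max_le zero_le_one (min_le_left _ _)

theorem cutoff_of_le {x : ℝ} (h : x ≤ 1) : cutoff x = 1 := by
  rw [cutoff, min_eq_left (by linarith), max_eq_right zero_le_one]

theorem cutoff_of_ge {x : ℝ} (h : 2 ≤ x) : cutoff x = 0 := by
  rw [cutoff, max_eq_left ((min_le_right _ _).trans (by linarith))]

theorem abs_cutoff_sub_le (x y : ℝ) : |cutoff x - cutoff y| ≤ |x - y| := by
  rw [cutoff, cutoff, max_comm 0, max_comm 0, min_comm 1, min_comm 1]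
  refine (abs_max_sub_max_le_abs _ _ _).trans ((abs_inf_sub_inf_le_abs _ _ _).trans ?_)
  rw [abs_sub_comm x y]
  refine le_of_eq (congrArg _ ?_)
  ring

theorem abs_log_max_sub_le {a b δ : ℝ} (hδ : 0 < δ) :
    |Real.log (max a δ) - Real.log (max b δ)| ≤ |a - b| / δ := by
  have key : ∀ x y : ℝ, δ ≤ x → δ ≤ y → Real.log x - Real.log y ≤ |x - y| / δ := by
    intro x y hx hy
    have hx0 : 0 < x := hδ.trans_le hx
    have hy0 : 0 < y := hδ.trans_le hy
    rw [← Real.log_div hx0.ne' hy0.ne']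
    refine (Real.log_le_sub_one_of_pos (div_pos hx0 hy0)).trans ?_
    have : x / y - 1 = (x - y) / y := by field_simp
    rw [this]
    exact (div_le_div_of_nonneg_right (le_abs_self _) hy0.le).trans
      (div_le_div_of_nonneg_left (abs_nonneg _) hδ hy)
  have h1 := key (max a δ) (max b δ) (le_max_right _ _) (le_max_right _ _)
  have h2 := key (max b δ) (max a δ) (le_max_right _ _) (le_max_right _ _)
  rw [abs_sub_comm] at h2
  have h3 : |max a δ - max b δ| / δ ≤ |a - b| / δ :=
    div_le_div_of_nonneg_right (abs_max_sub_max_le_abs _ _ _) hδ.le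
  rw [abs_le]
  constructor <;> linarith

section Cut

variable {ι : Type*} [Fintype ι] {m : ℕ}

/-- The excess of the logarithms of the forms `Qᵢ`, made Lipschitz near the hyperplanes
`Qᵢ = 0` and cut off at distance `2 B` from the origin. With `R = 2 B K`, this agrees with the
unmodified excess on the ball of radius `B` if the coefficients of each form have
absolute sum at most `K`. -/
noncomputable def cutExcess (Q : Fin m → ι → ℝ) (R B : ℝ) (s : ι → ℝ) : ℝ :=
  excess (fun i => Real.log (max |∑ j, Q i j * s j| (R ^ m)⁻¹)) * cutoff (‖s‖ / B)

theorem abs_sum_mul_le {q s : ι → ℝ} {K : ℝ} (hK : ∑ j, |q j| ≤ K) :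
    |∑ j, q j * s j| ≤ K * ‖s‖ := by
  calc |∑ j, q j * s j| ≤ ∑ j, |q j| * ‖s‖ := by
        refine (Finset.abs_sum_le_sum_abs _ _).trans (Finset.sum_le_sum fun j _ => ?_)
        rw [abs_mul]
        exact mul_le_mul_of_nonneg_left (norm_le_pi_norm s j) (abs_nonneg _)
    _ ≤ K * ‖s‖ := by
        rw [← Finset.sum_mul]
        exact mul_le_mul_of_nonneg_right hK (norm_nonneg _)

theorem cutExcess_eq_zero {Q : Fin m → ι → ℝ} {R B : ℝ} (hB : 0 < B) {s : ι → ℝ}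
    (hs : 2 * B ≤ ‖s‖) : cutExcess Q R B s = 0 := by
  rw [cutExcess, cutoff_of_ge ((le_div_iff₀ hB).2 hs), mul_zero]

theorem abs_cutExcess_sub_le (hm : 1 ≤ m) {Q : Fin m → ι → ℝ} {K : ℝ} (hK1 : 1 ≤ K)
    (hK : ∀ i, ∑ j, |Q i j| ≤ K) {B : ℝ} (hB : 1 ≤ B) (s t : ι → ℝ) :
    |cutExcess Q (2 * B * K) B s - cutExcess Q (2 * B * K) B t| ≤
      3 * K * (2 * B * K) ^ m * ‖s - t‖ := by
  set R := 2 * B * K with hR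
  have hB0 : 0 < B := by linarith
  have hR1 : 1 ≤ R := by nlinarith
  have hR0 : 0 < R := by linarith
  have hRm : R ≤ R ^ m := le_self_pow₀ hR1 (by omega)
  have hRm1 : 1 ≤ R ^ m := one_le_pow₀ hR1
  have hδ : 0 < (R ^ m)⁻¹ := by positivity
  set g : (ι → ℝ) → ℝ := fun s =>
    excess (fun i => Real.log (max |∑ j, Q i j * s j| (R ^ m)⁻¹)) with hg
  have hglip : ∀ s t, |g s - g t| ≤ 2 * (K * R ^ m * ‖s - t‖) := by
    intro s t
    refine abs_excess_sub_le hm fun i => (abs_log_max_sub_le hδ).trans ?_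
    rw [div_inv_eq_mul]
    have h1 : |(|∑ j, Q i j * s j| - |∑ j, Q i j * t j|)| ≤ K * ‖s - t‖ := by
      refine (abs_abs_sub_abs_le _ _).trans ?_
      rw [← Finset.sum_sub_distrib]
      simp_rw [← mul_sub]
      exact abs_sum_mul_le (s := s - t) (hK i)
    calc _ ≤ K * ‖s - t‖ * R ^ m := mul_le_mul_of_nonneg_right h1 (by positivity)
      _ = _ := by ring
  have hgbound : ∀ s, ‖s‖ ≤ 2 * B → |g s| ≤ R ^ m := by
    intro s hs
    refine (abs_excess_le hm (Real.log_nonneg hR1) fun i => ?_).trans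
      ((Real.log_le_self hR0.le).trans hRm)
    refine Real.log_le_log (lt_max_of_lt_right hδ) (max_le ?_ ?_)
    · refine (abs_sum_mul_le (hK i)).trans ?_
      rw [hR]
      nlinarith
    · exact (inv_le_one_of_one_le₀ hRm1).trans hR1
  have key : ∀ s t : ι → ℝ, ‖s‖ ≤ 2 * B →
      |g s * cutoff (‖s‖ / B) - g t * cutoff (‖t‖ / B)| ≤ 3 * K * R ^ m * ‖s - t‖ := by
    intro s t hs
    have h1 : g s * cutoff (‖s‖ / B) - g t * cutoff (‖t‖ / B) =
        g s * (cutoff (‖s‖ / B) - cutoff (‖t‖ / B)) + (g s - g t) * cutoff (‖t‖ / B) := by ring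
    have h2 : |cutoff (‖s‖ / B) - cutoff (‖t‖ / B)| ≤ ‖s - t‖ := by
      refine (abs_cutoff_sub_le _ _).trans ?_
      rw [← sub_div, abs_div, abs_of_pos hB0]
      exact (div_le_self (abs_nonneg _) hB).trans (abs_norm_sub_norm_le s t)
    have h3 : |(g s - g t) * cutoff (‖t‖ / B)| ≤ 2 * (K * R ^ m * ‖s - t‖) := by
      rw [abs_mul, abs_of_nonneg (cutoff_nonneg _)]
      exact (mul_le_of_le_one_right (abs_nonneg _) (cutoff_le_one _)).trans (hglip s t)
    have h4 : |g s * (cutoff (‖s‖ / B) - cutoff (‖t‖ / B))| ≤ K * R ^ m * ‖s - t‖ := by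
      rw [abs_mul]
      calc _ ≤ R ^ m * ‖s - t‖ :=
            mul_le_mul (hgbound s hs) h2 (abs_nonneg _) (by positivity)
        _ ≤ K * (R ^ m * ‖s - t‖) := le_mul_of_one_le_left (by positivity) hK1
        _ = _ := by ring
    rw [h1]
    refine (abs_add_le _ _).trans ((add_le_add h4 h3).trans (le_of_eq ?_))
    ring
  change |g s * cutoff (‖s‖ / B) - g t * cutoff (‖t‖ / B)| ≤ _
  rcases le_total ‖s‖ (2 * B) with hs | hs
  · exact key s t hs
  · rcases le_total ‖t‖ (2 * B) with ht | ht
    · rw [abs_sub_comm, norm_sub_rev]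
      exact key t s ht
    · rw [cutoff_of_ge ((le_div_iff₀ hB0).2 hs), cutoff_of_ge ((le_div_iff₀ hB0).2 ht)]
      simp only [mul_zero, sub_self, abs_zero]
      positivity

theorem cutExcess_div {Q : Fin m → ι → ℝ} {K : ℝ} (hK1 : 1 ≤ K)
    (hK : ∀ i, ∑ j, |Q i j| ≤ K) {B S : ℝ} (hB : 1 ≤ B) (hS : 0 < S) {y : ι → ℤ}
    (hy : ∀ i, latticeForm (Q i) y ≠ 0) :
    cutExcess Q (2 * B * K) B (fun k => y k / S) =
      excess (fun i => Real.log |latticeForm (Q i) y| - Real.log S) *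
        cutoff (‖fun k => (y k : ℝ) / S‖ / B) := by
  have hB0 : 0 < B := by linarith
  rcases le_total (2 * B) ‖fun k => (y k : ℝ) / S‖ with hs | hs
  · rw [cutExcess_eq_zero hB0 hs, cutoff_of_ge ((le_div_iff₀ hB0).2 hs), mul_zero]
  rw [cutExcess]
  congr 1
  set R := 2 * B * K with hR
  have hR1 : 1 ≤ R := by nlinarith
  have hR0 : 0 < R := by linarith
  have hform : ∀ i, ∑ j, Q i j * ((y j : ℝ) / S) = latticeForm (Q i) y / S := fun i => by
    rw [latticeForm, Finset.sum_div]
    exact Finset.sum_congr rfl fun j _ => by ring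
  have hlog : ∀ i, Real.log |latticeForm (Q i) y / S| =
      Real.log |latticeForm (Q i) y| - Real.log S := fun i => by
    rw [abs_div, abs_of_pos hS, Real.log_div (abs_ne_zero.2 (hy i)) hS.ne']
  rw [← excess_max (w := fun i => Real.log |latticeForm (Q i) y| - Real.log S)
    (M := Real.log R) (Real.log_nonneg hR1) fun i => ?_]
  · congr 1
    funext i
    have hpos : 0 < |latticeForm (Q i) y / S| := abs_pos.2 (div_ne_zero (hy i) hS.ne')
    have hδ : 0 < (R ^ m)⁻¹ := by positivity
    rw [hform, ← hlog, Real.strictMonoOn_log.monotoneOn.map_max (Set.mem_Ioi.2 hpos)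
      (Set.mem_Ioi.2 hδ), Real.log_inv, Real.log_pow]
  · rw [← hlog, ← hform]
    refine Real.log_le_log (by rw [hform]; exact abs_pos.2 (div_ne_zero (hy i) hS.ne')) ?_
    refine (abs_sum_mul_le (s := fun j => (y j : ℝ) / S) (hK i)).trans ?_
    rw [hR]
    nlinarith

end Cut

/-! ### Comparison of a product of forms with its factors -/

section Compare

variable {ι : Type*} [Fintype ι] {m : ℕ}

theorem exp_le_one_add_two_mul {x : ℝ} (h0 : 0 ≤ x) (h1 : x ≤ 1) : Real.exp x ≤ 1 + 2 * x := by
  have h := Real.abs_exp_sub_one_le (x := x) (by rwa [abs_of_nonneg h0])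
  rw [abs_of_nonneg h0] at h
  linarith [le_abs_self (Real.exp x - 1)]

/-- The excess of the numbers `log |Qᵢ(y)| - log S`. -/
noncomputable def logExcess (Q : Fin m → ι → ℝ) (S : ℝ) (y : ι → ℤ) : ℝ :=
  excess fun i => Real.log |latticeForm (Q i) y| - Real.log S

open Classical in
/-- The difference of the indicator of `|∏ᵢ Qᵢ(y)| < T ^ m` and the mean of the indicators of
`|Qᵢ(y)| < T`. -/
noncomputable def indicatorDiff (Q : Fin m → ι → ℝ) (T : ℝ) (y : ι → ℤ) : ℝ :=
  (if |∏ i, latticeForm (Q i) y| < T ^ m then 1 else 0) -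
    (∑ i, if |latticeForm (Q i) y| < T then 1 else 0) / m

/-- The points for which the product of the forms, or one of them, is close to the truncation
bound. -/
def transitionSet (Q : Fin m → ι → ℝ) (T ε : ℝ) : Set (ι → ℤ) :=
  {y | (T ^ m ≤ |∏ i, latticeForm (Q i) y| ∧
    |∏ i, latticeForm (Q i) y| ≤ T ^ m * (1 + 2 * m * ε)) ∨
    ∃ i, T ≤ |latticeForm (Q i) y| ∧ |latticeForm (Q i) y| ≤ T * (1 + 2 * ε)}

theorem logExcess_mul_exp {Q : Fin m → ι → ℝ} {T : ℝ} (hT : 0 < T) (ε : ℝ) (y : ι → ℤ) :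
    logExcess Q (T * Real.exp ε) y =
      excess fun i => Real.log |latticeForm (Q i) y| - Real.log T - ε := by
  rw [logExcess, Real.log_mul hT.ne' (Real.exp_pos ε).ne', Real.log_exp]
  congr 1
  funext i
  ring

open Classical in
theorem abs_logExcess_sub_le (hm : 1 ≤ m) {Q : Fin m → ι → ℝ} {T ε : ℝ} (hT : 0 < T)
    (hε : 0 ≤ ε) (hmε : m * ε ≤ 1) {y : ι → ℤ} (hy : ∀ i, latticeForm (Q i) y ≠ 0) :
    |logExcess Q (T * Real.exp ε) y - logExcess Q T y - ε * indicatorDiff Q T y| ≤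
      if y ∈ transitionSet Q T ε then ε * (1 + m) else 0 := by
  have hm' : (0 : ℝ) < m := by exact_mod_cast hm
  have hm1 : (1 : ℝ) ≤ m := by exact_mod_cast hm
  have hε1 : ε ≤ 1 := by nlinarith
  have ha : ∀ i, 0 < |latticeForm (Q i) y| := fun i => abs_pos.2 (hy i)
  set w : Fin m → ℝ := fun i => Real.log |latticeForm (Q i) y| - Real.log T with hw
  have hprod : |∏ i, latticeForm (Q i) y| = Real.exp (m * ((∑ i, w i) / m)) * T ^ m := by
    have h1 : m * ((∑ i, w i) / m) = ∑ i, w i := by field_simp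
    rw [h1, Real.exp_sum, Finset.abs_prod]
    have h2 : ∀ i, Real.exp (w i) = |latticeForm (Q i) y| / T := fun i => by
      rw [hw, Real.exp_sub, Real.exp_log (ha i), Real.exp_log hT]
    simp only [h2, Finset.prod_div_distrib, Finset.prod_const, Finset.card_univ, Fintype.card_fin]
    field_simp
  have hone : ∀ i, |latticeForm (Q i) y| = Real.exp (w i) * T := fun i => by
    rw [hw, Real.exp_sub, Real.exp_log (ha i), Real.exp_log hT]
    field_simp
  have hTm : 0 < T ^ m := by positivity
  have hlt : (∑ i, w i) / m < 0 ↔ |∏ i, latticeForm (Q i) y| < T ^ m := by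
    rw [hprod, mul_lt_iff_lt_one_left hTm, Real.exp_lt_one_iff]
    constructor
    · intro h
      exact mul_neg_of_pos_of_neg hm' h
    · intro h
      by_contra hge
      exact absurd h (not_lt.2 (mul_nonneg hm'.le (not_lt.1 hge)))
  have hlt1 : ∀ i, w i < 0 ↔ |latticeForm (Q i) y| < T := fun i => by
    rw [hone, mul_lt_iff_lt_one_left hT, Real.exp_lt_one_iff]
  have hle : 0 ≤ (∑ i, w i) / m ∧ (∑ i, w i) / m ≤ ε → y ∈ transitionSet Q T ε := by
    intro h
    refine Or.inl ⟨?_, ?_⟩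
    · rw [← not_lt, ← hlt]
      exact not_lt.2 h.1
    · rw [hprod, mul_comm (T ^ m)]
      refine mul_le_mul_of_nonneg_right ?_ hTm.le
      calc Real.exp (m * ((∑ i, w i) / m)) ≤ Real.exp (m * ε) :=
            Real.exp_le_exp.2 (mul_le_mul_of_nonneg_left h.2 hm'.le)
        _ ≤ 1 + 2 * (m * ε) := exp_le_one_add_two_mul (by positivity) hmε
        _ = _ := by ring
  have hle1 : ∀ i, 0 ≤ w i ∧ w i ≤ ε → y ∈ transitionSet Q T ε := by
    intro i h
    refine Or.inr ⟨i, ?_, ?_⟩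
    · rw [← not_lt, ← hlt1]
      exact not_lt.2 h.1
    · rw [hone, mul_comm T]
      exact mul_le_mul_of_nonneg_right
        ((Real.exp_le_exp.2 h.2).trans (exp_le_one_add_two_mul hε hε1)) hT.le
  have h := abs_excess_shift_le hm w hε
  rw [logExcess_mul_exp hT, indicatorDiff]
  simp only [← hlt, ← hlt1]
  refine h.trans ?_
  by_cases h3 : y ∈ transitionSet Q T ε
  · rw [if_pos h3]
    refine mul_le_mul_of_nonneg_left (add_le_add ?_ ?_) hε
    · split_ifs <;> norm_num
    · calc _ ≤ ∑ _i : Fin m, (1 : ℝ) := Finset.sum_le_sum fun i _ => by split_ifs <;> norm_num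
        _ = m := by simp
  · rw [if_neg h3, if_neg fun h => h3 (hle h),
      Finset.sum_eq_zero fun i _ => if_neg fun hi => h3 (hle1 i hi)]
    simp

theorem abs_logExcess_sub_cutExcess_le (hm : 1 ≤ m) {Q : Fin m → ι → ℝ} {K : ℝ} (hK1 : 1 ≤ K)
    (hK : ∀ i, ∑ j, |Q i j| ≤ K) {T B ε : ℝ} (hT : 0 < T) (hB : 1 ≤ B) (hε : 0 ≤ ε)
    (hε1 : ε ≤ 1) {y : ι → ℤ} (hy : ∀ i, latticeForm (Q i) y ≠ 0) :
    |logExcess Q (T * Real.exp ε) y - logExcess Q T y -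
      (cutExcess Q (2 * B * K) B (fun k => y k / (T * Real.exp ε)) -
        cutExcess Q (2 * B * K) B (fun k => y k / T))| ≤
      ε * (2 + 4 * Real.log (6 * B * K)) := by
  set T' := T * Real.exp ε with hT'
  have hexp1 : 1 ≤ Real.exp ε := Real.one_le_exp hε
  have hexp2 := exp_le_one_add_two_mul hε hε1
  have hTT' : T ≤ T' := le_mul_of_one_le_right hT.le hexp1
  have hT'3 : T' ≤ 3 * T := by
    rw [hT', mul_comm]
    exact mul_le_mul_of_nonneg_right (by linarith) hT.le
  have hT'0 : 0 < T' := hT.trans_le hTT'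
  have hB0 : 0 < B := by linarith
  rw [cutExcess_div hK1 hK hB hT'0 hy, cutExcess_div hK1 hK hB hT hy]
  change |logExcess Q T' y - logExcess Q T y - (logExcess Q T' y * _ - logExcess Q T y * _)| ≤ _
  have hnorm : ∀ S : ℝ, 0 < S → ‖fun k => (y k : ℝ) / S‖ = ‖fun k => (y k : ℝ)‖ / S := by
    intro S hS
    have : (fun k => (y k : ℝ) / S) = S⁻¹ • fun k => (y k : ℝ) := by
      funext k
      simp [div_eq_inv_mul]
    rw [this, norm_smul, norm_inv, Real.norm_of_nonneg hS.le, div_eq_inv_mul]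
  rw [hnorm T hT, hnorm T' hT'0]
  set Y := ‖fun k => (y k : ℝ)‖ with hY
  have hY0 : 0 ≤ Y := norm_nonneg _
  set ψ := cutoff (Y / T / B)
  set ψ' := cutoff (Y / T' / B)
  have hsplit : logExcess Q T' y - logExcess Q T y -
      (logExcess Q T' y * ψ' - logExcess Q T y * ψ) =
      (logExcess Q T' y - logExcess Q T y) * (1 - ψ') - logExcess Q T y * (ψ' - ψ) := by ring
  have h1 : |(logExcess Q T' y - logExcess Q T y) * (1 - ψ')| ≤ ε * 2 := by
    rw [abs_mul]
    have h2 : |logExcess Q T' y - logExcess Q T y| ≤ 2 * ε := by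
      rw [hT', logExcess_mul_exp hT]
      refine abs_excess_sub_le hm fun i => ?_
      rw [sub_sub_cancel_left, abs_neg, abs_of_nonneg hε]
    have h3 : |1 - ψ'| ≤ 1 := by
      rw [abs_le]
      constructor <;> linarith [cutoff_nonneg (Y / T' / B), cutoff_le_one (Y / T' / B)]
    calc _ ≤ 2 * ε * 1 := mul_le_mul h2 h3 (abs_nonneg _) (by positivity)
      _ = _ := by ring
  have hlog0 : 0 ≤ Real.log (6 * B * K) := Real.log_nonneg (by nlinarith)
  have h4 : |logExcess Q T y * (ψ' - ψ)| ≤ ε * (4 * Real.log (6 * B * K)) := by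
    rcases le_total (2 * B) (Y / T') with hbig | hsmall
    · have hbig' : 2 * B ≤ Y / T := hbig.trans (div_le_div_of_nonneg_left hY0 hT hTT')
      have e1 : ψ' = 0 := cutoff_of_ge ((le_div_iff₀ hB0).2 hbig)
      have e2 : ψ = 0 := cutoff_of_ge ((le_div_iff₀ hB0).2 hbig')
      rw [e1, e2, sub_self, mul_zero, abs_zero]
      positivity
    · have h5 : |logExcess Q T y| ≤ Real.log (6 * B * K) := by
        refine abs_excess_le hm hlog0 fun i => ?_
        rw [← Real.log_div (abs_ne_zero.2 (hy i)) hT.ne']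
        refine Real.log_le_log (div_pos (abs_pos.2 (hy i)) hT) ?_
        rw [div_le_iff₀ hT]
        refine (abs_sum_mul_le (s := fun j => (y j : ℝ)) (hK i)).trans ?_
        rw [div_le_iff₀ hT'0] at hsmall
        calc K * Y ≤ K * (2 * B * (3 * T)) := by gcongr; exact hsmall.trans (by gcongr)
          _ = _ := by ring
      have h6 : |ψ' - ψ| ≤ 4 * ε := by
        refine (abs_cutoff_sub_le _ _).trans ?_
        have e : Y / T / B = Y / T' / B * Real.exp ε := by
          rw [hT']
          field_simp
        have h7 : Y / T' / B ≤ 2 := by rw [div_le_iff₀ hB0]; exact hsmall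
        have h8 : 0 ≤ Y / T' / B := by positivity
        rw [e, abs_sub_comm, abs_of_nonneg (by nlinarith)]
        nlinarith
      rw [abs_mul]
      calc _ ≤ Real.log (6 * B * K) * (4 * ε) := mul_le_mul h5 h6 (abs_nonneg _) hlog0
        _ = _ := by ring
  rw [hsplit, mul_add]
  exact (abs_sub _ _).trans (add_le_add h1 h4)

theorem logExcess_sub_cutExcess_eq_zero {Q : Fin m → ι → ℝ} {K : ℝ} (hK1 : 1 ≤ K)
    (hK : ∀ i, ∑ j, |Q i j| ≤ K) {T B S : ℝ} (hB : 1 ≤ B) (hT : 0 < T) (hTS : T ≤ S)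
    {y : ι → ℤ} (hy : ∀ i, latticeForm (Q i) y ≠ 0)
    (h : (∀ i, S ≤ |latticeForm (Q i) y|) ∨ ∀ k, |(y k : ℝ)| ≤ B * T) :
    logExcess Q S y - cutExcess Q (2 * B * K) B (fun k => y k / S) = 0 := by
  have hB0 : 0 < B := by linarith
  have hS := hT.trans_le hTS
  rw [cutExcess_div hK1 hK hB hS hy]
  change logExcess Q S y - logExcess Q S y * _ = 0
  rcases h with h | h
  · have : logExcess Q S y = 0 :=
      excess_of_nonneg fun i => sub_nonneg.2 (Real.log_le_log hS (h i))
    rw [this]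
    ring
  · rw [cutoff_of_le, mul_one, sub_self]
    rw [div_le_one hB0, pi_norm_le_iff_of_nonneg hB0.le]
    intro k
    rw [Real.norm_eq_abs, abs_div, abs_of_pos hS, div_le_iff₀ hS]
    exact (h k).trans (mul_le_mul_of_nonneg_left hTS hB0.le)

/-- The contribution of the dilated cut-off excess. -/
theorem exists_norm_tsum_cutExcess_le [DecidableEq ι] {p : ι → ℕ} (hp : ∀ k, 1 ≤ p k)
    (u : ι → ℝ) (hm : 1 ≤ m)
    {Q : Fin m → ι → ℝ} {K : ℝ} (hK1 : 1 ≤ K) (hK : ∀ i, ∑ j, |Q i j| ≤ K) :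
    ∃ C, 0 ≤ C ∧ ∀ T B ε : ℝ, 1 ≤ T → 1 ≤ B → 0 ≤ ε → ε ≤ 1 →
      let r : (ι → ℤ) → ℂ := fun y => diagTerm p u y *
        ((cutExcess Q (2 * B * K) B (fun k => y k / (T * Real.exp ε)) -
            cutExcess Q (2 * B * K) B (fun k => y k / T) : ℝ) : ℂ)
      Summable r ∧ ‖∑' y, r y‖ ≤
        C * (B ^ m / T * harmonicSum ⌈6 * B * T⌉₊ ^ Fintype.card ι) := by
  obtain ⟨C, hC0, hC⟩ := exists_norm_sum_cube_scale_le hp u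
  refine ⟨C * (3 * K * (2 * K) ^ m) * 2 ^ Fintype.card ι, by positivity,
    fun T B ε hT hB hε hε1 => ?_⟩
  intro r
  have hT0 : 0 < T := by linarith
  have hB0 : 0 < B := by linarith
  have hTT' : T ≤ T * Real.exp ε := le_mul_of_one_le_right hT0.le (Real.one_le_exp hε)
  have hT'3 : T * Real.exp ε ≤ 3 * T := by
    rw [mul_comm]
    exact mul_le_mul_of_nonneg_right (by linarith [exp_le_one_add_two_mul hε hε1]) hT0.le
  set N := ⌈6 * B * T⌉₊ with hN
  have hNle : 6 * B * T ≤ N := Nat.le_ceil _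
  have hN1 : 1 ≤ N := Nat.one_le_ceil_iff.2 (by positivity)
  have hvanish : ∀ s : ι → ℝ, (∃ k, 2 * B ≤ |s k|) → cutExcess Q (2 * B * K) B s = 0 := by
    rintro s ⟨k, hk⟩
    exact cutExcess_eq_zero hB0 (hk.trans (norm_le_pi_norm s k))
  have hr0 : ∀ y ∉ cube ι N, r y = 0 := by
    intro y hy
    rw [mem_cube] at hy
    push Not at hy
    obtain ⟨k, hk⟩ := hy
    have hk' : 6 * B * T ≤ |(y k : ℝ)| := by
      refine hNle.trans ?_
      exact_mod_cast hk.le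
    have h1 : ∀ S, 0 < S → S ≤ 3 * T → 2 * B ≤ |(y k : ℝ) / S| := by
      intro S hS hS3
      rw [abs_div, abs_of_pos hS, le_div_iff₀ hS]
      refine le_trans ?_ hk'
      nlinarith
    simp only [r]
    rw [hvanish _ ⟨k, h1 _ (by positivity) hT'3⟩, hvanish _ ⟨k, h1 T hT0 (by linarith)⟩]
    simp
  have hsum := hC N T (T * Real.exp ε) (3 * K * (2 * B * K) ^ m) (cutExcess Q (2 * B * K) B) hN1
    hT0 hTT' (by positivity) (fun s t => abs_cutExcess_sub_le hm hK1 hK hB s t) fun s ⟨k, hk⟩ => by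
      refine hvanish s ⟨k, ?_⟩
      have h2 : 6 * B * T ≤ 3 * T * |s k| :=
        (hNle.trans hk).trans (mul_le_mul_of_nonneg_right hT'3 (abs_nonneg _))
      by_contra hlt
      push Not at hlt
      nlinarith
  refine ⟨summable_of_hasFiniteSupport ((cube ι N).finite_toSet.subset fun y hy => ?_), ?_⟩
  · by_contra h
    exact hy (hr0 y h)
  · rw [tsum_eq_sum hr0]
    refine hsum.trans (le_of_eq ?_)
    rw [mul_pow 2 (harmonicSum N), show 2 * B * K = B * (2 * K) by ring, mul_pow B]
    ring

variable [Nonempty ι]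

theorem latticeForm_ne_zero_of_diagTerm {p : ι → ℕ} (hp : ∀ k, 1 ≤ p k) {u : ι → ℝ}
    {Q : Fin m → ι → ℝ} (hQ : ∀ i, ∀ y : ι → ℤ, y ≠ 0 → latticeForm (Q i) y ≠ 0) {y : ι → ℤ}
    (hd : diagTerm p u y ≠ 0) (i : Fin m) : latticeForm (Q i) y ≠ 0 := by
  refine hQ i y fun h => hd ?_
  obtain ⟨k⟩ := ‹Nonempty ι›
  exact diagTerm_eq_zero hp u (k := k) (by rw [h]; rfl)

variable [DecidableEq ι]

/-- The contribution of the points outside the ball on which the cut-off excess is unmodified. -/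
theorem exists_norm_tsum_far_le {p : ι → ℕ} (hp : ∀ k, 1 ≤ p k) (u : ι → ℝ) (hm : 1 ≤ m)
    {Q : Fin m → ι → ℝ} (hQ : ∀ i, ∀ y : ι → ℤ, y ≠ 0 → latticeForm (Q i) y ≠ 0)
    {K : ℝ} (hK1 : 1 ≤ K) (hK : ∀ i, ∑ j, |Q i j| ≤ K) {θ : ℝ} (hθ : 0 < θ) (hθ1 : θ ≤ 1) :
    ∃ C, 0 ≤ C ∧ ∀ T B ε : ℝ, 1 ≤ T → 1 ≤ B → 0 ≤ ε → ε ≤ 1 →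
      let r : (ι → ℤ) → ℂ := fun y => diagTerm p u y *
        ((logExcess Q (T * Real.exp ε) y - logExcess Q T y -
          (cutExcess Q (2 * B * K) B (fun k => y k / (T * Real.exp ε)) -
            cutExcess Q (2 * B * K) B (fun k => y k / T)) : ℝ) : ℂ)
      Summable r ∧ ‖∑' y, r y‖ ≤
        C * (ε * (2 + 4 * Real.log (6 * B * K)) * (T * (B * T) ^ (θ - 1))) := by
  have hQ0 : ∀ i j, Q i j ≠ 0 := fun i => coeff_ne_zero_of_nonvanishing (hQ i)
  obtain ⟨C, hC0, hC⟩ := exists_sum_weight_strip_le hQ0 hθ hθ1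
  refine ⟨3 * C, by positivity, fun T B ε hT hB hε hε1 => ?_⟩
  intro r
  have hT0 : 0 < T := by linarith
  have hB0 : 0 < B := by linarith
  have hTT' : T ≤ T * Real.exp ε := le_mul_of_one_le_right hT0.le (Real.one_le_exp hε)
  have hT'3 : T * Real.exp ε ≤ 3 * T := by
    rw [mul_comm]
    exact mul_le_mul_of_nonneg_right (by linarith [exp_le_one_add_two_mul hε hε1]) hT0.le
  have hlog0 : 0 ≤ Real.log (6 * B * K) := Real.log_nonneg (by nlinarith)
  have hBT : 0 < B * T := by positivity
  have := summable_and_norm_tsum_le (f := r)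
    (S := {y | (∃ i, |latticeForm (Q i) y| ≤ 3 * T) ∧ ∃ a, B * T ≤ |(y a : ℝ)|})
    (c := ε * (2 + 4 * Real.log (6 * B * K))) (b := C * (3 * T) * (B * T) ^ (θ - 1))
    (by positivity) (fun y _ => ?_) (fun y hy => ?_) fun A hA => ?_
  · refine ⟨this.1, this.2.trans (le_of_eq ?_)⟩
    ring
  · by_cases hd : diagTerm p u y = 0
    · simp only [r, hd, zero_mul, norm_zero]
      exact mul_nonneg (by positivity) (weight_nonneg y)
    · have hform := latticeForm_ne_zero_of_diagTerm hp hQ hd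
      simp only [r]
      rw [norm_mul, Complex.norm_real, Real.norm_eq_abs, mul_comm]
      exact mul_le_mul (abs_logExcess_sub_cutExcess_le hm hK1 hK hT0 hB hε hε1 hform)
        (norm_diagTerm_le hp u y) (norm_nonneg _) (by positivity)
  · by_cases hd : diagTerm p u y = 0
    · simp only [r, hd, zero_mul]
    · have hform := latticeForm_ne_zero_of_diagTerm hp hQ hd
      have hor : (∀ i, 3 * T ≤ |latticeForm (Q i) y|) ∨ ∀ k, |(y k : ℝ)| ≤ B * T := by
        by_contra hne
        push Not at hne
        obtain ⟨⟨i, hi⟩, k, hk⟩ := hne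
        exact hy ⟨⟨i, hi.le⟩, k, hk.le⟩
      have h1 := logExcess_sub_cutExcess_eq_zero hK1 hK hB hT0 le_rfl hform
        (hor.imp (fun h i => by linarith [h i]) id)
      have h2 := logExcess_sub_cutExcess_eq_zero hK1 hK hB hT0 hTT' hform
        (hor.imp (fun h i => hT'3.trans (h i)) id)
      have h3 : ∀ a b c d : ℝ, a - c = 0 → b - d = 0 → a - b - (c - d) = 0 := by
        intro a b c d h h'
        linarith
      simp only [r]
      rw [h3 _ _ _ _ h2 h1, Complex.ofReal_zero, mul_zero]
  · exact hC A (3 * T) (B * T) (by linarith) hBT (fun y hy => (hA y hy).1) fun y hy => (hA y hy).2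

/-- The contribution of the transition set. -/
theorem exists_norm_tsum_transition_le {p : ι → ℕ} (hp : ∀ k, 1 ≤ p k) (u : ι → ℝ) (hm : 1 ≤ m)
    {Q : Fin m → ι → ℝ} (hQ : ∀ i, ∀ y : ι → ℤ, y ≠ 0 → latticeForm (Q i) y ≠ 0)
    {θ : ℝ} (hθ : 0 < θ) (hθ1 : θ ≤ 1) :
    ∃ C, 0 ≤ C ∧ ∀ T ε : ℝ, 1 ≤ T → 0 ≤ ε → m * ε ≤ 1 →
      let r : (ι → ℤ) → ℂ := fun y => diagTerm p u y *
        ((logExcess Q (T * Real.exp ε) y - logExcess Q T y - ε * indicatorDiff Q T y : ℝ) : ℂ)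
      Summable r ∧ ‖∑' y, r y‖ ≤
        C * (ε * ((1 + ε ^ (1 / (m : ℝ)) * T) * T ^ (θ - 1))) := by
  classical
  have hm' : (0 : ℝ) < m := by exact_mod_cast hm
  have hm1 : (1 : ℝ) ≤ m := by exact_mod_cast hm
  have hQ0 : ∀ i j, Q i j ≠ 0 := fun i => coeff_ne_zero_of_nonvanishing (hQ i)
  obtain ⟨C, hC0, hC⟩ := exists_sum_weight_transition_le hm hQ0 hθ hθ1
  choose C' hC'0 hC' using fun i => exists_sum_weight_transition_le (Q := fun _ : Fin 1 => Q i)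
    le_rfl (fun _ j => hQ0 i j) hθ hθ1
  refine ⟨(1 + m) * (C * (2 * m) + ∑ i, C' i * (2 * m)),
    mul_nonneg (by positivity) (add_nonneg (by positivity)
      (Finset.sum_nonneg fun i _ => mul_nonneg (hC'0 i) (by positivity))),
    fun T ε hT hε hmε => ?_⟩
  intro r
  have hT0 : 0 < T := by linarith
  have hε1 : ε ≤ 1 := by nlinarith
  set X := (1 + ε ^ (1 / (m : ℝ)) * T) * T ^ (θ - 1) with hX
  have hroot : ∀ x, 0 ≤ x → x ≤ 2 * m * ε ^ (1 / (m : ℝ)) →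
      (1 + x * T) * T ^ (θ - 1) ≤ 2 * m * X := by
    intro x hx hxle
    rw [hX, ← mul_assoc]
    refine mul_le_mul_of_nonneg_right ?_ (by positivity)
    nlinarith [mul_le_mul_of_nonneg_right hxle hT0.le]
  have hbound : ∀ A : Finset (ι → ℤ), (∀ y ∈ A, y ∈ transitionSet Q T ε) →
      ∑ y ∈ A, weight y ≤ (C * (2 * m) + ∑ i, C' i * (2 * m)) * X := by
    intro A hA
    have h1 : ∑ y ∈ A, weight y ≤
        (∑ y ∈ A with T ^ m ≤ |∏ i, latticeForm (Q i) y| ∧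
          |∏ i, latticeForm (Q i) y| ≤ T ^ m * (1 + 2 * m * ε), weight y) +
        ∑ i, ∑ y ∈ A with T ≤ |latticeForm (Q i) y| ∧ |latticeForm (Q i) y| ≤ T * (1 + 2 * ε),
          weight y := by
      simp only [Finset.sum_filter]
      rw [Finset.sum_comm, ← Finset.sum_add_distrib]
      refine Finset.sum_le_sum fun y hy => ?_
      have hnn : ∀ i, 0 ≤ if T ≤ |latticeForm (Q i) y| ∧
          |latticeForm (Q i) y| ≤ T * (1 + 2 * ε) then weight y else 0 := fun i => by
        split_ifs
        exacts [weight_nonneg y, le_rfl]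
      rcases hA y hy with h | ⟨i, hi⟩
      · rw [if_pos h]
        linarith [Finset.sum_nonneg fun i (_ : i ∈ Finset.univ) => hnn i]
      · have h2 := Finset.single_le_sum (fun i _ => hnn i) (Finset.mem_univ i)
        rw [if_pos hi] at h2
        refine h2.trans (le_add_of_nonneg_left ?_)
        split_ifs
        exacts [weight_nonneg y, le_rfl]
    have h3 := hC (A.filter fun y => T ^ m ≤ |∏ i, latticeForm (Q i) y| ∧
          |∏ i, latticeForm (Q i) y| ≤ T ^ m * (1 + 2 * m * ε)) T (2 * m * ε) hT0 (by positivity)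
          fun y hy => (Finset.mem_filter.1 hy).2
    have h4 : ∀ i, _ := fun i => hC' i (A.filter fun y => T ≤ |latticeForm (Q i) y| ∧
          |latticeForm (Q i) y| ≤ T * (1 + 2 * ε)) T (2 * ε) hT0 (by positivity)
          fun y hy => by simpa using (Finset.mem_filter.1 hy).2
    have h5 : (2 * m * ε) ^ (1 / (m : ℝ)) ≤ 2 * m * ε ^ (1 / (m : ℝ)) := by
      rw [Real.mul_rpow (by positivity) hε]
      refine mul_le_mul_of_nonneg_right ?_ (by positivity)
      calc (2 * (m : ℝ)) ^ (1 / (m : ℝ)) ≤ (2 * (m : ℝ)) ^ (1 : ℝ) :=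
            Real.rpow_le_rpow_of_exponent_le (by linarith) (by rw [div_le_one hm']; exact hm1)
        _ = _ := Real.rpow_one _
    have h6 : 2 * ε ≤ 2 * m * ε ^ (1 / (m : ℝ)) := by
      have h7 : ε ≤ ε ^ (1 / (m : ℝ)) := by
        rcases hε.eq_or_lt with h0 | h0
        · rw [← h0]
          exact Real.rpow_nonneg le_rfl _
        · conv_lhs => rw [← Real.rpow_one ε]
          exact Real.rpow_le_rpow_of_exponent_ge h0 hε1 (by rw [div_le_one hm']; exact hm1)
      nlinarith
    refine h1.trans ?_
    rw [add_mul, Finset.sum_mul]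
    refine add_le_add ?_ (Finset.sum_le_sum fun i _ => ?_)
    · refine h3.trans ?_
      rw [mul_assoc, mul_assoc C]
      exact mul_le_mul_of_nonneg_left (hroot _ (by positivity) h5) hC0
    · refine (h4 i).trans ?_
      rw [Nat.cast_one, div_one, Real.rpow_one, mul_assoc, mul_assoc (C' i)]
      exact mul_le_mul_of_nonneg_left (hroot _ (by positivity) h6) (hC'0 i)
  have := summable_and_norm_tsum_le (f := r) (S := transitionSet Q T ε) (c := ε * (1 + m))
    (by positivity) (fun y hy => ?_) (fun y hy => ?_) hbound
  · refine ⟨this.1, this.2.trans (le_of_eq ?_)⟩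
    ring
  · by_cases hd : diagTerm p u y = 0
    · simp only [r, hd, zero_mul, norm_zero]
      exact mul_nonneg (by positivity) (weight_nonneg y)
    · have h := abs_logExcess_sub_le hm hT0 hε hmε (latticeForm_ne_zero_of_diagTerm hp hQ hd)
      rw [if_pos hy] at h
      simp only [r]
      rw [norm_mul, Complex.norm_real, Real.norm_eq_abs, mul_comm]
      exact mul_le_mul h (norm_diagTerm_le hp u y) (norm_nonneg _) (by positivity)
  · by_cases hd : diagTerm p u y = 0
    · simp only [r, hd, zero_mul]
    · have h := abs_logExcess_sub_le hm hT0 hε hmε (latticeForm_ne_zero_of_diagTerm hp hQ hd)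
      rw [if_neg hy] at h
      simp only [r]
      rw [abs_nonpos_iff.1 h, Complex.ofReal_zero, mul_zero]

theorem hasSum_indicatorDiff {p : ι → ℕ} (hp : ∀ k, 1 ≤ p k) (u : ι → ℝ) (hm : 1 ≤ m)
    {Q : Fin m → ι → ℝ} (hQ : ∀ i j, Q i j ≠ 0) (T : ℝ) :
    HasSum (fun y => diagTerm p u y * (indicatorDiff Q T y : ℂ))
      (sharpSum p u Q (T ^ m) - (∑ i, stripSum p u (Q i) T) / m) := by
  classical
  have h1 := (summable_sharp hp u hm hQ (T ^ m)).hasSum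
  have h2 := (hasSum_sum fun i (_ : i ∈ Finset.univ) =>
    (summable_strip hp u (hQ i) T).hasSum).div_const (m : ℂ)
  refine (h1.sub h2).congr_fun fun y => ?_
  simp only [indicatorDiff]
  push_cast
  rw [mul_sub, mul_div_assoc', Finset.mul_sum]
  congr 1
  · split_ifs <;> simp
  · congr 1
    refine Finset.sum_congr rfl fun i _ => ?_
    split_ifs <;> simp

theorem exists_norm_sharpSum_sub_le {p : ι → ℕ} (hp : ∀ k, 1 ≤ p k) (u : ι → ℝ) (hm : 1 ≤ m)
    {Q : Fin m → ι → ℝ} (hQ : ∀ i, ∀ y : ι → ℤ, y ≠ 0 → latticeForm (Q i) y ≠ 0)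
    {θ : ℝ} (hθ : 0 < θ) (hθ1 : θ ≤ 1) :
    ∃ C K, 0 ≤ C ∧ 1 ≤ K ∧ ∀ T B ε : ℝ, 1 ≤ T → 1 ≤ B → 0 < ε → m * ε ≤ 1 →
      ‖sharpSum p u Q (T ^ m) - (∑ i, stripSum p u (Q i) T) / m‖ ≤
        C * ((2 + 4 * Real.log (6 * B * K)) * (T * (B * T) ^ (θ - 1)) +
          B ^ m / (T * ε) * harmonicSum ⌈6 * B * T⌉₊ ^ Fintype.card ι +
          (1 + ε ^ (1 / (m : ℝ)) * T) * T ^ (θ - 1)) := by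
  have hm1 : (1 : ℝ) ≤ m := by exact_mod_cast hm
  have hQ0 : ∀ i j, Q i j ≠ 0 := fun i => coeff_ne_zero_of_nonvanishing (hQ i)
  set K := 1 + ∑ i, ∑ j, |Q i j| with hKdef
  have hnn : ∀ i, 0 ≤ ∑ j, |Q i j| := fun i => Finset.sum_nonneg fun j _ => abs_nonneg _
  have hK1 : 1 ≤ K := by linarith [Finset.sum_nonneg fun i (_ : i ∈ Finset.univ) => hnn i]
  have hK : ∀ i, ∑ j, |Q i j| ≤ K := fun i => by
    have := Finset.single_le_sum (f := fun i => ∑ j, |Q i j|) (fun i _ => hnn i)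
      (Finset.mem_univ i)
    linarith
  obtain ⟨C₁, hC₁0, hC₁⟩ := exists_norm_tsum_far_le hp u hm hQ hK1 hK hθ hθ1
  obtain ⟨C₂, hC₂0, hC₂⟩ := exists_norm_tsum_cutExcess_le hp u hm hK1 hK
  obtain ⟨C₃, hC₃0, hC₃⟩ := exists_norm_tsum_transition_le hp u hm hQ hθ hθ1
  refine ⟨C₁ + C₂ + C₃, K, by positivity, hK1, fun T B ε hT hB hε hmε => ?_⟩
  have hT0 : 0 < T := by linarith
  have hε1 : ε ≤ 1 := by nlinarith
  obtain ⟨s1, b1⟩ := hC₁ T B ε hT hB hε.le hε1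
  obtain ⟨s2, b2⟩ := hC₂ T B ε hT hB hε.le hε1
  obtain ⟨s3, b3⟩ := hC₃ T ε hT hε.le hmε
  -- `ε` times the difference of the indicators is the sum of the first two functions minus the
  -- third
  have hs := (s1.hasSum.add s2.hasSum).sub s3.hasSum
  have hs' := (hasSum_indicatorDiff hp u hm hQ0 T).mul_left (ε : ℂ)
  have heq := hs'.unique (hs.congr_fun fun y => by
    push_cast
    ring)
  set D := sharpSum p u Q (T ^ m) - (∑ i, stripSum p u (Q i) T) / m
  have hlog0 : 0 ≤ Real.log (6 * B * K) := Real.log_nonneg (by nlinarith)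
  have hH := harmonicSum_nonneg ⌈6 * B * T⌉₊
  refine le_of_mul_le_mul_left ?_ hε
  have hnorm : ε * ‖D‖ = ‖(ε : ℂ) * D‖ := by
    rw [norm_mul, Complex.norm_real, Real.norm_of_nonneg hε.le]
  rw [hnorm, heq]
  refine (norm_sub_le _ _).trans ((add_le_add ((norm_add_le _ _).trans (add_le_add b1 b2))
    b3).trans ?_)
  set X₁ := (2 + 4 * Real.log (6 * B * K)) * (T * (B * T) ^ (θ - 1))
  set X₂ := B ^ m / (T * ε) * harmonicSum ⌈6 * B * T⌉₊ ^ Fintype.card ι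
  set X₃ := (1 + ε ^ (1 / (m : ℝ)) * T) * T ^ (θ - 1)
  have e1 : ε * (2 + 4 * Real.log (6 * B * K)) * (T * (B * T) ^ (θ - 1)) = ε * X₁ := by ring
  have e2 : B ^ m / T * harmonicSum ⌈6 * B * T⌉₊ ^ Fintype.card ι = ε * X₂ := by
    simp only [X₂]
    field_simp
  have hX₁ : 0 ≤ X₁ := by positivity
  have hX₂ : 0 ≤ X₂ := by positivity
  have hX₃ : 0 ≤ X₃ := by positivity
  rw [e1, e2]
  calc C₁ * (ε * X₁) + C₂ * (ε * X₂) + C₃ * (ε * X₃) = ε * (C₁ * X₁ + C₂ * X₂ + C₃ * X₃) := by ring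
    _ ≤ _ := by
      refine mul_le_mul_of_nonneg_left ?_ hε.le
      nlinarith [mul_nonneg hC₁0 hX₂, mul_nonneg hC₁0 hX₃, mul_nonneg hC₂0 hX₁,
        mul_nonneg hC₂0 hX₃, mul_nonneg hC₃0 hX₁, mul_nonneg hC₃0 hX₂]

end Compare

/-! ### The limit of the truncated sums -/

section Limit

variable {ι : Type*} [Fintype ι] {m : ℕ}

theorem tendsto_log_pow_mul_rpow_neg (k : ℕ) {a : ℝ} (ha : 0 < a) :
    Tendsto (fun T : ℝ => Real.log T ^ k * T ^ (-a)) atTop (𝓝 0) := by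
  refine ((isLittleO_log_rpow_rpow_atTop (k : ℝ) ha).tendsto_div_nhds_zero).congr' ?_
  filter_upwards [eventually_ge_atTop 0] with T hT
  rw [Real.rpow_neg hT, Real.rpow_natCast, div_eq_mul_inv]

variable [DecidableEq ι] [Nonempty ι]

/-- The sums truncated by a product of forms have the same limit as the mean of the sums
truncated by its factors. The bound for the difference is applied with `B = T ^ b` and
`ε = T ^ (-b)`, for a small exponent `b`. -/
theorem tendsto_sharpSum_pow_sub {p : ι → ℕ} (hp : ∀ k, 1 ≤ p k) (u : ι → ℝ) (hm : 1 ≤ m)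
    {Q : Fin m → ι → ℝ} (hQ : ∀ i, ∀ y : ι → ℤ, y ≠ 0 → latticeForm (Q i) y ≠ 0) :
    Tendsto (fun T : ℝ => sharpSum p u Q (T ^ m) - (∑ i, stripSum p u (Q i) T) / m) atTop
      (𝓝 0) := by
  have hm1 : (1 : ℝ) ≤ m := by exact_mod_cast hm
  have hm0 : (0 : ℝ) < m := by linarith
  set b : ℝ := 1 / (4 * m) with hb
  set θ : ℝ := b / (4 * m) with hθ
  have hb0 : 0 < b := by positivity
  have hbm : b * m = 1 / 4 := by rw [hb]; field_simp
  have hb4 : b ≤ 1 / 4 := by nlinarith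
  have hθ0 : 0 < θ := by positivity
  have hθm : θ * m = b / 4 := by rw [hθ]; field_simp
  have hθb : θ ≤ b / 4 := by nlinarith
  obtain ⟨C, K, hC0, hK1, hC⟩ := exists_norm_sharpSum_sub_le hp u hm hQ hθ0
    (by linarith : θ ≤ 1)
  set ℓ := Fintype.card ι
  set a : ℝ := b - θ - b * θ with ha
  have ha0 : 0 < a := by nlinarith
  set a' : ℝ := 1 - b * m - b with ha'
  have ha'0 : 0 < a' := by linarith
  set a'' : ℝ := b / m - θ with ha''
  have ha''0 : 0 < a'' := by
    have : b / m = 4 * θ := by rw [hθ]; field_simp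
    linarith
  have hlim : Tendsto (fun T : ℝ =>
      C * (((2 + 4 * Real.log (6 * K)) * T ^ (-a) + 4 * b * (Real.log T ^ 1 * T ^ (-a))) +
        (3 + Real.log 7) ^ ℓ * (Real.log T ^ ℓ * T ^ (-a')) +
        (T ^ (-(1 - θ)) + T ^ (-a'')))) atTop (𝓝 0) := by
    have h1 := (tendsto_rpow_neg_atTop ha0).const_mul (2 + 4 * Real.log (6 * K))
    have h2 := (tendsto_log_pow_mul_rpow_neg 1 ha0).const_mul (4 * b)
    have h3 := (tendsto_log_pow_mul_rpow_neg ℓ ha'0).const_mul ((3 + Real.log 7) ^ ℓ)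
    have h4 := tendsto_rpow_neg_atTop (y := 1 - θ) (by linarith)
    have h5 := tendsto_rpow_neg_atTop ha''0
    simpa using ((((h1.add h2).add h3).add (h4.add h5)).const_mul C)
  refine squeeze_zero_norm' ?_ hlim
  have hεev : ∀ᶠ T : ℝ in atTop, T ^ (-b) < 1 / m :=
    (tendsto_rpow_neg_atTop hb0).eventually_lt_const (by positivity)
  filter_upwards [hεev, eventually_ge_atTop (Real.exp 1)] with T hTε hTe
  have hT1 : 1 ≤ T := (Real.one_le_exp zero_le_one).trans hTe
  have hT0 : 0 < T := by linarith
  have hlogT : 1 ≤ Real.log T := by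
    rw [← Real.log_exp 1]
    exact Real.log_le_log (Real.exp_pos 1) hTe
  have hB1 : 1 ≤ T ^ b := Real.one_le_rpow hT1 hb0.le
  have hBT : T ^ b ≤ T := by
    conv_rhs => rw [← Real.rpow_one T]
    exact Real.rpow_le_rpow_of_exponent_le hT1 (by linarith)
  refine (hC T (T ^ b) (T ^ (-b)) hT1 hB1 (by positivity) ?_).trans ?_
  · have := mul_le_mul_of_nonneg_left hTε.le hm0.le
    rwa [mul_one_div_cancel hm0.ne'] at this
  refine mul_le_mul_of_nonneg_left (add_le_add (add_le_add ?_ ?_) ?_) hC0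
  · have e1 : Real.log (6 * T ^ b * K) = Real.log (6 * K) + b * Real.log T := by
      rw [show 6 * T ^ b * K = 6 * K * T ^ b by ring,
        Real.log_mul (by positivity) (by positivity), Real.log_rpow hT0]
    have e2 : T * (T ^ b * T) ^ (θ - 1) = T ^ (-a) := by
      rw [← Real.rpow_add_one hT0.ne', ← Real.rpow_mul hT0.le, mul_comm,
        ← Real.rpow_add_one hT0.ne']
      congr 1
      rw [ha]
      ring
    rw [e1, e2]
    refine le_of_eq ?_
    ring
  · have e3 : (T ^ b) ^ m / (T * T ^ (-b)) = T ^ (-a') := by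
      rw [← Real.rpow_natCast, ← Real.rpow_mul hT0.le, mul_comm T, ← Real.rpow_add_one hT0.ne',
        ← Real.rpow_sub hT0]
      congr 1
      rw [ha']
      ring
    have h7 : 0 ≤ Real.log 7 := Real.log_nonneg (by norm_num)
    have hH : harmonicSum ⌈6 * T ^ b * T⌉₊ ≤ (3 + Real.log 7) * Real.log T := by
      refine (harmonicSum_le _).trans ?_
      have hN0 : 0 < 6 * T ^ b * T := by positivity
      have hN : (⌈6 * T ^ b * T⌉₊ : ℝ) ≤ 7 * T ^ 2 := by
        refine (Nat.ceil_lt_add_one hN0.le).le.trans ?_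
        nlinarith [mul_le_mul_of_nonneg_right hBT hT0.le]
      have hN1 : (0 : ℝ) < ⌈6 * T ^ b * T⌉₊ := by exact_mod_cast Nat.ceil_pos.2 hN0
      have := Real.log_le_log hN1 hN
      rw [Real.log_mul (by norm_num) (by positivity), Real.log_pow] at this
      push_cast at this
      nlinarith
    rw [e3]
    calc _ ≤ T ^ (-a') * ((3 + Real.log 7) * Real.log T) ^ ℓ := by
          have := harmonicSum_nonneg ⌈6 * T ^ b * T⌉₊
          gcongr
      _ = _ := by
          rw [mul_pow]
          ring
  · have e4 : (T ^ (-b)) ^ (1 / (m : ℝ)) * T * T ^ (θ - 1) = T ^ (-a'') := by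
      rw [← Real.rpow_mul hT0.le, ← Real.rpow_add_one hT0.ne', ← Real.rpow_add hT0]
      congr 1
      rw [ha'']
      field_simp
      ring
    rw [add_mul, one_mul, e4, neg_sub 1 θ]

theorem tendsto_sharpSum_mean {p : ι → ℕ} (hp : ∀ k, 1 ≤ p k) (u : ι → ℝ) (hm : 1 ≤ m)
    {Q : Fin m → ι → ℝ} (hQ : ∀ i, ∀ y : ι → ℤ, y ≠ 0 → latticeForm (Q i) y ≠ 0) :
    Tendsto (sharpSum p u Q) atTop (𝓝 ((∑ i, sideMean p u (Q i)) / m)) := by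
  have h1 : Tendsto (fun T : ℝ => (∑ i, stripSum p u (Q i) T) / (m : ℂ)) atTop
      (𝓝 ((∑ i, sideMean p u (Q i)) / m)) :=
    (tendsto_finsetSum _ fun i _ =>
      tendsto_stripSum hp u (coeff_ne_zero_of_nonvanishing (hQ i))).div_const _
  have h2 := (tendsto_sharpSum_pow_sub hp u hm hQ).add h1
  simp only [sub_add_cancel, zero_add] at h2
  have hm0 : (0 : ℝ) < m := by exact_mod_cast hm
  refine (h2.comp (tendsto_rpow_atTop (y := (m : ℝ)⁻¹) (by positivity))).congr' ?_
  filter_upwards [eventually_ge_atTop 0] with t ht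
  simp only [Function.comp]
  rw [Real.rpow_inv_natCast_pow ht (by omega)]

end Limit

/-! ### The value of the limit -/

section Value

variable {l m : ℕ}

theorem prod_fourierSide (p : Fin l → ℕ) (u q : Fin l → ℝ) (c : ℝ) :
    ∏ k, fourierSide (p k) (u k) (c * Real.sign (q k)) =
      kappa p * ((-c) ^ (exceptional p u).card *
        ((∏ j ∈ exceptional p u, Real.sign (q j) / 2) *
          ∏ j ∈ (exceptional p u)ᶜ, periodicBernoulli (p j) (u j)) : ℝ) := by
  classical
  have h : ∀ k, fourierSide (p k) (u k) (c * Real.sign (q k)) =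
      -((2 * (Real.pi : ℂ) * Complex.I) ^ p k) / ((p k).factorial : ℂ) *
        ((if k ∈ exceptional p u then -c * (Real.sign (q k) / 2)
          else periodicBernoulli (p k) (u k) : ℝ) : ℂ) := by
    intro k
    simp only [fourierSide, fourierLimit, exceptional, Finset.mem_filter, Finset.mem_univ,
      true_and]
    split_ifs
    · congr 2
      ring
    · rfl
  simp only [h]
  rw [Finset.prod_mul_distrib, ← Complex.ofReal_prod, kappa]
  congr 2
  rw [← Finset.prod_mul_prod_compl (exceptional p u), ← mul_assoc, ← Finset.prod_const,
    ← Finset.prod_mul_distrib]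
  congr 1
  · exact Finset.prod_congr rfl fun j hj => if_pos hj
  · exact Finset.prod_congr rfl fun j hj => if_neg (Finset.mem_compl.1 hj)

theorem mean_sideMean (p : Fin l → ℕ) (u : Fin l → ℝ) (Q : Matrix (Fin m) (Fin l) ℝ) :
    (∑ i, sideMean p u (Q i)) / m = kappa p * (bernoulliQ p u Q : ℂ) := by
  have h : ∀ i, sideMean p u (Q i) = kappa p *
      ((((-1) ^ (exceptional p u).card + 1) / 2 *
        ((∏ j ∈ exceptional p u, Real.sign (Q i j) / 2) *
          ∏ j ∈ (exceptional p u)ᶜ, periodicBernoulli (p j) (u j)) : ℝ) : ℂ) := by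
    intro i
    have h1 := prod_fourierSide p u (Q i) 1
    have h2 := prod_fourierSide p u (Q i) (-1)
    simp only [one_mul, neg_one_mul, neg_neg, one_pow] at h1 h2
    rw [sideMean, h1, h2]
    push_cast
    ring
  simp only [h]
  rw [← Finset.mul_sum, mul_div_assoc, ← Complex.ofReal_sum]
  congr 1
  rw [bernoulliQ]
  split_ifs with hJ
  · rw [hJ.neg_one_pow, ← Finset.mul_sum]
    push_cast
    ring
  · rw [(Nat.not_even_iff_odd.1 hJ).neg_one_pow]
    simp

theorem tendsto_sharpSum (hl : 1 ≤ l) {p : Fin l → ℕ} (hp : ∀ k, 1 ≤ p k) (u : Fin l → ℝ)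
    (hm : 1 ≤ m) {Q : Matrix (Fin m) (Fin l) ℝ}
    (hQ : ∀ i, ∀ y : Fin l → ℤ, y ≠ 0 → latticeForm (Q i) y ≠ 0) :
    Tendsto (sharpSum p u Q) atTop (𝓝 (kappa p * (bernoulliQ p u Q : ℂ))) := by
  have : Nonempty (Fin l) := ⟨⟨0, hl⟩⟩
  rw [← mean_sideMean]
  exact tendsto_sharpSum_mean hp u hm hQ

end Value

/-! ### The blocks of a diagonal sum -/

section Blocks

variable {l n : ℕ} (h : l ≤ n) (σ : Matrix (Fin n) (Fin n) ℤ) (hd : IsDiagonal h σ)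

theorem exists_leader_eq (j : Fin n) : ∃ k, projCol h σ j = projCol h σ (leader h σ hd k) := by
  classical
  set s := Finset.univ.filter fun i => projCol h σ i = projCol h σ j
  have hs : s.Nonempty := ⟨j, by simp [s]⟩
  have hmin : projCol h σ (s.min' hs) = projCol h σ j :=
    (Finset.mem_filter.1 (s.min'_mem hs)).2
  have hmem : s.min' hs ∈ leaders h σ := by
    refine Finset.mem_filter.2 ⟨Finset.mem_univ _, fun i hi he => ?_⟩
    exact absurd (s.min'_le i (Finset.mem_filter.2 ⟨Finset.mem_univ _, he.trans hmin⟩))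
      (not_le.2 hi)
  obtain ⟨k, hk⟩ : ∃ k, leader h σ hd k = s.min' hs :=
    (Finset.range_orderEmbOfFin (leaders h σ) hd).ge hmem
  refine ⟨k, ?_⟩
  rw [hk, hmin]

theorem leader_injective {k k' : Fin l}
    (he : projCol h σ (leader h σ hd k) = projCol h σ (leader h σ hd k')) : k = k' := by
  have key : ∀ a b, a < b → projCol h σ (leader h σ hd a) ≠ projCol h σ (leader h σ hd b) := by
    intro a b hab
    have hmem : leader h σ hd b ∈ leaders h σ := Finset.orderEmbOfFin_mem _ _ _
    exact (Finset.mem_filter.1 hmem).2 _ (((leaders h σ).orderEmbOfFin hd).strictMono hab)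
  rcases lt_trichotomy k k' with hlt | heq | hgt
  · exact absurd he (key _ _ hlt)
  · exact heq
  · exact absurd he.symm (key _ _ hgt)

theorem one_le_sumType (k : Fin l) : 1 ≤ sumType h σ hd k :=
  Finset.card_pos.2 ⟨leader h σ hd k, by simp⟩

/-- The columns of a block contribute equal factors. -/
theorem prod_projCol {M : Type*} [CommMonoid M] (g : (Fin l → ℤ) → M) :
    ∏ j, g (projCol h σ j) = ∏ k, g (fun a => rho h σ hd a k) ^ sumType h σ hd k := by
  choose f hf using exists_leader_eq h σ hd
  rw [← Finset.prod_fiberwise Finset.univ f]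
  refine Finset.prod_congr rfl fun k _ => ?_
  have hfilter : ∀ j, f j = k ↔ projCol h σ j = projCol h σ (leader h σ hd k) := fun j =>
    ⟨fun e => e ▸ hf j, fun e => leader_injective h σ hd ((hf j).symm.trans e)⟩
  rw [sumType]
  simp only [← hfilter]
  rw [← Finset.prod_const]
  refine Finset.prod_congr rfl fun j hj => ?_
  rw [hf j, (Finset.mem_filter.1 hj).2]
  rfl

/-- The embedding of `ℤˡ` onto the span of the first `l` basis vectors of `ℤⁿ`. -/
noncomputable def extendZero (z : Fin l → ℤ) : Fin n → ℤ := Function.extend (Fin.castLE h) z 0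

theorem extendZero_castLE (z : Fin l → ℤ) (a : Fin l) : extendZero h z (Fin.castLE h a) = z a :=
  (Fin.castLE_injective h).extend_apply z 0 a

theorem extendZero_injective : Function.Injective (extendZero h) := fun z z' hz => by
  funext a
  rw [← extendZero_castLE h z, hz, extendZero_castLE]

theorem extendZero_of_notMem (z : Fin l → ℤ) {i : Fin n} (hi : i ∉ Set.range (Fin.castLE h)) :
    extendZero h z i = 0 :=
  Function.extend_apply' _ _ _ fun ⟨a, ha⟩ => hi ⟨a, ha⟩

theorem range_extendZero : Set.range (extendZero h) = firstLattice n l := by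
  ext x
  constructor
  · rintro ⟨z, rfl⟩ i hi
    refine extendZero_of_notMem h z ?_
    rintro ⟨a, rfl⟩
    exact absurd a.isLt (not_lt.2 hi)
  · intro hx
    refine ⟨proj h x, ?_⟩
    funext i
    by_cases hi : (i : ℕ) < l
    · exact extendZero_castLE h (proj h x) ⟨i, hi⟩
    · rw [hx i (not_lt.1 hi)]
      refine extendZero_of_notMem h _ ?_
      rintro ⟨a, rfl⟩
      exact hi a.isLt

theorem sum_extendZero_mul (z : Fin l → ℤ) (c : Fin n → ℤ) :
    ∑ i, extendZero h z i * c i = ∑ a, z a * c (Fin.castLE h a) := by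
  refine (Fintype.sum_of_injective _ (Fin.castLE_injective h) _ _ (fun i hi => ?_)
    fun a => ?_).symm
  · rw [extendZero_of_notMem h z hi, zero_mul]
  · rw [extendZero_castLE]

theorem sum_extendZero_mul_real (z : Fin l → ℤ) (c : Fin n → ℝ) :
    ∑ i, (extendZero h z i : ℝ) * c i = ∑ a, (z a : ℝ) * c (Fin.castLE h a) := by
  refine (Fintype.sum_of_injective _ (Fin.castLE_injective h) _ _ (fun i hi => ?_)
    fun a => ?_).symm
  · rw [extendZero_of_notMem h z hi, Int.cast_zero, zero_mul]
  · rw [extendZero_castLE]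

theorem denominator_extendZero (z : Fin l → ℤ) :
    denominator σ 1 (extendZero h z) =
      ∏ k, (Matrix.vecMul z (rho h σ hd)) k ^ sumType h σ hd k := by
  have h1 : denominator σ 1 (extendZero h z) = ∏ j, ∑ a, z a * projCol h σ j a := by
    refine Finset.prod_congr rfl fun j _ => ?_
    rw [Pi.one_apply, pow_one, sum_extendZero_mul h z fun i => σ i j]
    rfl
  rw [h1, prod_projCol h σ hd fun c => ∑ a, z a * c a]
  rfl

/-- A vector in the left kernel of `ρ`, extended by zero, is in the left kernel of `σ`. -/
theorem rho_det_ne_zero (hσ : σ.det ≠ 0) : (rho h σ hd).det ≠ 0 := by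
  intro hρ
  obtain ⟨z, hz, hzρ⟩ := Matrix.exists_vecMul_eq_zero_iff.2 hρ
  refine hσ (Matrix.exists_vecMul_eq_zero_iff.1 ⟨extendZero h z, fun h0 => hz ?_, ?_⟩)
  · refine extendZero_injective h (h0.trans ?_)
    funext i
    by_cases hi : i ∈ Set.range (Fin.castLE h)
    · obtain ⟨a, rfl⟩ := hi
      rw [extendZero_castLE]
      rfl
    · rw [extendZero_of_notMem h 0 hi]
      rfl
  · funext j
    obtain ⟨k, hk⟩ := exists_leader_eq h σ hd j
    have h1 := congrFun hzρ k
    change ∑ i, extendZero h z i * σ i j = 0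
    rw [sum_extendZero_mul h z fun i => σ i j]
    have h2 : ∀ a, σ (Fin.castLE h a) j = rho h σ hd a k := fun a => congrFun hk a
    simp only [h2]
    exact h1

/-- Columns attaining the index `1` are distinct columns of `ρ`, in some order. -/
theorem natAbs_det_rho_of_isUnimodular (hu : IsUnimodular h σ) :
    (rho h σ hd).det.natAbs = 1 := by
  classical
  obtain ⟨I, hI⟩ : ∃ I : Fin l → Fin n,
      (Matrix.det (Matrix.of fun a k => projCol h σ (I k) a)).natAbs = 1 := by
    by_contra hne
    push Not at hne
    have hle : index h σ ≤ 0 := by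
      refine Finset.sup_le fun I hI => ?_
      have h1 : _ ≤ index h σ := Finset.le_sup
        (f := fun I : Fin l → Fin n =>
          (Matrix.det (Matrix.of fun a k => projCol h σ (I k) a)).natAbs) hI
      rw [hu] at h1
      have h2 := hne I
      change _ ≤ 1 at h1
      omega
    rw [hu] at hle
    exact absurd hle (by norm_num)
  choose f hf using fun k => exists_leader_eq h σ hd (I k)
  have hmat : (Matrix.of fun a k => projCol h σ (I k) a) = (rho h σ hd).submatrix id f := by
    ext a k
    exact congrFun (hf k) a
  rw [hmat] at hI
  have hinj : Function.Injective f := by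
    intro a b hab
    by_contra hne
    rw [Matrix.det_zero_of_column_eq hne (by intro k; simp [hab])] at hI
    exact absurd hI (by norm_num)
  have hperm := Matrix.det_permute' (Equiv.ofBijective f (Finite.injective_iff_bijective.1 hinj))
    (rho h σ hd)
  rw [Equiv.coe_ofBijective] at hperm
  rw [hperm, Int.natAbs_mul] at hI
  exact Nat.eq_one_of_mul_eq_one_left hI

end Blocks

/-! ### Characters of `ℤˡ / ρℤˡ` -/

section CosetCharacters

variable {l : ℕ} {ρ : Matrix (Fin l) (Fin l) ℤ}

theorem det_realMatrix : (realMatrix ρ).det = (ρ.det : ℝ) := (Int.cast_det ρ).symm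

theorem isUnit_det_realMatrix (hρ : ρ.det ≠ 0) : IsUnit (realMatrix ρ).det := by
  rw [det_realMatrix]
  exact isUnit_iff_ne_zero.2 (by exact_mod_cast hρ)

theorem realMatrix_mulVec_cast (z : Fin l → ℤ) :
    (realMatrix ρ).mulVec (fun a => (z a : ℝ)) = fun a => ((ρ.mulVec z a : ℤ) : ℝ) := by
  funext a
  simp [realMatrix, Matrix.mulVec, dotProduct]

theorem vecMul_realMatrix_cast (z : Fin l → ℤ) :
    Matrix.vecMul (fun a => (z a : ℝ)) (realMatrix ρ) =
      fun a => ((Matrix.vecMul z ρ a : ℤ) : ℝ) := by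
  funext a
  simp [realMatrix, Matrix.vecMul, dotProduct]

theorem natCard_cosets (hρ : ρ.det ≠ 0) : Nat.card (Cosets ρ) = ρ.det.natAbs := by
  have hinj : Function.Injective ρ.mulVecLin := by
    rw [injective_iff_map_eq_zero]
    exact fun z hz => Matrix.eq_zero_of_mulVec_eq_zero hρ hz
  rw [← Submodule.natAbs_det_equiv _ (LinearEquiv.ofInjective ρ.mulVecLin hinj),
    ← LinearMap.det_toLin']
  rfl

/-- The pairing `⟨y, ρ⁻¹ r⟩`. -/
noncomputable def pairing (ρ : Matrix (Fin l) (Fin l) ℤ) (y r : Fin l → ℤ) : ℝ :=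
  latticeForm ((realMatrix ρ)⁻¹.mulVec fun a => (r a : ℝ)) y

theorem pairing_eq (y r : Fin l → ℤ) :
    pairing ρ y r = ∑ a, Matrix.vecMul (fun k => (y k : ℝ)) (realMatrix ρ)⁻¹ a * r a := by
  have := Matrix.dotProduct_mulVec (fun k => (y k : ℝ)) (realMatrix ρ)⁻¹ fun a => (r a : ℝ)
  refine Eq.trans ?_ this
  rw [dotProduct_comm]
  rfl

theorem pairing_add (y r r' : Fin l → ℤ) :
    pairing ρ y (r + r') = pairing ρ y r + pairing ρ y r' := by
  rw [pairing_eq, pairing_eq, pairing_eq, ← Finset.sum_add_distrib]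
  refine Finset.sum_congr rfl fun a _ => ?_
  rw [Pi.add_apply]
  push_cast
  ring

theorem pairing_mulVec (hρ : ρ.det ≠ 0) (y z : Fin l → ℤ) :
    pairing ρ y (ρ.mulVec z) = ((∑ k, z k * y k : ℤ) : ℝ) := by
  rw [pairing, ← realMatrix_mulVec_cast, Matrix.mulVec_mulVec,
    Matrix.nonsing_inv_mul _ (isUnit_det_realMatrix hρ), Matrix.one_mulVec, latticeForm]
  push_cast
  rfl

theorem pairing_vecMul (hρ : ρ.det ≠ 0) (z r : Fin l → ℤ) :
    pairing ρ (Matrix.vecMul z ρ) r = ((∑ a, z a * r a : ℤ) : ℝ) := by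
  rw [pairing_eq, ← vecMul_realMatrix_cast, Matrix.vecMul_vecMul,
    Matrix.mul_nonsing_inv _ (isUnit_det_realMatrix hρ), Matrix.vecMul_one]
  push_cast
  rfl

/-- `r ↦ 𝐞(⟨y, ρ⁻¹ r⟩)` is well defined on `ℤˡ / ρℤˡ`. -/
theorem character_pairing_out (hρ : ρ.det ≠ 0) (y r : Fin l → ℤ) :
    character (pairing ρ y (Quotient.out (Submodule.Quotient.mk r : Cosets ρ))) =
      character (pairing ρ y r) := by
  set r' := Quotient.out (Submodule.Quotient.mk r : Cosets ρ)
  have hr' : (Submodule.Quotient.mk r' : Cosets ρ) = Submodule.Quotient.mk r := Quotient.out_eq _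
  obtain ⟨z, hz⟩ := (Submodule.Quotient.eq _).1 hr'
  rw [Matrix.mulVecLin_apply] at hz
  have : r' = r + ρ.mulVec z := by rw [hz]; abel
  rw [this, pairing_add, pairing_mulVec hρ, character_add_intCast]

open Classical in
/-- Orthogonality of characters: the mean over `ℤˡ / ρℤˡ` detects the lattice `ρᵗℤˡ`. -/
theorem sum_character_pairing [Fintype (Cosets ρ)] (hρ : ρ.det ≠ 0) (y : Fin l → ℤ) :
    ∑ r : Cosets ρ, character (pairing ρ y r.out) =
      if ∃ z, Matrix.vecMul z ρ = y then (Fintype.card (Cosets ρ) : ℂ) else 0 := by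
  split_ifs with hy
  · obtain ⟨z, rfl⟩ := hy
    simp only [pairing_vecMul hρ, character_intCast]
    simp
  · obtain ⟨r₀, hr₀⟩ : ∃ r₀, character (pairing ρ y r₀) ≠ 1 := by
      by_contra hall
      push Not at hall
      have hint : ∀ a, ∃ k : ℤ,
          Matrix.vecMul (fun k => (y k : ℝ)) (realMatrix ρ)⁻¹ a = k := by
        intro a
        by_contra hne
        push Not at hne
        refine character_ne_one hne ?_
        have := hall (Pi.single a 1)
        rw [pairing_eq, Finset.sum_eq_single a] at this
        · simpa using this
        · intro b _ hb
          simp [hb]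
        · simp
      choose z hz using hint
      refine hy ⟨z, ?_⟩
      have h1 : Matrix.vecMul (fun a => (z a : ℝ)) (realMatrix ρ) = fun k => (y k : ℝ) := by
        rw [← funext hz, Matrix.vecMul_vecMul,
          Matrix.nonsing_inv_mul _ (isUnit_det_realMatrix hρ), Matrix.vecMul_one]
      rw [vecMul_realMatrix_cast] at h1
      funext k
      exact_mod_cast congrFun h1 k
    have hshift : ∑ r : Cosets ρ, character (pairing ρ y r.out) =
        character (pairing ρ y r₀) * ∑ r : Cosets ρ, character (pairing ρ y r.out) := by
      rw [Finset.mul_sum]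
      refine (Equiv.sum_comp (Equiv.addRight (Submodule.Quotient.mk r₀ : Cosets ρ))
        fun r => character (pairing ρ y r.out)).symm.trans (Finset.sum_congr rfl fun r _ => ?_)
      have hr : Equiv.addRight (Submodule.Quotient.mk r₀ : Cosets ρ) r =
          Submodule.Quotient.mk (r.out + r₀) := by
        rw [Equiv.coe_addRight, Submodule.Quotient.mk_add]
        congr 1
        exact (Quotient.out_eq r).symm
      simp only [hr]
      rw [character_pairing_out hρ, pairing_add, character_add, mul_comm]
    have h2 : (1 - character (pairing ρ y r₀)) *
        ∑ r : Cosets ρ, character (pairing ρ y r.out) = 0 := by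
      rw [sub_mul, one_mul, ← hshift, sub_self]
    exact (mul_eq_zero.1 h2).resolve_left (sub_ne_zero.2 hr₀.symm)

/-- A shift of `r` multiplies the general term by a character of `ℤˡ / ρℤˡ`. -/
theorem diagTerm_uVec (p : Fin l → ℕ) (w : Fin l → ℝ) (r y : Fin l → ℤ) :
    diagTerm p (uVec ρ w r) y = diagTerm p (uVec ρ w 0) y * character (pairing ρ y r) := by
  have h := diagTerm_mul_character p (uVec ρ w 0)
    ((realMatrix ρ)⁻¹.mulVec fun a => (r a : ℝ)) y 1
  rw [mul_one] at h
  rw [pairing, h]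
  congr 1
  have h1 : (fun a => (r a : ℝ) + w a) = (fun a => (((0 : Fin l → ℤ) a : ℤ) : ℝ) + w a) +
      fun a => (r a : ℝ) := by
    funext a
    simp [add_comm]
  rw [uVec, h1, Matrix.mulVec_add]
  funext k
  rw [mul_one]
  rfl

theorem vecMul_injective (hρ : ρ.det ≠ 0) : Function.Injective fun z => Matrix.vecMul z ρ := by
  intro z z' hz
  have h0 : Matrix.vecMul (z - z') ρ = 0 := by
    rw [Matrix.sub_vecMul, sub_eq_zero]
    exact hz
  exact sub_eq_zero.1 (Matrix.eq_zero_of_vecMul_eq_zero hρ h0)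

end CosetCharacters

/-! ### Reduction of a diagonal sum to sums over `ℤˡ` -/

section CosetSums

variable {l m : ℕ} {ρ : Matrix (Fin l) (Fin l) ℤ}

open Classical in
/-- Averaging over `ℤˡ / ρℤˡ` restricts the summation to the lattice `ρᵗℤˡ`. -/
theorem sum_cosets_sharpSum [Fintype (Cosets ρ)] (hl : 1 ≤ l) (hm : 1 ≤ m) (hρ : ρ.det ≠ 0)
    {p : Fin l → ℕ} (hp : ∀ k, 1 ≤ p k) (w : Fin l → ℝ) {Q : Fin m → Fin l → ℝ}
    (hQ : ∀ i j, Q i j ≠ 0) (t : ℝ) :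
    ∑ r : Cosets ρ, sharpSum p (uVec ρ w r.out) Q t =
      Fintype.card (Cosets ρ) * ∑' z : Fin l → ℤ,
        if |∏ i, latticeForm (Q i) (Matrix.vecMul z ρ)| < t then
          diagTerm p (uVec ρ w 0) (Matrix.vecMul z ρ) else 0 := by
  have : Nonempty (Fin l) := ⟨⟨0, hl⟩⟩
  have hsum : ∑ r : Cosets ρ, sharpSum p (uVec ρ w r.out) Q t =
      ∑' y : Fin l → ℤ, (Fintype.card (Cosets ρ) : ℂ) *
        if ∃ z, Matrix.vecMul z ρ = y then
          if |∏ i, latticeForm (Q i) y| < t then diagTerm p (uVec ρ w 0) y else 0 else 0 := by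
    simp only [sharpSum]
    rw [← Summable.tsum_finsetSum fun r _ => summable_sharp hp _ hm hQ t]
    refine tsum_congr fun y => ?_
    by_cases ht : |∏ i, latticeForm (Q i) y| < t
    · simp only [if_pos ht]
      rw [Finset.sum_congr rfl fun r _ => diagTerm_uVec p w _ y, ← Finset.mul_sum,
        sum_character_pairing hρ]
      split_ifs <;> ring
    · simp only [if_neg ht, ite_self, Finset.sum_const_zero, mul_zero]
  rw [hsum, tsum_mul_left, ← (vecMul_injective hρ).tsum_eq]
  · congr 1
    exact tsum_congr fun z => if_pos ⟨z, rfl⟩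
  · intro y hy
    by_contra hne
    exact hy (if_neg hne)

theorem vecMul_inv_transpose_dotProduct {R : Matrix (Fin l) (Fin l) ℝ} (hR : IsUnit R.det)
    (q z : Fin l → ℝ) :
    dotProduct (Matrix.vecMul q R.transpose⁻¹) (Matrix.vecMul z R) = dotProduct z q := by
  rw [← Matrix.mulVec_transpose R, Matrix.dotProduct_mulVec, Matrix.vecMul_vecMul,
    Matrix.nonsing_inv_mul _ (by rwa [Matrix.det_transpose]), Matrix.vecMul_one, dotProduct_comm]

end CosetSums

section Reduction

variable {l m n : ℕ} (h : l ≤ n) (σ : Matrix (Fin n) (Fin n) ℤ) (hd : IsDiagonal h σ)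
  (v : Fin n → ℝ) (Q : Matrix (Fin m) (Fin n) ℝ)

/-- The general term in the coordinates `y = ρᵗ z`. -/
theorem term_extendZero (hρ : (rho h σ hd).det ≠ 0) (z : Fin l → ℤ) :
    term σ 1 v (extendZero h z) = (σ.det : ℂ) *
      diagTerm (sumType h σ hd) (uVec (rho h σ hd) (proj h v) 0)
        (Matrix.vecMul z (rho h σ hd)) := by
  set ρ := rho h σ hd
  set y := Matrix.vecMul z ρ with hy
  have harg : ∑ i, (extendZero h z i : ℝ) * v i =
      ∑ k, (y k : ℝ) * uVec ρ (proj h v) 0 k := by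
    rw [sum_extendZero_mul_real]
    change dotProduct (fun a => (z a : ℝ)) (proj h v) = dotProduct (fun k => (y k : ℝ)) _
    rw [hy, ← vecMul_realMatrix_cast, ← Matrix.dotProduct_mulVec, uVec, Matrix.mulVec_mulVec,
      Matrix.mul_nonsing_inv _ (isUnit_det_realMatrix hρ), Matrix.one_mulVec]
    congr 1
    funext a
    simp
  rw [term, denominator_extendZero h σ hd, harg, diagTerm, character_sum]
  simp only [fourierTerm]
  rw [Finset.prod_div_distrib]
  push_cast
  ring

theorem sum_transformedForms (hρ : (rho h σ hd).det ≠ 0) (i : Fin m) (z : Fin l → ℤ) :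
    latticeForm (transformedForms h (rho h σ hd) Q i) (Matrix.vecMul z (rho h σ hd)) =
      ∑ j, Q i j * (extendZero h z j : ℝ) := by
  set ρ := rho h σ hd
  have h1 : ∑ j, Q i j * (extendZero h z j : ℝ) = ∑ a, (z a : ℝ) * Q i (Fin.castLE h a) := by
    rw [← sum_extendZero_mul_real]
    exact Finset.sum_congr rfl fun j _ => mul_comm _ _
  have h2 := vecMul_inv_transpose_dotProduct (isUnit_det_realMatrix hρ) (proj h (Q i))
    fun a => (z a : ℝ)
  rw [vecMul_realMatrix_cast] at h2
  exact h2.trans h1.symm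

/-- Every integral vector has a multiple in `ρᵗℤˡ`, where the forms are restrictions of
the given ones. -/
theorem transformedForms_ne_zero (hρ : (rho h σ hd).det ≠ 0)
    (hQ : ∀ i, ∀ y : Fin n → ℚ, y ≠ 0 → ∑ j, Q i j * (y j : ℝ) ≠ 0) (i : Fin m)
    (y : Fin l → ℤ) (hy : y ≠ 0) :
    latticeForm (transformedForms h (rho h σ hd) Q i) y ≠ 0 := by
  intro h0
  set ρ := rho h σ hd
  set z := Matrix.vecMul y ρ.adjugate with hz
  have hzρ : Matrix.vecMul z ρ = fun k => ρ.det * y k := by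
    rw [hz, Matrix.vecMul_vecMul, Matrix.adjugate_mul, Matrix.vecMul_smul, Matrix.vecMul_one]
    rfl
  have hz0 : z ≠ 0 := by
    intro hz0
    rw [hz0, Matrix.zero_vecMul] at hzρ
    refine hy (funext fun k => ?_)
    exact (mul_eq_zero.1 (congrFun hzρ k).symm).resolve_left hρ
  have h1 := sum_transformedForms h σ hd Q hρ i z
  change latticeForm (transformedForms h ρ Q i) (Matrix.vecMul z ρ) = _ at h1
  have h2 : latticeForm (transformedForms h ρ Q i) (fun k => ρ.det * y k) =
      ρ.det * latticeForm (transformedForms h ρ Q i) y := by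
    rw [latticeForm, latticeForm, Finset.mul_sum]
    refine Finset.sum_congr rfl fun k _ => ?_
    push_cast
    ring
  rw [hzρ, h2, h0, mul_zero] at h1
  refine hQ i (fun j => (extendZero h z j : ℚ)) (fun he => hz0 ?_) ?_
  · funext a
    have := congrFun he (Fin.castLE h a)
    simp only [extendZero_castLE, Pi.zero_apply] at this
    simpa using this
  · rw [h1]
    exact Finset.sum_congr rfl fun j _ => by simp

open Classical in
/-- The terms with vanishing denominator need no separate treatment: they are zero by the
convention `x / 0 = 0`. -/
theorem indicator_truncation_extendZero (hρ : (rho h σ hd).det ≠ 0) (t : ℝ) (z : Fin l → ℤ) :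
    (truncation (firstLattice n l) σ 1 Q t).indicator (term σ 1 v) (extendZero h z) =
      (σ.det : ℂ) * if |∏ i, latticeForm (transformedForms h (rho h σ hd) Q i)
          (Matrix.vecMul z (rho h σ hd))| < t then
        diagTerm (sumType h σ hd) (uVec (rho h σ hd) (proj h v) 0)
          (Matrix.vecMul z (rho h σ hd)) else 0 := by
  have hmem : extendZero h z ∈ firstLattice n l := by
    rw [← SetLike.mem_coe, ← range_extendZero h]
    exact ⟨z, rfl⟩
  simp only [sum_transformedForms h σ hd Q hρ]
  rw [mul_ite, mul_zero, ← term_extendZero h σ hd v hρ]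
  change _ = if |productOfForms Q fun j => (extendZero h z j : ℝ)| < t then _ else _
  by_cases hden : denominator σ 1 (extendZero h z) = 0
  · have h0 : term σ 1 v (extendZero h z) = 0 := by
      rw [term, hden, Int.cast_zero, div_zero]
    rw [h0, ite_self, Set.indicator_apply_eq_zero]
    exact fun _ => h0
  · rw [Set.indicator_apply]
    congr 1
    exact propext ⟨fun hx => hx.2.2, fun hx => ⟨hmem, hden, hx⟩⟩

theorem support_indicator_truncation (t : ℝ) :
    Function.support ((truncation (firstLattice n l) σ 1 Q t).indicator (term σ 1 v)) ⊆
      Set.range (extendZero h) := by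
  intro x hx
  rw [range_extendZero]
  exact (Set.indicator_apply_ne_zero.1 hx).1.1

theorem summable_truncation (hl : 1 ≤ l) (hm : 1 ≤ m) (hρ : (rho h σ hd).det ≠ 0)
    (hQ : ∀ i, ∀ y : Fin n → ℚ, y ≠ 0 → ∑ j, Q i j * (y j : ℝ) ≠ 0) (t : ℝ) :
    Summable fun x : truncation (firstLattice n l) σ 1 Q t => term σ 1 v x := by
  classical
  have : Nonempty (Fin l) := ⟨⟨0, hl⟩⟩
  change Summable (term σ 1 v ∘ Subtype.val)
  rw [summable_subtype_iff_indicator, ← (extendZero_injective h).summable_iff fun x hx => by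
    by_contra hne
    exact hx (support_indicator_truncation h σ v Q t hne)]
  refine Summable.congr ?_ fun z => (indicator_truncation_extendZero h σ hd v Q hρ t z).symm
  exact ((summable_sharp (one_le_sumType h σ hd) (uVec (rho h σ hd) (proj h v) 0) hm
    (fun i => coeff_ne_zero_of_nonvanishing (transformedForms_ne_zero h σ hd Q hρ hQ i))
    t).comp_injective (vecMul_injective hρ)).mul_left _

/-- The truncated Dedekind sum as a mean of sums over the full lattice `ℤˡ`. -/
theorem tsum_truncation [Fintype (Cosets (rho h σ hd))] (hl : 1 ≤ l) (hm : 1 ≤ m)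
    (hρ : (rho h σ hd).det ≠ 0)
    (hQ : ∀ i, ∀ y : Fin n → ℚ, y ≠ 0 → ∑ j, Q i j * (y j : ℝ) ≠ 0) (t : ℝ) :
    ∑' x : truncation (firstLattice n l) σ 1 Q t, term σ 1 v x =
      (σ.det : ℂ) / (Fintype.card (Cosets (rho h σ hd)) : ℂ) *
        ∑ r : Cosets (rho h σ hd), sharpSum (sumType h σ hd)
          (uVec (rho h σ hd) (proj h v) r.out) (transformedForms h (rho h σ hd) Q) t := by
  classical
  have hcard : (Fintype.card (Cosets (rho h σ hd)) : ℂ) ≠ 0 := by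
    exact_mod_cast Fintype.card_ne_zero
  have hQ0 : ∀ i j, transformedForms h (rho h σ hd) Q i j ≠ 0 := fun i =>
    coeff_ne_zero_of_nonvanishing (transformedForms_ne_zero h σ hd Q hρ hQ i)
  rw [sum_cosets_sharpSum hl hm hρ (one_le_sumType h σ hd) (proj h v) hQ0 t, ← mul_assoc,
    div_mul_cancel₀ _ hcard, tsum_subtype,
    ← (extendZero_injective h).tsum_eq (support_indicator_truncation h σ v Q t), ← tsum_mul_left]
  exact tsum_congr fun z => indicator_truncation_extendZero h σ hd v Q hρ t z

theorem cosetTerm_out (ρ : Matrix (Fin l) (Fin l) ℤ) (p : Fin l → ℕ) (w : Fin l → ℝ)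
    (Q' : Matrix (Fin m) (Fin l) ℝ) (r : Cosets ρ) :
    cosetTerm ρ p w Q' r = bernoulliQ p (uVec ρ w r.out) Q' := by
  conv_lhs => rw [← Quotient.out_eq r]
  rfl

theorem hasQLimit_of_det_rho_ne_zero (hl : 1 ≤ l) (hm : 1 ≤ m) (hρ : (rho h σ hd).det ≠ 0)
    (hQ : ∀ i, ∀ y : Fin n → ℚ, y ≠ 0 → ∑ j, Q i j * (y j : ℝ) ≠ 0) :
    HasQLimit (firstLattice n l) σ 1 v Q
      (kappa (sumType h σ hd) * (σ.det : ℂ) / ((|(rho h σ hd).det| : ℤ) : ℂ) *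
        ∑ᶠ r : Cosets (rho h σ hd), (cosetTerm (rho h σ hd) (sumType h σ hd) (proj h v)
          (transformedForms h (rho h σ hd) Q) r : ℂ)) := by
  have hcard := natCard_cosets hρ
  have : Finite (Cosets (rho h σ hd)) := Nat.finite_of_card_ne_zero (by
    rw [hcard]
    exact Int.natAbs_ne_zero.2 hρ)
  have : Fintype (Cosets (rho h σ hd)) := Fintype.ofFinite _
  refine ⟨summable_truncation h σ hd v Q hl hm hρ hQ, ?_⟩
  simp only [tsum_truncation h σ hd v Q hl hm hρ hQ]
  have hlim := (tendsto_finsetSum Finset.univ fun (r : Cosets (rho h σ hd)) _ =>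
    tendsto_sharpSum hl (one_le_sumType h σ hd) (uVec (rho h σ hd) (proj h v) r.out) hm
      (transformedForms_ne_zero h σ hd Q hρ hQ)).const_mul
        ((σ.det : ℂ) / (Fintype.card (Cosets (rho h σ hd)) : ℂ))
  have hC : (Fintype.card (Cosets (rho h σ hd)) : ℂ) = ((|(rho h σ hd).det| : ℤ) : ℂ) := by
    rw [← Nat.card_eq_fintype_card, hcard, ← Int.natCast_natAbs, Int.cast_natCast]
  rw [finsum_eq_sum_of_fintype]
  simp only [cosetTerm_out]
  rw [← Finset.mul_sum, hC] at hlim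
  rw [hC]
  convert hlim using 2
  ring

/-- If `ρ` is singular, then so is `σ`, and all terms vanish. -/
theorem hasQLimit_zero_of_det_rho_eq_zero (hρ : (rho h σ hd).det = 0) :
    HasQLimit (firstLattice n l) σ 1 v Q 0 := by
  have hσ : σ.det = 0 := by
    by_contra hne
    exact rho_det_ne_zero h σ hd hne hρ
  have h0 : ∀ x, term σ 1 v x = 0 := fun x => by
    rw [term, hσ, Int.cast_zero, mul_zero, zero_div]
  simp only [HasQLimit, h0]
  exact ⟨fun t => summable_zero, by simp⟩

end Reduction

end DedekindSum

open DedekindSum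

theorem proposition3p6 {l m n : ℕ} (hl : 1 ≤ l) (hln : l ≤ n) (hm : 1 ≤ m)
    (σ : Matrix (Fin n) (Fin n) ℤ) (v : Fin n → ℝ)
    (Q : Matrix (Fin m) (Fin n) ℝ)
    (hQ : ∀ i, ∀ y : Fin n → ℚ, y ≠ 0 → ∑ j, Q i j * (y j : ℝ) ≠ 0)
    (hnorm : IsNormalized hln σ) (hdiag : IsDiagonal hln σ) :
    -- the `Q`-limit is well defined
    (∃ s : ℂ, HasQLimit (firstLattice n l) σ 1 v Q s) ∧
    -- `ρ` is invertible as soon as `σ` is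
    (σ.det ≠ 0 → (rho hln σ hdiag).det ≠ 0) ∧
    -- the finite sum formula
    ((rho hln σ hdiag).det ≠ 0 →
      Finite (Cosets (rho hln σ hdiag)) ∧
      HasQLimit (firstLattice n l) σ 1 v Q
        (kappa (sumType hln σ hdiag) * (σ.det : ℂ) / ((|(rho hln σ hdiag).det| : ℤ) : ℂ) *
          ∑ᶠ r : Cosets (rho hln σ hdiag),
            (cosetTerm (rho hln σ hdiag) (sumType hln σ hdiag) (proj hln v)
              (transformedForms hln (rho hln σ hdiag) Q) r : ℂ))) ∧
    -- the unimodular case: only one term, and the resulting value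
    (IsUnimodular hln σ →
      Nat.card (Cosets (rho hln σ hdiag)) = 1 ∧
      HasQLimit (firstLattice n l) σ 1 v Q
        (kappa (sumType hln σ hdiag) * (σ.det : ℂ) *
          (bernoulliQ (sumType hln σ hdiag) (uVec (rho hln σ hdiag) (proj hln v) 0)
            (transformedForms hln (rho hln σ hdiag) Q) : ℂ))) := by
  refine ⟨?_, rho_det_ne_zero hln σ hdiag, fun hρ => ⟨?_, ?_⟩, fun hu => ?_⟩
  · by_cases hρ : (rho hln σ hdiag).det = 0
    · exact ⟨0, hasQLimit_zero_of_det_rho_eq_zero hln σ hdiag v Q hρ⟩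
    · exact ⟨_, hasQLimit_of_det_rho_ne_zero hln σ hdiag v Q hl hm hρ hQ⟩
  · refine Nat.finite_of_card_ne_zero ?_
    rw [natCard_cosets hρ]
    exact Int.natAbs_ne_zero.2 hρ
  · exact hasQLimit_of_det_rho_ne_zero hln σ hdiag v Q hl hm hρ hQ
  · have hdet := natAbs_det_rho_of_isUnimodular hln σ hdiag hu
    have hρ : (rho hln σ hdiag).det ≠ 0 := by
      intro h0
      rw [h0] at hdet
      exact absurd hdet (by norm_num)
    have hcard : Nat.card (Cosets (rho hln σ hdiag)) = 1 := by rw [natCard_cosets hρ, hdet]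
    refine ⟨hcard, ?_⟩
    have hlim := hasQLimit_of_det_rho_ne_zero hln σ hdiag v Q hl hm hρ hQ
    have habs : |(rho hln σ hdiag).det| = 1 := by
      rw [← Int.natCast_natAbs, hdet, Nat.cast_one]
    have := (Nat.card_eq_one_iff_unique.1 hcard).1
    rw [finsum_eq_single _ (Submodule.Quotient.mk 0 : Cosets (rho hln σ hdiag))
      fun r hr => absurd (Subsingleton.elim _ _) hr, habs, Int.cast_one, div_one] at hlim
    exact hlim
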